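/- **Conventions.** Graphs are finite and simple. $N[v]$ is the closed neighbourhood of a vertex $v$, $N(D)$ is the set of vertices outside $D$ with a neighbour in $D$, $N[D]=D\cup N(D)$, and $N^d[v]$ is the set of vertices at distance at most $d$ from $v$. For $w:V(G)\to[0,1]$ and $X\subseteq V(G)$ put $w(X)=\sum_{x\in X}w(x)$ and $w(G)=w(V(G))$. A set $X\subseteq V(G)$ is a *$d$-bounded $(w,c)$-balanced separator* of $G$ if $X\subseteq N^d[v]$ for some $v\in V(G)$ and every connected component $D$ of $G\setminus X$ satisfies $w(D)\le c$. A vertex $v$ *breaks* a set $X\subseteq V(G)\setminus\{v\}$ if no connected component $D$ of $G\setminus N[v]$ satisfies $X\subseteq N[D]$. A graph $G$ is *perfect* if $\chi(H)=\omega(H)$ for every induced subgraph $H$ of $G$. It is *paw-friendly* if it is perfect and, for every induced subgraph $H$ of $G$ and all vertices $c,a,b_1,b_2$ of $H$ that induce in $H$ a paw with edge set $\{ab_1,ab_2,b_1b_2,ac\}$, in the graph $H$ either $a$ breaks $\{c,b_1,b_2\}$, or $b_1$ breaks $\{c,b_2\}$, or $b_2$ breaks $\{c,b_1\}$. A set $X$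 is an *even set* in $G$ if for all distinct $x,y\in X$ every induced path of $G$ from $x$ to $y$ has even length. A *$(w,k,c,d)$-even set separator* of $G$ is a sequence $(X_1,\dots,X_k)$ of pairwise disjoint (possibly empty) subsets of $V(G)$ such that each $X_i$ is an even set in $G\setminus\bigcup_{j<i}X_j$, and every connected component $D$ of $G\setminus\bigcup_iX_i$ satisfies $|N(D)|\le d$ and $w(D)\le c$. **Lemma.** Let $c\in[\frac12,1)$ and let $d,\delta$ be positive integers with $d\ge\delta+3$. Let $G$ be a connected paw-friendly graph on $n$ vertices with maximum degree at most $\delta$, let $w:V(G)\to[0,1]$ satisfy $w(G)=1$, and suppose that $G$ has no $d$-bounded $(w,c)$-balanced separator. Then $G$ has a $(w,\delta^2+2,c,\delta+1)$-even set separator $(X_1,X_2,L_1,\dots,L_{\delta^2})$, and such a sequence can be computed in time $\mathcal O(n^3)$: for all $c,d,\delta$ as above there are one algorithm and one constant $C$ such that, for all $n$, $G$ and $w$ as above, the algorithm, given the adjacency matrix of $G$ on the vertex set $\{0,\dots,n-1\}$, the weights $w$ and the number $c$, halts after at most $Cn^3$ steps and outputs such a sequence (in the form of the index of the set containing $v$,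 for each vertex $v$ that lies in one of the sets). Here an algorithm is a program of a random access machine with unit costs, which operates on natural numbers by adding or subtracting $1$ and comparing, and on real numbers by adding, subtracting and comparing. -/

import Mathlib

noncomputable section

namespace EvenSep

open SimpleGraph

/-! ### Graphs -/

section Graph

variable {V : Type*}

/-- The closed neighbourhood `N[v]` of a vertex. -/
def closedNbhd (G : SimpleGraph V) (v : V) : Set V := {u | u = v ∨ G.Adj v u}

/-- The neighbourhood `N(D)` of a set: the vertices outside `D` with a neighbour in `D`. -/
def setNbhd (G : SimpleGraph V) (D : Set V) : Set V := {u | u ∉ D ∧ ∃ x ∈ D, G.Adj x u}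

/-- `D` is (the vertex set of) a connected component of the induced subgraph `G[S]`. -/
def IsComponentOf (G : SimpleGraph V) (S D : Set V) : Prop :=
  ∃ K : (G.induce S).ConnectedComponent, D = Subtype.val '' K.supp

/-- The ball `N^d[v]`: the vertices at distance at most `d` from `v`
(`edist` is infinite between different components). -/
def ball (G : SimpleGraph V) (d : ℕ) (v : V) : Set V := {u | G.edist v u ≤ (d : ℕ∞)}

/-- `X` is `d`-bounded: it lies in `N^d[v]` for some vertex `v`. -/
def IsBounded (G : SimpleGraph V) (d : ℕ) (X : Set V) : Prop := ∃ v : V, X ⊆ ball G d v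

/-- The weight `w(X)` of a vertex set. -/
def weight [Fintype V] (w : V → ℝ) (X : Set V) : ℝ := ∑ v, X.indicator w v

/-- `X` is a `(w, c)`-balanced separator: all components of `G ∖ X` have weight at most `c`. -/
def IsBalancedSeparator [Fintype V] (G : SimpleGraph V) (w : V → ℝ) (c : ℝ) (X : Set V) : Prop :=
  ∀ D : Set V, IsComponentOf G Xᶜ D → weight w D ≤ c

/-- A graph is perfect if `χ(H) = ω(H)` for every induced subgraph `H`. -/
def IsPerfect (G : SimpleGraph V) : Prop :=
  ∀ S : Set V, (G.induce S).chromaticNumber = ((G.induce S).cliqueNum : ℕ∞)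

/-- `v` breaks `X ⊆ V(G) ∖ {v}`: no component `D` of `G ∖ N[v]` has `X ⊆ N[D]`. -/
def Breaks (G : SimpleGraph V) (v : V) (X : Set V) : Prop :=
  v ∉ X ∧ ∀ D : Set V, IsComponentOf G (closedNbhd G v)ᶜ D → ¬ X ⊆ D ∪ setNbhd G D

/-- `{c, a, b₁, b₂}` induces a paw in `G`, with edges `a b₁`, `a b₂`, `b₁ b₂`, `a c`
(the four vertices are then automatically distinct). -/
def IsPaw (G : SimpleGraph V) (c a b₁ b₂ : V) : Prop :=
  G.Adj a b₁ ∧ G.Adj a b₂ ∧ G.Adj b₁ b₂ ∧ G.Adj a c ∧ ¬ G.Adj c b₁ ∧ ¬ G.Adj c b₂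

/-- Paw-friendly graphs. The breaking takes place in the induced subgraph `H = G[S]`. -/
def PawFriendly (G : SimpleGraph V) : Prop :=
  IsPerfect G ∧ ∀ (S : Set V) (c a b₁ b₂ : S), IsPaw (G.induce S) c a b₁ b₂ →
    Breaks (G.induce S) a {c, b₁, b₂} ∨ Breaks (G.induce S) b₁ {c, b₂} ∨
      Breaks (G.induce S) b₂ {c, b₁}

/-- `p` is an induced path: a path all of whose chords in `G` are edges of `p`. -/
def IsInducedPath (G : SimpleGraph V) {x y : V} (p : G.Walk x y) : Prop :=
  p.IsPath ∧ ∀ u ∈ p.support, ∀ v ∈ p.support, G.Adj u v → s(u, v) ∈ p.edges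

/-- `{x, y}` is an even pair: every induced path from `x` to `y` has even length. -/
def IsEvenPair (G : SimpleGraph V) (x y : V) : Prop :=
  ∀ p : G.Walk x y, IsInducedPath G p → Even p.length

/-- `X` is an even set: every two distinct vertices of `X` form an even pair. -/
def IsEvenSet (G : SimpleGraph V) (X : Set V) : Prop :=
  ∀ x ∈ X, ∀ y ∈ X, x ≠ y → IsEvenPair G x y

/-- `(X₁, …, X_k)` is a `k`-iterated even set: the `X_i` are pairwise disjoint, and each `X_i` is
an even set in the graph `G ∖ ⋃_{j < i} X_j`. -/
def IsIteratedEvenSet (G : SimpleGraph V) {k : ℕ} (X : Fin k → Set V) : Prop :=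
  (∀ i j, i ≠ j → Disjoint (X i) (X j)) ∧
    ∀ i, IsEvenSet (G.induce (⋃ j, ⋃ _ : j < i, X j)ᶜ) (Subtype.val ⁻¹' X i)

/-- `(X₁, …, X_k)` is a `(w, k, c, d)`-even set separator of `G`. -/
def IsEvenSetSeparator [Fintype V] (G : SimpleGraph V) (w : V → ℝ) (k : ℕ) (c : ℝ) (d : ℕ)
    (X : Fin k → Set V) : Prop :=
  IsIteratedEvenSet G X ∧
    ∀ D : Set V, IsComponentOf G (⋃ i, X i)ᶜ D → (setNbhd G D).ncard ≤ d ∧ weight w D ≤ c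

end Graph

/-! ### A random access machine with a step count

The memory consists of two-dimensional arrays of natural numbers and one-dimensional arrays of real
numbers, each named by a natural number. Array names are literals of the program, indices are
computed. The only arithmetic on natural numbers is `+ 1` and `- 1`, so that all integers occurring
in a run are bounded linearly by the input values plus the number of steps; real numbers
can only be added, subtracted and compared. -/

/-- A memory state. -/
structure State where
  nat : ℕ → ℕ → ℕ → ℕ
  real : ℕ → ℕ → ℝ

/-- Integer expressions: literals, array reads, `+ 1`, `- 1`. -/
inductive NExpr where
  | const (k : ℕ) : NExpr
  | read (a : ℕ) (i j : NExpr) : NExpr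
  | succ (e : NExpr) : NExpr
  | pred (e : NExpr) : NExpr

/-- The value of an integer expression. -/
def NExpr.eval (s : State) : NExpr → ℕ
  | .const k => k
  | .read a i j => s.nat a (i.eval s) (j.eval s)
  | .succ e => e.eval s + 1
  | .pred e => e.eval s - 1

/-- Real expressions: zero, array reads, sums and differences. -/
inductive RExpr where
  | zero : RExpr
  | read (a : ℕ) (i : NExpr) : RExpr
  | plus (e f : RExpr) : RExpr
  | minus (e f : RExpr) : RExpr

/-- The value of a real expression. -/
def RExpr.eval (s : State) : RExpr → ℝ
  | .zero => 0
  | .read a i => s.real a (i.eval s)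
  | .plus e f => e.eval s + f.eval s
  | .minus e f => e.eval s - f.eval s

/-- Tests: comparisons of integers and of reals, and Boolean combinations. -/
inductive Test where
  | natLe (e f : NExpr) : Test
  | realLe (e f : RExpr) : Test
  | neg (b : Test) : Test
  | both (b b' : Test) : Test

/-- A test succeeds in a state. -/
def Test.holds (s : State) : Test → Prop
  | .natLe e f => e.eval s ≤ f.eval s
  | .realLe e f => e.eval s ≤ f.eval s
  | .neg b => ¬ b.holds s
  | .both b b' => b.holds s ∧ b'.holds s

/-- Programs. -/
inductive Prog where
  | skip : Prog
  | write (a : ℕ) (i j e : NExpr) : Prog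
  | writeReal (a : ℕ) (i : NExpr) (e : RExpr) : Prog
  | seq (p q : Prog) : Prog
  | cond (b : Test) (p q : Prog) : Prog
  | loop (b : Test) (p : Prog) : Prog

/-- Overwrite one integer cell. -/
def State.setNat (s : State) (a i j k : ℕ) : State where
  nat := fun a' i' j' => if a' = a ∧ i' = i ∧ j' = j then k else s.nat a' i' j'
  real := s.real

/-- Overwrite one real cell. -/
def State.setReal (s : State) (a i : ℕ) (r : ℝ) : State where
  nat := s.nat
  real := fun a' i' => if a' = a ∧ i' = i then r else s.real a' i'

/-- `Runs p s t s'`: started in the state `s`, the program `p` halts after exactly `t` steps in the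
state `s'`. Each assignment and each test counts as one step (expressions and tests are part of
the program, so their evaluation takes a number of elementary operations that depends on the
program only). `loop b p` is "while `b` do `p`". -/
inductive Runs : Prog → State → ℕ → State → Prop
  | skip (s : State) : Runs .skip s 1 s
  | write (a : ℕ) (i j e : NExpr) (s : State) :
      Runs (.write a i j e) s 1 (s.setNat a (i.eval s) (j.eval s) (e.eval s))
  | writeReal (a : ℕ) (i : NExpr) (e : RExpr) (s : State) :
      Runs (.writeReal a i e) s 1 (s.setReal a (i.eval s) (e.eval s))
  | seq {p q : Prog} {s s' s'' : State} {t t' : ℕ} :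
      Runs p s t s' → Runs q s' t' s'' → Runs (.seq p q) s (t + t') s''
  | condTrue {b : Test} {p q : Prog} {s s' : State} {t : ℕ} :
      b.holds s → Runs p s t s' → Runs (.cond b p q) s (t + 1) s'
  | condFalse {b : Test} {p q : Prog} {s s' : State} {t : ℕ} :
      ¬ b.holds s → Runs q s t s' → Runs (.cond b p q) s (t + 1) s'
  | loopTrue {b : Test} {p : Prog} {s s' s'' : State} {t t' : ℕ} :
      b.holds s → Runs p s t s' → Runs (.loop b p) s' t' s'' →
        Runs (.loop b p) s (t + t' + 1) s''
  | loopFalse {b : Test} {p : Prog} {s : State} :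
      ¬ b.holds s → Runs (.loop b p) s 1 s

/-- The input state for a graph `G` on the vertices `0, …, n - 1` with weights `w` and the number
`c`: integer array `0` holds `n` in cell `(0, 0)`, integer array `1` holds the adjacency matrix,
real array `0` the weights, and real array `1` holds `c` in cell `0`; all other cells are zero. -/
def inputState {n : ℕ} (G : SimpleGraph (Fin n)) [DecidableRel G.Adj] (w : Fin n → ℝ) (c : ℝ) :
    State where
  nat := fun a i j =>
    if a = 0 ∧ i = 0 ∧ j = 0 then n
    else if a = 1 then
      if h : i < n ∧ j < n then (if G.Adj ⟨i, h.1⟩ ⟨j, h.2⟩ then 1 else 0) else 0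
    else 0
  real := fun a i =>
    if a = 0 then (if h : i < n then w ⟨i, h⟩ else 0)
    else if a = 1 ∧ i = 0 then c
    else 0

/-- The sequence of `k` vertex sets that is written in a state: vertex `v` belongs to the `i`-th
set, `i = 1, …, k`, if cell `(v, 0)` of integer array `2` holds `i`. -/
def outputSets (n k : ℕ) (s : State) : Fin k → Set (Fin n) :=
  fun i => {v | s.nat 2 v 0 = (i : ℕ) + 1}

end EvenSep

end

/-!
Write `N[v]` for the closed neighbourhood of `v`. As `G` has no bounded balanced separator,
`G ∖ N[v]` has a unique component `B v` of weight more than `c`. Let `C v = {v} ∪ N(B v)` be the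
star separator of `v`, and `A v` its small side, the set of all other vertices. Any two of the sets
`B v` meet, so these star separations behave like a tangle: `u ∈ A v` implies `B v ⊆ B u`.

A vertex `b` kills `x` if `x ∈ A b`, where ties (`B b = B x`) are broken by the order of the
vertices. This is a strict partial order. Its minimal elements are called live; they play the part
of the central bag. Every other vertex is on the small side of a live vertex. A set of live
vertices closed under adjacency of live vertices reaches, together with the small sides, all of `G`
(`mem_or_small_of_closed`), so it is not contained in a ball of radius `2`. As paws are broken, no
paw is live; hence no triangle is live (`HeavySide.live_triangle_free`), and by perfection the live
vertices induce a bipartite graph. Its two colour classes are the sets `X₁`, `X₂`. They are even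
sets of `G`: an induced path between live vertices that enters a small side `A z` can be cut at
`C z`, where the pieces inside are even because perfect graphs have no odd holes and paws are
broken (`live_parity`).

Star separations of nonadjacent live vertices do not cross, but those of adjacent live vertices
`u`, `y` may. For every such pair one of the two beats the other, and the part of `C u` on the
small side of the loser `y` is torn, that is, put into the separator. The winner is the one whose
separator crosses in fewer vertices, so a component left over on the small side of a live vertex
`v` has at most `|C v| ≤ δ + 1` neighbours (`exists_small_of_component`); its weight is at most
`1 - w(B v) < c`. A torn vertex `t ∈ C u` has at most `δ - 1` killers, all of them neighbours of
`u`. The torn vertices are partitioned by the number of their killers and the colour of `u`, which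
gives at most `2 (δ - 1) ≤ δ²` classes, and these are even sets after the deletion of the previous
classes: an initial piece of a path on the small side of the next vertex would yield a torn vertex
of lower rank (`torn_closed`, `torn_parity`).

All of this is computed by filling tables with one cell for each pair of vertices, in linear time
per cell (`halts_table`). The components of the graphs `G ∖ N[v]` are found with adjacency lists:
the least vertex reachable from `x` is computed in `n` rounds, each of which looks at the at most
`δ` neighbours of every vertex, so that all vertices `v` together take `O(δ n³)` steps
(`halts_heavy`).
-/


namespace EvenSep

/-! ### Induced paths as vertex sequences -/

section Paths

variable {V : Type*} {G : SimpleGraph V}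

/-- `x 0, …, x m` are the vertices of an induced path of length `m`, in this order
(the values of `x` beyond `m` are irrelevant). -/
def IndPath (G : SimpleGraph V) (x : ℕ → V) (m : ℕ) : Prop :=
  ∀ i j, i < j → j ≤ m → x i ≠ x j ∧ (G.Adj (x i) (x j) ↔ j = i + 1)

theorem IndPath.adj_succ {x : ℕ → V} {m : ℕ} (h : IndPath G x m) {i : ℕ} (hi : i < m) :
    G.Adj (x i) (x (i + 1)) := ((h i (i + 1) (by omega) (by omega)).2).2 rfl

theorem IndPath.adj_iff {x : ℕ → V} {m : ℕ} (h : IndPath G x m) {i j : ℕ} (hi : i ≤ m)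
    (hj : j ≤ m) : G.Adj (x i) (x j) ↔ (j = i + 1 ∨ i = j + 1) := by
  rcases lt_trichotomy i j with hij | rfl | hij
  · rw [(h i j hij hj).2]; omega
  · simp
  · rw [G.adj_comm, (h j i hij hi).2]; omega

theorem IndPath.inj {x : ℕ → V} {m : ℕ} (h : IndPath G x m) {i j : ℕ} (hi : i ≤ m)
    (hj : j ≤ m) (hx : x i = x j) : i = j := by
  rcases lt_trichotomy i j with hij | rfl | hij
  · exact absurd hx (h i j hij hj).1
  · rfl
  · exact absurd hx.symm (h j i hij hi).1

theorem IndPath.sub {x : ℕ → V} {m : ℕ} (h : IndPath G x m) {a k : ℕ} (hk : a + k ≤ m) :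
    IndPath G (fun i => x (a + i)) k := by
  intro i j hij hj
  refine ⟨(h (a + i) (a + j) (by omega) (by omega)).1, ?_⟩
  simp only [(h (a + i) (a + j) (by omega) (by omega)).2]
  omega

theorem IndPath.reverse {x : ℕ → V} {m : ℕ} (h : IndPath G x m) :
    IndPath G (fun i => x (m - i)) m := by
  intro i j hij hj
  refine ⟨(h (m - j) (m - i) (by omega) (by omega)).1.symm, ?_⟩
  simp only
  rw [G.adj_comm, (h (m - j) (m - i) (by omega) (by omega)).2]
  omega

/-- Append the vertex `z` to an induced path when `z` sees only its last vertex. -/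
theorem IndPath.snoc {x : ℕ → V} {m : ℕ} (h : IndPath G x m) {z : V} (hz : G.Adj (x m) z)
    (hne : ∀ i ≤ m, x i ≠ z) (hadj : ∀ i < m, ¬ G.Adj (x i) z) :
    IndPath G (fun i => if i ≤ m then x i else z) (m + 1) := by
  intro i j hij hj
  have hi : i ≤ m := by omega
  by_cases hjm : j ≤ m
  · simpa [hi, hjm] using h i j hij hjm
  · simp only [hi, hjm, if_true, if_false]
    refine ⟨hne i hi, ?_⟩
    constructor
    · intro ha
      by_contra hcon
      exact hadj i (by omega) ha
    · intro hji
      have : i = m := by omega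
      rwa [this]

/-- `S` is connected in `G`: no proper part of `S` is closed under adjacency within `S`. -/
def IsConn (G : SimpleGraph V) (S : Set V) : Prop :=
  ∀ T : Set V, (S ∩ T).Nonempty → (∀ x ∈ S, ∀ y ∈ S, x ∈ T → G.Adj x y → y ∈ T) → S ⊆ T

/-- A walk from `p` to `q` of length `k` with all interior vertices in `S`. -/
def WalkThrough (G : SimpleGraph V) (S : Set V) (p q : V) (k : ℕ) : Prop :=
  ∃ y : ℕ → V, y 0 = p ∧ y k = q ∧ (∀ i < k, G.Adj (y i) (y (i + 1))) ∧
    ∀ i, 0 < i → i < k → y i ∈ S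

/-- Two nonadjacent vertices with neighbours in a connected set `S` are joined by an induced
path through `S`: a shortest one. -/
theorem IsConn.exists_indPath {S : Set V} (hS : IsConn G S) {p q : V} (hpq : p ≠ q)
    (hnadj : ¬ G.Adj p q) (hp : ∃ a ∈ S, G.Adj p a) (hq : ∃ a ∈ S, G.Adj a q) :
    ∃ (y : ℕ → V) (k : ℕ), 2 ≤ k ∧ IndPath G y k ∧ y 0 = p ∧ y k = q ∧
      ∀ i, 0 < i → i < k → y i ∈ S := by
  classical
  obtain ⟨a, haS, hpa⟩ := hp
  obtain ⟨b, hbS, hbq⟩ := hq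
  have hreach : S ⊆ {v | ∃ (y : ℕ → V) (k : ℕ), y 0 = p ∧ y k = v ∧
      (∀ i < k, G.Adj (y i) (y (i + 1))) ∧ ∀ i, 0 < i → i ≤ k → y i ∈ S} := by
    refine hS _ ⟨a, haS, fun i => if i = 0 then p else a, 1, by simp, by simp, ?_, ?_⟩ ?_
    · intro i hi
      obtain rfl : i = 0 := by omega
      simpa using hpa
    · intro i hi _
      simpa [hi.ne'] using haS
    · rintro u hu v hv ⟨y, k, h0, hk, hadj, hmem⟩ huv
      refine ⟨fun i => if i ≤ k then y i else v, k + 1, by simpa using h0, by simp, ?_, ?_⟩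
      · intro i hi
        by_cases hik : i < k
        · simpa [hik.le, hik] using hadj i hik
        · obtain rfl : i = k := by omega
          simpa [hk] using huv
      · intro i hi hi'
        by_cases hik : i ≤ k
        · simpa [hik] using hmem i hi hik
        · simpa [hik] using hv
  have hex : ∃ k, WalkThrough G S p q k := by
    obtain ⟨y, k, h0, hk, hadj, hmem⟩ := hreach hbS
    refine ⟨k + 1, fun i => if i ≤ k then y i else q, by simpa using h0, by simp, ?_, ?_⟩
    · intro i hi
      by_cases hik : i < k
      · simpa [hik.le, hik] using hadj i hik
      · obtain rfl : i = k := by omega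
        simpa [hk] using hbq
    · intro i hi hi'
      have : i ≤ k := by omega
      simpa [this] using hmem i hi this
  let k := Nat.find hex
  obtain ⟨y, h0, hk, hadj, hmem⟩ := Nat.find_spec hex
  -- no walk through `S` is shorter, hence no shortcut is possible
  have hmin : ∀ l < k, ¬ WalkThrough G S p q l := fun l hl => Nat.find_min hex hl
  change y k = q at hk
  change ∀ i < k, _ at hadj
  change ∀ i, 0 < i → i < k → _ at hmem
  have hcut : ∀ i d, 0 < d → i + d ≤ k → (∀ t, i + d + t = k → t = 0 → y i = q) →
      (∀ t, i + d + (t + 1) ≤ k → t = 0 → G.Adj (y i) (y (i + d + 1))) → False := by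
    intro i d hd hid he ha
    refine hmin (k - d) (by omega) ⟨fun t => if t ≤ i then y t else y (t + d), by simpa using h0,
      ?_, ?_, ?_⟩
    · by_cases h : k - d ≤ i
      · have : k - d = i := by omega
        simp only [this, le_refl, if_true]
        exact he 0 (by omega) rfl
      · simp only [h, if_false]
        rw [show k - d + d = k by omega, hk]
    · intro t ht
      by_cases h1 : t + 1 ≤ i
      · simp only [show t ≤ i by omega, h1, if_true]
        exact hadj t (by omega)
      · by_cases h2 : t ≤ i
        · obtain rfl : t = i := by omega
          simp only [le_refl, if_true, h1, if_false]
          rw [show t + 1 + d = t + d + 1 by omega]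
          exact ha 0 (by omega) rfl
        · simp only [h1, h2, if_false]
          rw [show t + 1 + d = t + d + 1 by omega]
          exact hadj (t + d) (by omega)
    · intro t ht ht'
      by_cases h2 : t ≤ i
      · simp only [h2, if_true]
        exact hmem t ht (by omega)
      · simp only [h2, if_false]
        exact hmem (t + d) (by omega) (by omega)
  have hk2 : 2 ≤ k := by
    by_contra hlt
    have : k = 0 ∨ k = 1 := by omega
    rcases this with h | h
    · rw [h] at hk; exact hpq (h0.symm.trans hk)
    · have := hadj 0 (by omega)
      rw [h] at hk
      rw [h0, hk] at this
      exact hnadj this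
  refine ⟨y, k, hk2, ?_, h0, hk, hmem⟩
  intro i j hij hj
  constructor
  · intro heq
    refine hcut i (j - i) (by omega) (by omega) ?_ ?_
    · intro t ht ht0
      rw [heq, show j = k by omega, hk]
    · intro t ht ht0
      rw [heq, show i + (j - i) = j by omega]
      exact hadj j (by omega)
  · constructor
    · intro ha
      by_contra hcon
      refine hcut i (j - i - 1) (by omega) (by omega) ?_ ?_
      · intro t ht ht0
        omega
      · intro t ht ht0
        rw [show i + (j - i - 1) + 1 = j by omega]
        exact ha
    · rintro rfl
      exact hadj i (by omega)

end Paths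

/-! ### Star separations given by a haven on closed neighbourhoods -/

section Haven

variable {V : Type*} {G : SimpleGraph V}

/-- `B` assigns to every vertex `v` a connected component `B v` of `G ∖ N[v]`, and any two of the
chosen components meet. -/
structure IsHaven (G : SimpleGraph V) (B : V → Set V) : Prop where
  conn : ∀ v, IsConn G (B v)
  self_notMem : ∀ v, v ∉ B v
  not_adj : ∀ {v x}, x ∈ B v → ¬ G.Adj v x
  adj_of_boundary : ∀ {v x y}, x ∈ B v → G.Adj x y → y ∉ B v → G.Adj v y
  inter_nonempty : ∀ u v, (B u ∩ B v).Nonempty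

/-- The star separator `C v = {v} ∪ N(B v)`. -/
def starCut (G : SimpleGraph V) (B : V → Set V) (v : V) : Set V :=
  {x | x = v ∨ (x ∉ B v ∧ ∃ y ∈ B v, G.Adj y x)}

/-- The small side `A v` of the star separation of `v`: all vertices outside `B v ∪ C v`. -/
def smallSide (G : SimpleGraph V) (B : V → Set V) (v : V) : Set V :=
  {x | x ∉ B v ∧ x ∉ starCut G B v}

variable {B : V → Set V}

theorem self_mem_starCut (v : V) : v ∈ starCut G B v := Or.inl rfl

theorem self_notMem_smallSide (v : V) : v ∉ smallSide G B v := fun h => h.2 (Or.inl rfl)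

theorem notMem_starCut_of_small {v x : V} (h : x ∈ smallSide G B v) : x ∉ starCut G B v := h.2

theorem notMem_small_of_starCut {v x : V} (h : x ∈ starCut G B v) : x ∉ smallSide G B v :=
  fun h' => h'.2 h

theorem mem_cases (v x : V) : x ∈ B v ∨ x ∈ starCut G B v ∨ x ∈ smallSide G B v := by
  by_cases h : x ∈ B v
  · exact Or.inl h
  · by_cases h' : x ∈ starCut G B v
    · exact Or.inr (Or.inl h')
    · exact Or.inr (Or.inr ⟨h, h'⟩)

theorem exists_adj_of_starCut {v x : V} (h : x ∈ starCut G B v) (hne : x ≠ v) :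
    ∃ y ∈ B v, G.Adj y x := (h.resolve_left hne).2

theorem not_adj_small_big {v x y : V} (hx : x ∈ smallSide G B v) (hy : y ∈ B v) :
    ¬ G.Adj x y := fun h => hx.2 (Or.inr ⟨hx.1, y, hy, h.symm⟩)

theorem small_or_cut_of_adj {v x y : V} (hx : x ∈ smallSide G B v) (h : G.Adj x y) :
    y ∈ smallSide G B v ∨ y ∈ starCut G B v := by
  rcases mem_cases (G := G) (B := B) v y with hy | hy | hy
  · exact absurd h (not_adj_small_big hx hy)
  · exact Or.inr hy
  · exact Or.inl hy

namespace IsHaven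

variable (H : IsHaven G B)
include H

theorem starCut_notMem_big {v x : V} (h : x ∈ starCut G B v) : x ∉ B v := by
  rcases h with rfl | h
  · exact H.self_notMem _
  · exact h.1

theorem adj_of_starCut {v x : V} (h : x ∈ starCut G B v) (hne : x ≠ v) : G.Adj v x := by
  obtain ⟨hx, y, hy, hyx⟩ := h.resolve_left hne
  exact H.adj_of_boundary hy hyx hx

/-- A vertex on the small side of `v` has a larger chosen component. -/
theorem big_subset {u v : V} (hu : u ∈ smallSide G B v) : B v ⊆ B u := by
  refine H.conn v (B u) (H.inter_nonempty v u) ?_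
  intro x hx y hy hxu hxy
  by_contra hyu
  exact not_adj_small_big hu hy (H.adj_of_boundary hxu hxy hyu)

theorem small_subset {e z x : V} (he : e ∈ smallSide G B z) (hx : x ∈ smallSide G B e) :
    x ∈ smallSide G B z ∨ x = z := by
  by_cases hxz : x = z
  · exact Or.inr hxz
  left
  have hsub := H.big_subset he
  refine ⟨fun h => hx.1 (hsub h), ?_⟩
  rintro (h | ⟨-, y, hy, hyx⟩)
  · exact hxz h
  · exact not_adj_small_big hx (hsub hy) hyx.symm

theorem big_eq_of_small_small {x b : V} (h : x ∈ smallSide G B b) (h' : b ∈ smallSide G B x) :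
    B x = B b :=
  Set.Subset.antisymm (H.big_subset h') (H.big_subset h)

theorem mem_small_of_big_eq {x b : V} (h : B x = B b) (hne : x ≠ b) : x ∈ smallSide G B b := by
  refine ⟨h ▸ H.self_notMem x, ?_⟩
  rintro (h' | ⟨-, y, hy, hyx⟩)
  · exact hne h'
  · rw [← h] at hy
    exact H.not_adj hy hyx.symm

end IsHaven

end Haven

/-! ### Live vertices -/

section Live

variable {V : Type*} [LinearOrder V] {G : SimpleGraph V} {B : V → Set V}

/-- `b` kills `x` if `x` is on the small side of `b`; if `b` is also on the small side of `x`
(which means `B b = B x`), the smaller vertex kills the larger one. -/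
def Kills (G : SimpleGraph V) (B : V → Set V) (b x : V) : Prop :=
  x ∈ smallSide G B b ∧ (b ∉ smallSide G B x ∨ b < x)

/-- The vertices that no vertex kills; they form the central bag. -/
def Live (G : SimpleGraph V) (B : V → Set V) (x : V) : Prop := ∀ b, ¬ Kills G B b x

/-- The number of vertices that kill `x`. -/
noncomputable def killRank (G : SimpleGraph V) (B : V → Set V) (x : V) : ℕ :=
  {b | Kills G B b x}.ncard

namespace IsHaven

variable (H : IsHaven G B)
include H

theorem kills_trans {b g x : V} (h : Kills G B b g) (h' : Kills G B g x) : Kills G B b x := by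
  have hxb : x ∈ smallSide G B b := by
    rcases H.small_subset h.1 h'.1 with hx | rfl
    · exact hx
    · rcases h.2 with h1 | h1
      · exact absurd h'.1 h1
      · rcases h'.2 with h2 | h2
        · exact absurd h.1 h2
        · exact absurd (h1.trans h2) (lt_irrefl _)
  refine ⟨hxb, ?_⟩
  by_cases hbx : b ∈ smallSide G B x
  · right
    -- all three components coincide, so the order of the vertices decides
    have e := H.big_eq_of_small_small hxb hbx
    have e1 := H.big_subset h.1
    have e2 := H.big_subset h'.1
    have hg : B g = B b := Set.Subset.antisymm (e2.trans e.subset) e1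
    have hbg : b ∈ smallSide G B g :=
      H.mem_small_of_big_eq hg.symm (fun h0 => self_notMem_smallSide g (h0 ▸ h.1))
    have hgx : g ∈ smallSide G B x :=
      H.mem_small_of_big_eq (hg.trans e.symm)
        (fun h0 => self_notMem_smallSide x (by rw [h0] at h'; exact h'.1))
    exact (h.2.resolve_left (not_not_intro hbg)).trans (h'.2.resolve_left (not_not_intro hgx))
  · exact Or.inl hbx

omit H in
theorem kills_irrefl (x : V) : ¬ Kills G B x x := fun h => self_notMem_smallSide x h.1

omit H in
theorem kills_or_kills {b x : V} (h : x ∈ smallSide G B b) : Kills G B b x ∨ Kills G B x b := by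
  by_cases hb : b ∈ smallSide G B x
  · rcases lt_trichotomy b x with hlt | rfl | hlt
    · exact Or.inl ⟨h, Or.inr hlt⟩
    · exact absurd h (self_notMem_smallSide _)
    · exact Or.inr ⟨hb, Or.inr hlt⟩
  · exact Or.inl ⟨h, Or.inl hb⟩

omit H in
/-- A live vertex can be on the small side of `b` only if `b` is on its small side, too. -/
theorem live_mem_small {b y : V} (hy : Live G B y) (h : y ∈ smallSide G B b) :
    b ∈ smallSide G B y := by
  by_contra hb
  exact hy b ⟨h, Or.inl hb⟩

omit H in
theorem not_small_of_live {u v : V} (hu : Live G B u) (hv : Live G B v) :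
    u ∉ smallSide G B v := by
  intro h
  rcases kills_or_kills h with h | h
  · exact hu v h
  · exact hv u h

theorem exists_live_of_not_live [Finite V] {x : V} (hx : ¬ Live G B x) :
    ∃ v, Live G B v ∧ x ∈ smallSide G B v := by
  have hwf : WellFounded (Kills G B) := by
    have : IsTrans V (Kills G B) := ⟨fun _ _ _ h h' => H.kills_trans h h'⟩
    have : Std.Irrefl (Kills G B) := ⟨kills_irrefl⟩
    exact Finite.wellFounded_of_trans_of_irrefl _
  obtain ⟨b, hb⟩ : ∃ b, Kills G B b x := by
    by_contra hcon
    exact hx fun b hb => hcon ⟨b, hb⟩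
  obtain ⟨v, hv, hmin⟩ := hwf.has_min {b | Kills G B b x} ⟨b, hb⟩
  exact ⟨v, fun u hu => hmin u (H.kills_trans hu hv) hu, hv.1⟩

omit H in
theorem not_live_of_small {x v : V} (hv : Live G B v) (hx : x ∈ smallSide G B v) :
    ¬ Live G B x := fun h => not_small_of_live h hv hx

omit H in
theorem live_iff_killRank [Finite V] {x : V} : Live G B x ↔ killRank G B x = 0 := by
  unfold killRank Live
  rw [Set.ncard_eq_zero, Set.eq_empty_iff_forall_notMem]
  rfl

theorem killRank_lt [Finite V] {g x : V} (h : Kills G B g x) :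
    killRank G B g < killRank G B x := by
  refine Set.ncard_lt_ncard ?_ (Set.toFinite _)
  refine ⟨fun b hb => H.kills_trans hb h, fun hcon => kills_irrefl g (hcon h)⟩

omit H in
/-- A live vertex adjacent to the small side of a live vertex `v` is `v` or a neighbour of `v`. -/
theorem live_adj_small {u v x : V} (hu : Live G B u) (hv : Live G B v)
    (hx : x ∈ smallSide G B v) (hxu : G.Adj x u) : u ∈ starCut G B v :=
  (small_or_cut_of_adj hx hxu).resolve_left (not_small_of_live hu hv)

/-- The star separations of two distinct nonadjacent live vertices do not cross. -/
theorem starCut_disjoint_small {u v x : V} (hu : Live G B u) (hv : Live G B v) (huv : u ≠ v)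
    (hadj : ¬ G.Adj v u) (hx : x ∈ starCut G B u) : x ∉ smallSide G B v := by
  intro hxv
  have hxu : x ≠ u := by
    rintro rfl
    exact not_small_of_live hu hv hxv
  have := live_adj_small hu hv hxv (H.adj_of_starCut hx hxu).symm
  exact hadj (H.adj_of_starCut this huv)

/-- A live neighbour of a vertex `u` that is live belongs to the star separator of `u`. -/
theorem live_adj_mem_starCut {u c : V} (hu : Live G B u) (hc : Live G B c) (h : G.Adj u c) :
    c ∈ starCut G B u := by
  rcases mem_cases (G := G) (B := B) u c with h' | h' | h'
  · exact absurd h (H.not_adj h')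
  · exact h'
  · exact absurd h' (not_small_of_live hc hu)

/-- If `t` lies in the star separator of a live vertex `u` and on the small side of `b`, then `b`
lies in that separator, too. -/
theorem mem_starCut_of_small {u t b : V} (hu : Live G B u) (ht : t ∈ starCut G B u)
    (htu : t ≠ u) (htb : t ∈ smallSide G B b) : b ∈ starCut G B u ∧ b ≠ u := by
  have hbu : b ≠ u := by
    rintro rfl
    exact notMem_small_of_starCut ht htb
  have hno : b ∉ smallSide G B u := by
    intro hb
    rcases H.small_subset hb htb with h | h
    · exact notMem_small_of_starCut ht h
    · exact htu h
  have hub : u ∈ starCut G B b := by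
    refine (small_or_cut_of_adj htb (H.adj_of_starCut ht htu).symm).resolve_left fun h => ?_
    exact hno (live_mem_small hu h)
  have hadj := H.adj_of_starCut hub hbu.symm
  refine ⟨?_, hbu⟩
  rcases mem_cases (G := G) (B := B) u b with h | h | h
  · exact absurd hadj.symm (H.not_adj h)
  · exact h
  · exact absurd h hno

end IsHaven

end Live

/-! ### Parity of induced paths between live vertices -/

section Parity

variable {V : Type*} {G : SimpleGraph V} {B : V → Set V}

/-- All holes are even, in the form of a statement about two induced paths with common ends and
otherwise disjoint and anticomplete. -/
def EvenHoles (G : SimpleGraph V) : Prop :=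
  ∀ (x y : ℕ → V) (m k : ℕ), 2 ≤ m → 2 ≤ k → IndPath G x m → IndPath G y k → x 0 = y 0 →
    x m = y k → (∀ i j, 0 < i → i < m → 0 < j → j < k → x i ≠ y j ∧ ¬ G.Adj (x i) (y j)) →
    Even (m + k)

/-- Every paw has a vertex that breaks it: some other vertex of the paw is then on the small side
of the breaking vertex. -/
def PawsBroken (G : SimpleGraph V) (B : V → Set V) : Prop :=
  ∀ c a b₁ b₂, IsPaw G c a b₁ b₂ →
    (∃ t ∈ ({c, b₁, b₂} : Set V), t ∈ smallSide G B a) ∨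
    (∃ t ∈ ({c, b₂} : Set V), t ∈ smallSide G B b₁) ∨
    (∃ t ∈ ({c, b₁} : Set V), t ∈ smallSide G B b₂)

theorem exists_last_lt (P : ℕ → Prop) {j : ℕ} (h : ∃ i < j, P i) :
    ∃ p < j, P p ∧ ∀ i, p < i → i < j → ¬ P i := by
  classical
  induction j with
  | zero => obtain ⟨i, hi, -⟩ := h; omega
  | succ j ih =>
    by_cases hj : P j
    · exact ⟨j, by omega, hj, fun i h1 h2 => by omega⟩
    · obtain ⟨i, hi, hPi⟩ := h
      have hij : i < j := by
        rcases Nat.lt_succ_iff_lt_or_eq.1 hi with h | rfl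
        · exact h
        · exact absurd hPi hj
      obtain ⟨p, hp, hPp, hmax⟩ := ih ⟨i, hij, hPi⟩
      refine ⟨p, by omega, hPp, fun t h1 h2 => ?_⟩
      rcases Nat.lt_succ_iff_lt_or_eq.1 h2 with h | rfl
      · exact hmax t h1 h
      · exact hj

theorem exists_first_gt (P : ℕ → Prop) {j m : ℕ} (h : ∃ i, j < i ∧ i ≤ m ∧ P i) :
    ∃ q, j < q ∧ q ≤ m ∧ P q ∧ ∀ i, j < i → i < q → ¬ P i := by
  classical
  have hex : ∃ i, j < i ∧ P i := by
    obtain ⟨i, h1, -, h2⟩ := h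
    exact ⟨i, h1, h2⟩
  obtain ⟨i, h1, h2, h3⟩ := h
  exact ⟨Nat.find hex, (Nat.find_spec hex).1, (Nat.find_min' hex ⟨h1, h3⟩).trans h2,
    (Nat.find_spec hex).2, fun t ht ht' hP => Nat.find_min hex ht' ⟨ht, hP⟩⟩

/-- A stretch of a path that avoids the star separator of `v` stays on one side. -/
theorem small_of_no_cut {x : ℕ → V} {m : ℕ} (hx : IndPath G x m) {v : V} {a b : ℕ} (hb : b ≤ m)
    (hno : ∀ i, a ≤ i → i ≤ b → x i ∉ starCut G B v) {j : ℕ} (haj : a ≤ j) (hjb : j ≤ b)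
    (hj : x j ∈ smallSide G B v) : ∀ i, a ≤ i → i ≤ b → x i ∈ smallSide G B v := by
  have hup : ∀ d, j + d ≤ b → x (j + d) ∈ smallSide G B v := by
    intro d
    induction d with
    | zero => intro _; exact hj
    | succ d ih =>
      intro hd
      exact (small_or_cut_of_adj (ih (by omega))
        (hx.adj_succ (i := j + d) (by omega))).resolve_right (hno _ (by omega) (by omega))
  have hdown : ∀ d, a + d ≤ j → x (j - d) ∈ smallSide G B v := by
    intro d
    induction d with
    | zero => intro _; exact hj
    | succ d ih =>
      intro hd
      have h1 := hx.adj_succ (i := j - (d + 1)) (by omega)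
      rw [show j - (d + 1) + 1 = j - d by omega] at h1
      exact (small_or_cut_of_adj (ih (by omega)) h1.symm).resolve_right
        (hno _ (by omega) (by omega))
  intro i hai hib
  rcases le_total i j with h | h
  · have := hdown (j - i) (by omega)
    rwa [show j - (j - i) = i by omega] at this
  · have := hup (i - j) (by omega)
    rwa [show j + (i - j) = i by omega] at this

/-- An induced path that has a vertex on the small side of its vertex `x i` stays there. -/
theorem small_tail {x : ℕ → V} {m : ℕ} (H : IsHaven G B) (hx : IndPath G x m) {i j : ℕ}
    (hij : i < j) (h : x j ∈ smallSide G B (x i)) :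
    ∀ k, j ≤ k → k ≤ m → x k ∈ smallSide G B (x i) := by
  intro k hjk
  induction k, hjk using Nat.le_induction with
  | base => intro _; exact h
  | succ k hjk ih =>
    intro hk
    refine (small_or_cut_of_adj (ih (by omega)) (hx.adj_succ (i := k) (by omega))).resolve_right
      fun hc => ?_
    have h1 := (hx i (k + 1) (by omega) hk)
    have := h1.2.1 (H.adj_of_starCut hc h1.1.symm)
    omega

theorem small_head {x : ℕ → V} {m : ℕ} (H : IsHaven G B) (hx : IndPath G x m) {i j : ℕ}
    (hij : j < i) (hi : i ≤ m) (h : x j ∈ smallSide G B (x i)) :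
    ∀ k, k ≤ j → x k ∈ smallSide G B (x i) := by
  intro k hk
  have h' := small_tail H hx.reverse (i := m - i) (j := m - j) (by omega)
    (by simpa only [show m - (m - i) = i by omega, show m - (m - j) = j by omega] using h)
    (m - k) (by omega) (by omega)
  simpa only [show m - (m - i) = i by omega, show m - (m - k) = k by omega] using h'

/-- The pieces of an induced path around a vertex on the small side of `z`: the path meets the
star separator of `z` before and after, and does not contain `z`. -/
theorem exists_excursion {x : ℕ → V} {m : ℕ} (H : IsHaven G B) (hx : IndPath G x m) {z : V}
    (h0 : x 0 ∉ smallSide G B z) (hm : x m ∉ smallSide G B z) {j : ℕ} (hjm : j ≤ m)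
    (hj : x j ∈ smallSide G B z) :
    ∃ p q, p + 2 ≤ q ∧ q ≤ m ∧ x p ∈ starCut G B z ∧ x q ∈ starCut G B z ∧
      (∀ i, p < i → i < q → x i ∉ starCut G B z) ∧ ∀ i ≤ m, x i ≠ z := by
  have hjc := notMem_starCut_of_small hj
  have hbefore : ∃ i < j, x i ∈ starCut G B z := by
    by_contra hcon
    push Not at hcon
    refine h0 (small_of_no_cut hx (a := 0) (b := j) hjm (fun i _ hi => ?_) (Nat.zero_le _) le_rfl
      hj 0 le_rfl (Nat.zero_le _))
    rcases hi.lt_or_eq with h | rfl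
    · exact hcon i h
    · exact hjc
  have hafter : ∃ i, j < i ∧ i ≤ m ∧ x i ∈ starCut G B z := by
    by_contra hcon
    push Not at hcon
    refine hm (small_of_no_cut hx (a := j) (b := m) le_rfl (fun i hi hi' => ?_) le_rfl hjm
      hj m hjm le_rfl)
    rcases hi.lt_or_eq with h | rfl
    · exact hcon i h hi'
    · exact hjc
  obtain ⟨p, hpj, hp, hpmax⟩ := exists_last_lt (fun i => x i ∈ starCut G B z) hbefore
  obtain ⟨q, hjq, hqm, hq, hqmin⟩ := exists_first_gt (fun i => x i ∈ starCut G B z) hafter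
  have hno : ∀ i, p < i → i < q → x i ∉ starCut G B z := by
    intro i hpi hiq
    rcases lt_trichotomy i j with h | rfl | h
    · exact hpmax i hpi h
    · exact hjc
    · exact hqmin i h hiq
  refine ⟨p, q, by omega, hqm, hp, hq, hno, ?_⟩
  rintro i hi rfl
  have hadjp : i = p ∨ p = i + 1 ∨ i = p + 1 := by
    by_cases h : x p = x i
    · exact Or.inl (hx.inj hi (by omega) h.symm)
    · exact Or.inr ((hx.adj_iff hi (by omega)).1 (H.adj_of_starCut hp h))
  have hadjq : i = q ∨ q = i + 1 ∨ i = q + 1 := by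
    by_cases h : x q = x i
    · exact Or.inl (hx.inj hi (by omega) h.symm)
    · exact Or.inr ((hx.adj_iff hi (by omega)).1 (H.adj_of_starCut hq h))
  exact hno i (by omega) (by omega) (self_mem_starCut _)

variable (H : IsHaven G B) (hE : EvenHoles G)
include H hE

/-- An induced path through `B v` between two vertices of `N(B v)` forms a hole with `v`. -/
theorem even_of_big {x : ℕ → V} {m : ℕ} (hx : IndPath G x m) (hm : 2 ≤ m) {v : V}
    (h0 : x 0 ∈ starCut G B v) (h0v : x 0 ≠ v) (hmc : x m ∈ starCut G B v) (hmv : x m ≠ v)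
    (hint : ∀ i, 0 < i → i < m → x i ∈ B v) : Even m := by
  have hy : IndPath G (fun i => if i = 0 then x 0 else if i = 1 then v else x m) 2 := by
    intro i j hij hj
    have hcase : (i = 0 ∧ j = 1) ∨ (i = 0 ∧ j = 2) ∨ (i = 1 ∧ j = 2) := by omega
    rcases hcase with ⟨rfl, rfl⟩ | ⟨rfl, rfl⟩ | ⟨rfl, rfl⟩
    · simpa using ⟨h0v, (H.adj_of_starCut h0 h0v).symm⟩
    · have := hx 0 m (by omega) le_rfl
      refine ⟨by simpa using this.1, ?_⟩
      refine iff_of_false (fun h => ?_) (by omega)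
      have := this.2.1 (by simpa using h)
      omega
    · simpa using ⟨hmv.symm, H.adj_of_starCut hmc hmv⟩
  have h := hE x _ m 2 hm le_rfl hx hy (by simp) (by simp) ?_
  · rw [Nat.even_add] at h
    exact h.2 (by decide)
  · intro i j hi him hj hj2
    obtain rfl : j = 1 := by omega
    have := hint i hi him
    refine ⟨?_, ?_⟩
    · rintro h
      simp only [one_ne_zero, if_true, if_false] at h
      exact H.self_notMem v (h ▸ this)
    · simpa using fun h => H.not_adj this h.symm

/-- An induced path through the small side of `v` between two vertices of `N(B v)` is completed
to a hole by a path through `B v`, which is even. -/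
theorem even_of_small {x : ℕ → V} {m : ℕ} (hx : IndPath G x m) (hm : 2 ≤ m) {v : V}
    (h0 : x 0 ∈ starCut G B v) (h0v : x 0 ≠ v) (hmc : x m ∈ starCut G B v) (hmv : x m ≠ v)
    (hint : ∀ i, 0 < i → i < m → x i ∈ smallSide G B v) : Even m := by
  have h0m := hx 0 m (by omega) le_rfl
  obtain ⟨a, ha, hax⟩ := exists_adj_of_starCut h0 h0v
  obtain ⟨b, hb, hbx⟩ := exists_adj_of_starCut hmc hmv
  obtain ⟨y, k, hk, hy, hy0, hyk, hyint⟩ := (H.conn v).exists_indPath h0m.1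
    (by rw [h0m.2]; omega) ⟨a, ha, hax.symm⟩ ⟨b, hb, hbx⟩
  have hke : Even k := even_of_big H hE hy hk (by rwa [hy0]) (by rwa [hy0]) (by rwa [hyk])
    (by rwa [hyk]) hyint
  have h := hE x y m k hm hk hx hy hy0.symm hyk.symm ?_
  · rw [Nat.even_add] at h
    exact h.2 hke
  · intro i j hi him hj hjk
    have h1 := hint i hi him
    have h2 := hyint j hj hjk
    exact ⟨fun h => h1.1 (h ▸ h2), not_adj_small_big h1 h2⟩

/-- Between two vertices of the star separator of `v`, an induced path that avoids `v` and has no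
edge inside the separator is even. -/
theorem even_of_cuts {x : ℕ → V} {m : ℕ} (hx : IndPath G x m) {v : V} (hv : ∀ i ≤ m, x i ≠ v)
    {a b : ℕ} (hab : a ≤ b) (hb : b ≤ m) (ha' : x a ∈ starCut G B v) (hb' : x b ∈ starCut G B v)
    (hno : ∀ i, a ≤ i → i < b → x i ∈ starCut G B v → x (i + 1) ∉ starCut G B v) :
    Even (b - a) := by
  induction hd : b - a using Nat.strong_induction_on generalizing a with
  | _ d ih =>
  subst hd
  rcases hab.eq_or_lt with rfl | hlt
  · simp
  obtain ⟨q, haq, hqb, hq, hqmin⟩ := exists_first_gt (fun i => x i ∈ starCut G B v)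
    (j := a) (m := b) ⟨b, hlt, le_rfl, hb'⟩
  have hq2 : a + 2 ≤ q := by
    by_contra hcon
    obtain rfl : q = a + 1 := by omega
    exact hno a le_rfl hlt ha' hq
  have h1 := ih (b - q) (by omega) hqb hq (fun i hi => hno i (by omega)) rfl
  have h2 : Even (q - a) := by
    have hsub := hx.sub (a := a) (k := q - a) (by omega)
    have hend : a + (q - a) = q := by omega
    by_cases hA : x (a + 1) ∈ smallSide G B v
    · refine even_of_small H hE hsub (by omega) (v := v) (by simpa using ha')
        (by simpa using hv a (by omega)) (by simpa [hend] using hq)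
        (by simpa [hend] using hv q (by omega)) ?_
      intro i hi hi'
      exact small_of_no_cut hx (a := a + 1) (b := q - 1) (by omega)
        (fun t h1 h2 => hqmin t (by omega) (by omega)) le_rfl (by omega) hA _ (by omega) (by omega)
    · refine even_of_big H hE hsub (by omega) (v := v) (by simpa using ha')
        (by simpa using hv a (by omega)) (by simpa [hend] using hq)
        (by simpa [hend] using hv q (by omega)) ?_
      intro i hi hi'
      rcases mem_cases (G := G) (B := B) v (x (a + i)) with h | h | h
      · exact h
      · exact absurd h (hqmin _ (by omega) (by omega))
      · exact absurd (small_of_no_cut hx (a := a + 1) (b := q - 1) (by omega)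
          (fun t h1 h2 => hqmin t (by omega) (by omega)) (j := a + i) (by omega) (by omega) h
          (a + 1) le_rfl (by omega)) hA
  have : b - a = (b - q) + (q - a) := by omega
  rw [this]
  exact h1.add h2

omit hE in
/-- An edge inside the star separator of `u`, together with a third vertex `c` of the separator,
forms a paw with `u`, which `u` does not break. -/
theorem small_of_cut_edge (hP : PawsBroken G B) {u h h' c : V}
    (hh : h ∈ starCut G B u) (hhu : h ≠ u) (hh' : h' ∈ starCut G B u) (hhu' : h' ≠ u)
    (hc : c ∈ starCut G B u) (hcu : c ≠ u) (hadj : G.Adj h h') (hch : ¬ G.Adj c h)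
    (hch' : ¬ G.Adj c h') :
    c ∈ smallSide G B h ∨ h' ∈ smallSide G B h ∨ c ∈ smallSide G B h' ∨ h ∈ smallSide G B h' := by
  rcases hP c u h h' ⟨H.adj_of_starCut hh hhu, H.adj_of_starCut hh' hhu', hadj,
      H.adj_of_starCut hc hcu, hch, hch'⟩ with ⟨t, ht, hs⟩ | ⟨t, ht, hs⟩ | ⟨t, ht, hs⟩
  · simp only [Set.mem_insert_iff, Set.mem_singleton_iff] at ht
    exfalso
    rcases ht with rfl | rfl | rfl <;> exact notMem_small_of_starCut (by assumption) hs
  · simp only [Set.mem_insert_iff, Set.mem_singleton_iff] at ht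
    rcases ht with rfl | rfl <;> simp [hs]
  · simp only [Set.mem_insert_iff, Set.mem_singleton_iff] at ht
    rcases ht with rfl | rfl <;> simp [hs]

end Parity

section LiveParity

variable {V : Type*} [LinearOrder V] {G : SimpleGraph V} {B : V → Set V} {s : V → ℕ}

/-- On an induced path between live vertices, no end is on the small side of a path vertex. -/
theorem end_notMem_small (H : IsHaven G B) {x : ℕ → V} {m : ℕ} (hx : IndPath G x m)
    (h0 : Live G B (x 0)) (hm : Live G B (x m)) {k : ℕ} (hk : k ≤ m) {e : ℕ}
    (he : e = 0 ∨ e = m) : x e ∉ smallSide G B (x k) := by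
  intro h
  have hlive : Live G B (x e) := by rcases he with rfl | rfl <;> assumption
  have hke := IsHaven.live_mem_small hlive h
  obtain ⟨p, q, -, -, -, -, -, hne⟩ := exists_excursion H hx
    (IsHaven.not_small_of_live h0 hlive) (IsHaven.not_small_of_live hm hlive) hk hke
  exact hne e (by omega) rfl

/-- An induced path between live vertices alternates between the two sides of the live graph, as
far as its length is concerned: its excursions to small sides can be replaced by their centres. -/
theorem live_parity [Finite V] (H : IsHaven G B) (hE : EvenHoles G) (hP : PawsBroken G B)
    (hs : ∀ u v, Live G B u → Live G B v → G.Adj u v → (s u + s v) % 2 = 1)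
    {x : ℕ → V} {m : ℕ} (hx : IndPath G x m) (h0 : Live G B (x 0)) (hm : Live G B (x m)) :
    (s (x 0) + s (x m) + m) % 2 = 0 := by
  induction m using Nat.strong_induction_on generalizing x with
  | _ m ih =>
  by_cases hall : ∀ i ≤ m, Live G B (x i)
  · have : ∀ i ≤ m, (s (x 0) + s (x i) + i) % 2 = 0 := by
      intro i
      induction i with
      | zero => intro _; omega
      | succ i ihi =>
        intro hi
        have h1 := ihi (by omega)
        have h2 := hs _ _ (hall i (by omega)) (hall (i + 1) hi) (hx.adj_succ (by omega))
        omega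
    exact this m le_rfl
  push Not at hall
  obtain ⟨j, hjm, hj⟩ := hall
  obtain ⟨z, hz, hjz⟩ := H.exists_live_of_not_live hj
  have h0z := IsHaven.not_small_of_live h0 hz
  have hmz := IsHaven.not_small_of_live hm hz
  obtain ⟨p', q', hpq, hqm, hp', hq', hno, hne⟩ := exists_excursion H hx h0z hmz hjm hjz
  -- the first and the last vertex of the path in the star separator of `z`
  obtain ⟨p, hpp', hp, hpmin⟩ : ∃ p ≤ p', x p ∈ starCut G B z ∧
      ∀ i < p, x i ∉ starCut G B z := by
    classical
    have hex : ∃ i, x i ∈ starCut G B z := ⟨p', hp'⟩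
    exact ⟨Nat.find hex, Nat.find_min' hex hp', Nat.find_spec hex, fun i hi => Nat.find_min hex hi⟩
  obtain ⟨q, hqm', hq, hqmax⟩ := exists_last_lt (fun i => x i ∈ starCut G B z)
    (j := m + 1) ⟨q', by omega, hq'⟩
  have hq'q : q' ≤ q := by
    by_contra hcon
    exact hqmax q' (by omega) (by omega) hq'
  have hmid : Even (q - p) := by
    refine even_of_cuts H hE hx hne (by omega) (by omega) hp hq ?_
    intro i hpi hiq hi hi1
    have hcase : i + 1 ≤ p' ∨ q' ≤ i := by
      by_contra hcon
      push Not at hcon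
      by_cases h : p' < i
      · exact hno i h (by omega) hi
      · exact hno (i + 1) (by omega) (by omega) hi1
    have hend : ∀ k ≤ m, x 0 ∉ smallSide G B (x k) ∧ x m ∉ smallSide G B (x k) := fun k hk =>
      ⟨end_notMem_small H hx h0 hm hk (Or.inl rfl), end_notMem_small H hx h0 hm hk (Or.inr rfl)⟩
    have hadj := hx.adj_succ (i := i) (by omega)
    rcases hcase with h | h
    · rcases small_of_cut_edge H hP hi (hne _ (by omega)) hi1 (hne _ (by omega)) hq'
          (hne _ (by omega)) hadj (by rw [hx.adj_iff (by omega) (by omega)]; omega)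
          (by rw [hx.adj_iff (by omega) (by omega)]; omega) with h1 | h1 | h1 | h1
      · exact (hend i (by omega)).2 (small_tail H hx (by omega) h1 m (by omega) le_rfl)
      · exact (hend i (by omega)).2 (small_tail H hx (by omega) h1 m (by omega) le_rfl)
      · exact (hend (i + 1) (by omega)).2
          (small_tail H hx (by omega) h1 m (by omega) le_rfl)
      · exact (hend (i + 1) (by omega)).1 (small_head H hx (by omega) (by omega) h1 0 (by omega))
    · rcases small_of_cut_edge H hP hi (hne _ (by omega)) hi1 (hne _ (by omega)) hp'
          (hne _ (by omega)) hadj (by rw [hx.adj_iff (by omega) (by omega)]; omega)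
          (by rw [hx.adj_iff (by omega) (by omega)]; omega) with h1 | h1 | h1 | h1
      · exact (hend i (by omega)).1 (small_head H hx (by omega) (by omega) h1 0 (by omega))
      · exact (hend i (by omega)).2 (small_tail H hx (by omega) h1 m (by omega) le_rfl)
      · exact (hend (i + 1) (by omega)).1 (small_head H hx (by omega) (by omega) h1 0 (by omega))
      · exact (hend (i + 1) (by omega)).1 (small_head H hx (by omega) (by omega) h1 0 (by omega))
  -- a stretch from an end to the first vertex in the separator of `z`, continued to `z`
  have hpiece : ∀ (y : ℕ → V) (k : ℕ), IndPath G y m → Live G B (y 0) → k + 1 < m →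
      y k ∈ starCut G B z → (∀ i < k, y i ∉ starCut G B z) → (∀ i ≤ m, y i ≠ z) →
      (s (y 0) + s z + (k + 1)) % 2 = 0 := by
    intro y k hy hy0 hkm hyk hymin hyne
    have hyk' : IndPath G y k := by simpa using hy.sub (a := 0) (k := k) (by omega)
    have hsn := hyk'.snoc (H.adj_of_starCut hyk (hyne k (by omega))).symm
      (fun i hi => hyne i (by omega)) (fun i hi hadj => by
        rcases mem_cases (G := G) (B := B) z (y i) with h | h | h
        · exact H.not_adj h hadj.symm
        · exact hymin i hi h
        · exact IsHaven.not_small_of_live hy0 hz (small_of_no_cut hyk' (a := 0) (b := k - 1)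
            (by omega) (fun t _ ht => hymin t (by omega)) (j := i) (by omega) (by omega) h 0
            le_rfl (by omega)))
    have := ih (k + 1) hkm hsn (by simpa using hy0) (by simpa using hz)
    simpa using this
  have e1 := hpiece x p hx h0 (by omega) hp hpmin hne
  have e2 := hpiece _ (m - q) hx.reverse (by simpa using hm) (by omega)
    (by simpa only [show m - (m - q) = q by omega] using hq)
    (fun i hi => hqmax _ (by omega) (by omega)) (fun i hi => hne _ (by omega))
  simp only [Nat.sub_zero] at e2
  obtain ⟨r, hr⟩ := hmid
  omega

end LiveParity

/-! ### Uncrossing the small sides of live vertices -/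

section Uncross

variable {V : Type*} [LinearOrder V]

/-- Live vertices with at least two live neighbours. -/
def Inner (G : SimpleGraph V) (B : V → Set V) (u : V) : Prop :=
  Live G B u ∧ ∃ c c', c ≠ c' ∧ Live G B c ∧ Live G B c' ∧ G.Adj u c ∧ G.Adj u c'

/-- The part of the small side of `v` that is not on the small side of a smaller live vertex of the
same colour. -/
def owned (G : SimpleGraph V) (B : V → Set V) (s : V → ℕ) (v : V) : Set V :=
  {x | x ∈ smallSide G B v ∧ ∀ y, Live G B y → s y = s v → y < v → x ∉ smallSide G B y}

/-- The number of vertices in which the star separator of `u` meets the set owned by `y`. -/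
noncomputable def crossCount (G : SimpleGraph V) (B : V → Set V) (s : V → ℕ) (u y : V) : ℕ :=
  (starCut G B u ∩ owned G B s y).ncard

/-- If at most one of two adjacent live vertices has no other live neighbour, exactly one of the
two beats the other; the set owned by the loser is cut at the separator of the winner. The winner
is the one whose separator meets the owned set of the other in fewer vertices, so that the boundary
of the loser does not grow by the cut. A vertex with only one live neighbour loses to that
neighbour if the latter has other live neighbours. -/
def Beats (G : SimpleGraph V) (B : V → Set V) (s : V → ℕ) (u y : V) : Prop :=
  Live G B u ∧ Live G B y ∧ G.Adj u y ∧ (¬ Inner G B y ∨ (Inner G B u ∧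
    (crossCount G B s u y < crossCount G B s y u ∨
      (crossCount G B s u y = crossCount G B s y u ∧ u < y))))

/-- The vertices outside the central bag at which crossing small sides are cut. -/
def torn (G : SimpleGraph V) (B : V → Set V) (s : V → ℕ) : Set V :=
  {t | ∃ u y, Beats G B s u y ∧ t ∈ starCut G B u ∧ t ∈ owned G B s y}

/-- What the proof uses of the live vertices: `s` is a proper colouring of the live vertices with
colours `0` and `1`, every live vertex has a live neighbour, and no two live vertices with only
one live neighbour are adjacent. -/
structure LiveColoring (G : SimpleGraph V) (B : V → Set V) (s : V → ℕ) : Prop where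
  lt_two : ∀ v, s v < 2
  adj : ∀ u v, Live G B u → Live G B v → G.Adj u v → (s u + s v) % 2 = 1
  exists_adj : ∀ v, Live G B v → ∃ c, Live G B c ∧ G.Adj v c
  inner : ∀ u v, Live G B u → Live G B v → G.Adj u v → Inner G B u ∨ Inner G B v

variable {G : SimpleGraph V} {B : V → Set V} {s : V → ℕ}

namespace LiveColoring

variable (S : LiveColoring G B s)
include S

theorem no_triangle {a b c : V} (ha : Live G B a) (hb : Live G B b) (hc : Live G B c)
    (hab : G.Adj a b) (hac : G.Adj a c) : ¬ G.Adj b c := by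
  intro hbc
  have := S.adj _ _ ha hb hab
  have := S.adj _ _ ha hc hac
  have := S.adj _ _ hb hc hbc
  omega

theorem eq_of_common_adj {u a b : V} (hu : Live G B u) (ha : Live G B a) (hb : Live G B b)
    (h : G.Adj u a) (h' : G.Adj u b) : s a = s b := by
  have := S.adj _ _ hu ha h
  have := S.adj _ _ hu hb h'
  have := S.lt_two a
  have := S.lt_two b
  omega

theorem not_adj_of_eq {a b : V} (ha : Live G B a) (hb : Live G B b) (h : s a = s b) :
    ¬ G.Adj a b := by
  intro h'
  have := S.adj _ _ ha hb h'
  omega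

end LiveColoring

variable (H : IsHaven G B)
include H

/-- A live vertex `y` that has a vertex of the star separator of the live vertex `u` on its small
side is adjacent to `u`. -/
theorem adj_of_small_cut {u y h : V} (hu : Live G B u) (hy : Live G B y)
    (hh : h ∈ starCut G B u) (hhu : h ≠ u) (hhy : h ∈ smallSide G B y) : G.Adj u y := by
  have h1 := IsHaven.live_adj_small hu hy hhy (H.adj_of_starCut hh hhu).symm
  refine (H.adj_of_starCut h1 ?_).symm
  rintro rfl
  exact notMem_small_of_starCut hh hhy

section Parity

variable [Finite V] (S : LiveColoring G B s)
include S

/-- Adjacent vertices outside the central bag in the star separator of a live vertex are on the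
small sides of the same live vertices. -/
theorem small_of_adj_cut {u h h' y : V} (hu : Live G B u) (hh : h ∈ starCut G B u)
    (hhl : ¬ Live G B h) (hh' : h' ∈ starCut G B u) (hhl' : ¬ Live G B h') (hadj : G.Adj h h')
    (hy : Live G B y) (hy' : h' ∈ smallSide G B y) : h ∈ smallSide G B y := by
  have hne : ∀ {a b}, ¬ Live G B a → Live G B b → a ≠ b := by
    rintro a b h1 h2 rfl; exact h1 h2
  refine (small_or_cut_of_adj hy' hadj.symm).resolve_right fun hc => ?_
  obtain ⟨y₂, hy₂, hhy₂⟩ := H.exists_live_of_not_live hhl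
  have h1 := adj_of_small_cut H hu hy hh' (hne hhl' hu) hy'
  have h2 := adj_of_small_cut H hu hy₂ hh (hne hhl hu) hhy₂
  have h3 := adj_of_small_cut H hy hy₂ hc (hne hhl hy) hhy₂
  exact S.no_triangle hu hy hy₂ h1 h2 h3

omit [Finite V] in
theorem eq_of_live_adj {u c h y : V} (hu : Live G B u) (hc : Live G B c) (huc : G.Adj u c)
    (hh : h ∈ starCut G B u) (hhl : ¬ Live G B h) (hch : G.Adj c h)
    (hy : Live G B y) (hhy : h ∈ smallSide G B y) : y = c := by
  have hne : h ≠ u := by rintro rfl; exact hhl hu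
  have h1 := adj_of_small_cut H hu hy hh hne hhy
  have h2 := IsHaven.live_adj_small hc hy hhy hch.symm
  by_contra hcon
  exact S.no_triangle hu hy hc h1 huc (H.adj_of_starCut h2 (Ne.symm hcon))

/-- Some live neighbour of an inner vertex completes any edge inside its star separator, outside
the central bag, to a paw. -/
theorem exists_pendant {u h h' : V} (hu : Inner G B u) (hh : h ∈ starCut G B u)
    (hhl : ¬ Live G B h) (hh' : h' ∈ starCut G B u) (hhl' : ¬ Live G B h') (hadj : G.Adj h h') :
    ∃ c, Live G B c ∧ G.Adj u c ∧ ¬ G.Adj c h ∧ ¬ G.Adj c h' := by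
  obtain ⟨hul, c₁, c₂, hne, h1, h2, hc1, hc2⟩ := hu
  -- a live neighbour of `u` adjacent to `h` or `h'` is the only centre of the other two
  have key : ∀ c, Live G B c → G.Adj u c → (G.Adj c h ∨ G.Adj c h') →
      ∀ y, Live G B y → h ∈ smallSide G B y → y = c := by
    intro c hc huc hor y hy hhy
    rcases hor with hch | hch
    · exact eq_of_live_adj H S hul hc huc hh hhl hch hy hhy
    · exact eq_of_live_adj H S hul hc huc hh' hhl' hch hy
        (small_of_adj_cut H S hul hh' hhl' hh hhl hadj.symm hy hhy)
  obtain ⟨y, hy, hhy⟩ := H.exists_live_of_not_live hhl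
  by_cases ha : G.Adj c₁ h ∨ G.Adj c₁ h'
  · by_cases hb : G.Adj c₂ h ∨ G.Adj c₂ h'
    · exact absurd ((key c₁ h1 hc1 ha y hy hhy).symm.trans (key c₂ h2 hc2 hb y hy hhy)) hne
    · push Not at hb
      exact ⟨c₂, h2, hc2, hb.1, hb.2⟩
  · push Not at ha
    exact ⟨c₁, h1, hc1, ha.1, ha.2⟩

/-- One end of an edge inside the star separator of an inner vertex, outside the central bag, is
on the small side of the other end. -/
theorem small_of_inner_edge (hP : PawsBroken G B) {u h h' : V} (hu : Inner G B u)
    (hh : h ∈ starCut G B u) (hhl : ¬ Live G B h) (hh' : h' ∈ starCut G B u)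
    (hhl' : ¬ Live G B h') (hadj : G.Adj h h') :
    h' ∈ smallSide G B h ∨ h ∈ smallSide G B h' := by
  have hne : ∀ {a b}, ¬ Live G B a → Live G B b → a ≠ b := by
    rintro a b h1 h2 rfl; exact h1 h2
  obtain ⟨c, hc, huc, hch, hch'⟩ := exists_pendant H S hu hh hhl hh' hhl' hadj
  -- if the live vertex `c` is on the small side of `g`, then `B c = B g`
  have key : ∀ g g', ¬ Live G B g' → G.Adj g g' → ¬ G.Adj c g' → c ∈ smallSide G B g →
      g' ∈ smallSide G B g := by
    intro g g' hg' hgg hcg' hcg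
    have hB := H.big_eq_of_small_small hcg (IsHaven.live_mem_small hc hcg)
    rcases mem_cases (G := G) (B := B) g g' with h1 | h1 | h1
    · exact absurd hgg (H.not_adj h1)
    · obtain ⟨y, hy, hyg⟩ := exists_adj_of_starCut h1 hgg.ne'
      refine absurd (H.adj_of_starCut (v := c) (Or.inr ⟨?_, y, hB ▸ hy, hyg⟩) (hne hg' hc)) hcg'
      rw [hB]
      exact H.starCut_notMem_big h1
    · exact h1
  rcases small_of_cut_edge H hP hh (hne hhl hu.1) hh' (hne hhl' hu.1)
    (H.live_adj_mem_starCut hu.1 hc huc) huc.ne' hadj hch hch' with h1 | h1 | h1 | h1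
  · exact Or.inl (key h h' hhl' hadj hch' h1)
  · exact Or.inl h1
  · exact Or.inr (key h' h hhl hadj.symm hch h1)
  · exact Or.inr h1

/-- An induced path outside the central bag between the star separators of two inner vertices of
the same colour is even, provided that it has no initial and no final piece on the small side of
the next vertex. -/
theorem even_of_inner (hE : EvenHoles G) (hP : PawsBroken G B) {x : ℕ → V} {m : ℕ}
    (hx : IndPath G x m) (hdead : ∀ i ≤ m, ¬ Live G B (x i)) {u u' : V} (hu : Inner G B u)
    (hu' : Inner G B u') (hs : s u = s u') (h0 : x 0 ∈ starCut G B u)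
    (hm : x m ∈ starCut G B u')
    (hhead : ∀ i < m, ¬ ∀ k ≤ i, x k ∈ smallSide G B (x (i + 1)))
    (htail : ∀ i < m, ¬ ∀ k, i + 1 ≤ k → k ≤ m → x k ∈ smallSide G B (x i)) : Even m := by
  have hne : ∀ v, Live G B v → ∀ i ≤ m, x i ≠ v := by
    rintro v hv i hi rfl; exact hdead i hi hv
  have hnoedge : ∀ v, Inner G B v → ∀ i < m, x i ∈ starCut G B v →
      x (i + 1) ∉ starCut G B v := by
    intro v hv i hi h1 h2
    rcases small_of_inner_edge H S hP hv h1 (hdead i hi.le) h2 (hdead (i + 1) hi)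
      (hx.adj_succ hi) with h | h
    · exact htail i hi (small_tail H hx (by omega) h)
    · exact hhead i hi (small_head H hx (by omega) (by omega) h)
  obtain ⟨l, hlm, hl, hlmax⟩ := exists_last_lt (fun i => x i ∈ starCut G B u) (j := m + 1)
    ⟨0, by omega, h0⟩
  have e1 : Even (l - 0) := even_of_cuts H hE hx (hne u hu.1) (Nat.zero_le _) (by omega) h0 hl
    fun i _ hi => hnoedge u hu i (by omega)
  by_cases hlm' : l = m
  · simpa [hlm'] using e1
  have huu : u ≠ u' := by
    rintro rfl
    exact hlmax m (by omega) (by omega) hm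
  have hnadj := S.not_adj_of_eq hu.1 hu'.1 hs
  have hnadj' : ¬ G.Adj u' u := fun h => hnadj h.symm
  have hmu : x m ∉ smallSide G B u :=
    H.starCut_disjoint_small hu'.1 hu.1 huu.symm hnadj hm
  have hbig : ∀ i, l < i → i ≤ m → x i ∈ B u := by
    intro i hi him
    rcases mem_cases (G := G) (B := B) u (x i) with h | h | h
    · exact h
    · exact absurd h (hlmax i hi (by omega))
    · exact absurd (small_of_no_cut hx (a := l + 1) (b := m) le_rfl
        (fun t h1 h2 => hlmax t (by omega) (by omega)) (j := i) (by omega) (by omega) h m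
        (by omega) le_rfl) hmu
  obtain ⟨f, hlf, hfm, hf, hfmin⟩ : ∃ f, l ≤ f ∧ f ≤ m ∧ x f ∈ starCut G B u' ∧
      ∀ i, l ≤ i → i < f → x i ∉ starCut G B u' := by
    classical
    have hex : ∃ i, l ≤ i ∧ x i ∈ starCut G B u' := ⟨m, by omega, hm⟩
    exact ⟨Nat.find hex, (Nat.find_spec hex).1, Nat.find_min' hex ⟨by omega, hm⟩,
      (Nat.find_spec hex).2, fun i h1 h2 h3 => Nat.find_min hex h2 ⟨h1, h3⟩⟩
  have hlu' : x l ∉ smallSide G B u' :=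
    H.starCut_disjoint_small hu.1 hu'.1 huu hnadj' hl
  have e2 : Even (f - l) := by
    have h1 := (hx.sub (a := l) (k := f - l) (by omega)).snoc (z := u')
      (by simpa only [show l + (f - l) = f by omega] using
        (H.adj_of_starCut hf (hne _ hu'.1 _ hfm)).symm)
      (fun i hi => hne _ hu'.1 _ (by omega)) (fun i hi hadj => by
        rcases mem_cases (G := G) (B := B) u' (x (l + i)) with h | h | h
        · exact H.not_adj h hadj.symm
        · exact hfmin _ (by omega) (by omega) h
        · exact hlu' (small_of_no_cut hx (a := l) (b := f - 1) (by omega)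
            (fun t h1 h2 => hfmin t h1 (by omega)) (j := l + i) (by omega) (by omega) h l
            le_rfl (by omega)))
    have h2 := h1.reverse.snoc (z := u) (by
        simpa using (H.adj_of_starCut hl (hne _ hu.1 _ (by omega))).symm)
      (fun i hi => by
        by_cases h : f - l + 1 - i ≤ f - l
        · simpa [h] using hne _ hu.1 _ (by omega)
        · simpa [h] using huu.symm)
      (fun i hi => by
        by_cases h : f - l + 1 - i ≤ f - l
        · simp only [h, if_true]
          exact fun hadj => H.not_adj (hbig _ (by omega) (by omega)) hadj.symm
        · simpa [h] using hnadj')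
    have h3 := live_parity H hE hP S.adj h2 (by simpa using hu'.1) (by simpa using hu.1)
    simp at h3
    rw [Nat.even_iff]
    omega
  have e3 : Even (m - f) := even_of_cuts H hE hx (hne u' hu'.1) hfm le_rfl hf hm
    fun i _ hi => hnoedge u' hu' i hi
  have : m = (l - 0) + (f - l) + (m - f) := by omega
  rw [this]
  exact (e1.add e2).add e3

/-- The torn vertices of a crossing pair are closed under passing to a vertex that kills them,
along paths on its small side. -/
theorem torn_closed {x : ℕ → V} {j : ℕ} (hx : IndPath G x j)
    (hdead : ∀ i ≤ j, ¬ Live G B (x i)) (hj : 0 < j) {u y : V} (hb : Beats G B s u y)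
    (h0 : x 0 ∈ starCut G B u) (h0' : x 0 ∈ owned G B s y)
    (hk : ∀ k < j, x k ∈ smallSide G B (x j)) :
    x j ∈ starCut G B u ∧ x j ∈ owned G B s y := by
  obtain ⟨hul, hyl, huy, -⟩ := hb
  have hne : ∀ v, Live G B v → ∀ i ≤ j, x i ≠ v := by
    rintro v hv i hi rfl; exact hdead i hi hv
  refine ⟨(H.mem_starCut_of_small hul h0 (hne _ hul 0 (by omega)) (hk 0 hj)).1, ?_⟩
  obtain ⟨z, hz, hjz⟩ := H.exists_live_of_not_live (hdead j le_rfl)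
  have hall : ∀ k ≤ j, x k ∈ smallSide G B z := by
    intro k hkj
    rcases hkj.lt_or_eq with h | rfl
    · exact (H.small_subset hjz (hk k h)).resolve_right (hne z hz k hkj)
    · exact hjz
  have huz := adj_of_small_cut H hul hz h0 (hne _ hul 0 (by omega)) (hall 0 (by omega))
  have hnadj := S.not_adj_of_eq hz hyl (S.eq_of_common_adj hul hz hyl huz huy)
  have hallY : ∀ k ≤ j, x k ∈ smallSide G B y := fun k hkj =>
    small_of_no_cut hx (a := 0) (b := j) le_rfl (fun t _ ht hc => by
      by_cases hyz : y = z
      · subst hyz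
        exact notMem_small_of_starCut hc (hall t ht)
      · exact H.starCut_disjoint_small hyl hz hyz hnadj hc (hall t ht)) (j := 0) le_rfl
      (by omega) h0'.1 k (by omega) hkj
  refine ⟨hallY j le_rfl, fun v hv hvs hvy hjv => ?_⟩
  refine h0'.2 v hv hvs hvy (small_of_no_cut hx (a := 0) (b := j) le_rfl (fun t _ ht hc => ?_)
    (by omega) le_rfl hjv 0 le_rfl (by omega))
  exact H.starCut_disjoint_small hv hyl hvy.ne (S.not_adj_of_eq hyl hv hvs.symm) hc (hallY t ht)

theorem not_small_head_of_torn {x : ℕ → V} {m : ℕ} (hx : IndPath G x m)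
    (hdead : ∀ i ≤ m, ¬ Live G B (x i)) (h0 : x 0 ∈ torn G B s)
    (hrank : killRank G B (x 0) = killRank G B (x m))
    (hmin : ∀ i ≤ m, x i ∈ torn G B s → killRank G B (x 0) ≤ killRank G B (x i)) :
    ∀ i < m, ¬ ∀ k ≤ i, x k ∈ smallSide G B (x (i + 1)) := by
  intro i hi hk
  rcases IsHaven.kills_or_kills (hk 0 (by omega)) with h | h
  · obtain ⟨u, y, hb, h1, h2⟩ := h0
    have hsub : IndPath G x (i + 1) := by simpa using hx.sub (a := 0) (k := i + 1) (by omega)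
    have := torn_closed H S hsub (fun t ht => hdead t (by omega)) (by omega) hb h1 h2
      (fun k hk' => hk k (by omega))
    have h3 := hmin (i + 1) hi ⟨u, y, hb, this⟩
    have h4 := H.killRank_lt h
    omega
  · rcases IsHaven.kills_or_kills
      (small_tail H hx (i := 0) (j := i + 1) (by omega) h.1 m (by omega) le_rfl) with h' | h'
    all_goals
      have := H.killRank_lt h'
      omega

/-- An induced path outside the central bag between two torn vertices of the same rank and colour
is even, provided that it avoids the torn vertices of lower rank. -/
theorem torn_parity (hE : EvenHoles G) (hP : PawsBroken G B) {x : ℕ → V} {m : ℕ}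
    (hx : IndPath G x m) (hdead : ∀ i ≤ m, ¬ Live G B (x i)) {u u' y y' : V}
    (hs : s u = s u') (hb : Beats G B s u y) (hb' : Beats G B s u' y')
    (h0 : x 0 ∈ starCut G B u) (h0' : x 0 ∈ owned G B s y) (hm : x m ∈ starCut G B u')
    (hm' : x m ∈ owned G B s y') (hrank : killRank G B (x 0) = killRank G B (x m))
    (hmin : ∀ i ≤ m, x i ∈ torn G B s → killRank G B (x 0) ≤ killRank G B (x i)) : Even m := by
  have hinner : ∀ a b, Beats G B s a b → Inner G B a := by
    rintro a b ⟨h1, h2, h3, h4 | h4⟩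
    · exact (S.inner a b h1 h2 h3).resolve_right h4
    · exact h4.1
  refine even_of_inner H S hE hP hx hdead (hinner _ _ hb) (hinner _ _ hb') hs h0 hm
    (not_small_head_of_torn H S hx hdead ⟨u, y, hb, h0, h0'⟩ hrank hmin) ?_
  intro i hi hk
  have hmT : x m ∈ torn G B s := ⟨u', y', hb', hm, hm'⟩
  have hrev := not_small_head_of_torn H S hx.reverse (fun t _ => hdead _ (by omega))
    (by simpa only [Nat.sub_zero] using hmT) (by simpa using hrank.symm)
    (fun t _ ht => by simpa [← hrank] using hmin _ (by omega) ht) (m - (i + 1)) (by omega)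
  refine hrev fun k hk' => ?_
  rw [show m - (m - (i + 1) + 1) = i by omega]
  exact hk _ (by omega) (by omega)

end Parity

end Uncross

/-! ### Components outside the central bag and the torn vertices -/

/-- Replacing the pairwise disjoint pieces `C ∩ P i` of a set by sets `Q i` that are not larger
does not enlarge the set. -/
theorem ncard_exchange {V ι : Type*} [Finite V] (R : Finset ι) (C : Set V) (P Q : ι → Set V)
    (hP : ∀ i ∈ R, ∀ j ∈ R, i ≠ j → Disjoint (P i) (P j))
    (hle : ∀ i ∈ R, (Q i).ncard ≤ (C ∩ P i).ncard) :
    ((C \ ⋃ i ∈ R, P i) ∪ ⋃ i ∈ R, Q i).ncard ≤ C.ncard := by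
  classical
  have key : (C \ ⋃ i ∈ R, P i).ncard + (⋃ i ∈ R, Q i).ncard ≤ C.ncard := by
    induction R using Finset.induction_on with
    | empty => simp
    | insert a R ha ih =>
      have ih' := ih (fun i hi j hj => hP i (by simp [hi]) j (by simp [hj]))
        (fun i hi => hle i (by simp [hi]))
      have h1 : (⋃ i ∈ insert a R, Q i).ncard ≤ (Q a).ncard + (⋃ i ∈ R, Q i).ncard := by
        rw [Finset.set_biUnion_insert]
        exact Set.ncard_union_le _ _
      have h2 : (C ∩ P a).ncard + (C \ ⋃ i ∈ insert a R, P i).ncard ≤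
          (C \ ⋃ i ∈ R, P i).ncard := by
        rw [← Set.ncard_union_eq ?_ (Set.toFinite _) (Set.toFinite _)]
        · refine Set.ncard_le_ncard ?_ (Set.toFinite _)
          rintro x (⟨hx, hxa⟩ | ⟨hx, hxn⟩)
          · refine ⟨hx, fun hx' => ?_⟩
            simp only [Set.mem_iUnion] at hx'
            obtain ⟨i, hi, hxi⟩ := hx'
            have hne : a ≠ i := by rintro rfl; exact ha hi
            exact (hP a (by simp) i (by simp [hi]) hne).ne_of_mem hxa hxi rfl
          · refine ⟨hx, fun hx' => hxn ?_⟩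
            rw [Finset.set_biUnion_insert]
            exact Or.inr hx'
        · rw [Set.disjoint_left]
          rintro x ⟨-, hxa⟩ ⟨-, hxn⟩
          refine hxn ?_
          rw [Finset.set_biUnion_insert]
          exact Or.inl hxa
      have h3 := hle a (by simp)
      omega
  exact (Set.ncard_union_le _ _).trans key

section Separation

variable {V : Type*} [LinearOrder V] {G : SimpleGraph V} {B : V → Set V} {s : V → ℕ}

/-- What is left of the set owned by `v` when `v` has given way to all vertices that beat it. -/
def kept (G : SimpleGraph V) (B : V → Set V) (s : V → ℕ) (v : V) : Set V :=
  {x | x ∈ owned G B s v ∧ ∀ y, Beats G B s y v → x ∉ owned G B s y ∧ x ∉ starCut G B y}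

theorem eq_of_owned {x y y' : V} (hy : Live G B y) (hy' : Live G B y') (hs : s y = s y')
    (h : x ∈ owned G B s y) (h' : x ∈ owned G B s y') : y = y' := by
  rcases lt_trichotomy y y' with hlt | rfl | hlt
  · exact absurd h.1 (h'.2 y hy hs hlt)
  · rfl
  · exact absurd h'.1 (h.2 y' hy' hs.symm hlt)

theorem exists_owned [Finite V] {x v : V} (hv : Live G B v) (hx : x ∈ smallSide G B v) :
    ∃ u, Live G B u ∧ s u = s v ∧ x ∈ owned G B s u := by
  obtain ⟨u, ⟨hu, hs, hxu⟩, hmin⟩ := (wellFounded_lt (α := V)).has_min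
    {u | Live G B u ∧ s u = s v ∧ x ∈ smallSide G B u} ⟨v, hv, rfl, hx⟩
  exact ⟨u, hu, hs, hxu, fun y hy hsy hlt hxy => hmin y ⟨hy, hsy.trans hs, hxy⟩ hlt⟩

section

variable (S : LiveColoring G B s)
include S

theorem beats_asymm {v y : V} (h : Beats G B s v y) : ¬ Beats G B s y v := by
  rintro ⟨-, -, -, h'⟩
  obtain ⟨hv, hy, hadj, h⟩ := h
  rcases h with h | ⟨h1, h2⟩
  · rcases h' with h' | ⟨h', -⟩
    · rcases S.inner v y hv hy hadj with h3 | h3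
      · exact h' h3
      · exact h h3
    · exact h h'
  · rcases h' with h' | ⟨-, h'⟩
    · exact h' h1
    · rcases h2 with h2 | ⟨h2, h3⟩ <;> rcases h' with h' | ⟨h', h4⟩
      · omega
      · omega
      · omega
      · exact lt_asymm h3 h4

omit S in
theorem beats_total {v y : V} (hv : Live G B v) (hy : Live G B y) (hadj : G.Adj v y) :
    Beats G B s v y ∨ Beats G B s y v := by
  by_cases h1 : Inner G B v
  · by_cases h2 : Inner G B y
    · rcases lt_trichotomy (crossCount G B s v y) (crossCount G B s y v) with h | h | h
      · exact Or.inl ⟨hv, hy, hadj, Or.inr ⟨h1, Or.inl h⟩⟩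
      · rcases hadj.ne.lt_or_gt with h' | h'
        · exact Or.inl ⟨hv, hy, hadj, Or.inr ⟨h1, Or.inr ⟨h, h'⟩⟩⟩
        · exact Or.inr ⟨hy, hv, hadj.symm, Or.inr ⟨h2, Or.inr ⟨h.symm, h'⟩⟩⟩
      · exact Or.inr ⟨hy, hv, hadj.symm, Or.inr ⟨h2, Or.inl h⟩⟩
    · exact Or.inl ⟨hv, hy, hadj, Or.inl h2⟩
  · exact Or.inr ⟨hy, hv, hadj.symm, Or.inl h1⟩

variable (H : IsHaven G B)
include H

theorem owned_or_cut_of_adj {x x' y : V} (hy : Live G B y) (hx' : x' ∈ owned G B s y)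
    (hadj : G.Adj x' x) : x ∈ owned G B s y ∨ x ∈ starCut G B y := by
  rcases small_or_cut_of_adj hx'.1 hadj with h | h
  · refine Or.inl ⟨h, fun v hv hvs hvy hxv => ?_⟩
    have h1 := (small_or_cut_of_adj hxv hadj.symm).resolve_left (hx'.2 v hv hvs hvy)
    exact H.starCut_disjoint_small hv hy hvy.ne (S.not_adj_of_eq hy hv hvs.symm) h1 hx'.1
  · exact Or.inr h

variable [Finite V]

theorem torn_or_kept {x : V} (hx : ¬ Live G B x) :
    x ∈ torn G B s ∨ ∃ v, Live G B v ∧ x ∈ kept G B s v := by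
  obtain ⟨v₀, hv₀, hxv₀⟩ := H.exists_live_of_not_live hx
  obtain ⟨v, hv, -, hxv⟩ := exists_owned (s := s) hv₀ hxv₀
  by_cases hk : x ∈ kept G B s v
  · exact Or.inr ⟨v, hv, hk⟩
  by_cases hT : x ∈ torn G B s
  · exact Or.inl hT
  obtain ⟨y, hb, hxy⟩ : ∃ y, Beats G B s y v ∧ x ∈ owned G B s y := by
    by_contra hcon
    push Not at hcon
    exact hk ⟨hxv, fun y hy => ⟨hcon y hy, fun hc => hT ⟨y, v, hy, hc, hxv⟩⟩⟩
  refine Or.inr ⟨y, hb.1, hxy, fun z hz => ⟨fun hxz => ?_, fun hc => hT ⟨z, y, hz, hc, hxy⟩⟩⟩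
  -- `z` and `v` have the same colour, so `x` can be owned by both only if `z = v`
  have hzv : z = v := eq_of_owned hz.1 hv
    (S.eq_of_common_adj hb.1 hz.1 hv hz.2.2.1.symm hb.2.2.1) hxz hxv
  exact beats_asymm S hb (hzv ▸ hz)

theorem kept_of_adj {x x' v : V} (hv : Live G B v) (hx' : x' ∈ kept G B s v) (hadj : G.Adj x' x)
    (hxl : ¬ Live G B x) (hxT : x ∉ torn G B s) : x ∈ kept G B s v := by
  have hno : ∀ y, Beats G B s y v → x ∉ owned G B s y := by
    intro y hb hxy
    rcases owned_or_cut_of_adj S H hb.1 hxy hadj.symm with h | h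
    · exact (hx'.2 y hb).1 h
    · exact (hx'.2 y hb).2 h
  rcases owned_or_cut_of_adj S H hv hx'.1 hadj with h | h
  · exact ⟨h, fun y hb => ⟨hno y hb, fun hc => hxT ⟨y, v, hb, hc, h⟩⟩⟩
  · exfalso
    obtain ⟨y₀, hy₀, hxy₀⟩ := H.exists_live_of_not_live hxl
    obtain ⟨y, hy, -, hxy⟩ := exists_owned (s := s) hy₀ hxy₀
    have hne : x ≠ v := by rintro rfl; exact hxl hv
    rcases beats_total hv hy (adj_of_small_cut H hv hy h hne hxy.1) with hb | hb
    · exact hxT ⟨v, y, hb, h, hxy⟩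
    · exact hno y hb hxy

omit [Finite V] in
/-- The boundary of a component of the set kept by `v`. -/
theorem mem_boundary {x z v : V} (hv : Live G B v) (hx : x ∈ kept G B s v) (hadj : G.Adj x z)
    (hz : Live G B z ∨ z ∈ torn G B s) :
    z ∈ (starCut G B v \ ⋃ y ∈ {y | Beats G B s y v}, owned G B s y) ∪
      ⋃ y ∈ {y | Beats G B s y v}, starCut G B y ∩ owned G B s v := by
  rcases owned_or_cut_of_adj S H hv hx.1 hadj with h | h
  · right
    obtain ⟨u, y, hb, h1, h2⟩ := hz.resolve_left (IsHaven.not_live_of_small hv h.1)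
    have hne : z ≠ u := by
      rintro rfl
      exact IsHaven.not_live_of_small hv h.1 hb.1
    have huv := adj_of_small_cut H hb.1 hv h1 hne h.1
    have hyv : y = v := eq_of_owned hb.2.1 hv
      (S.eq_of_common_adj hb.1 hb.2.1 hv hb.2.2.1 huv) h2 h
    subst hyv
    simp only [Set.mem_iUnion]
    exact ⟨u, hb, h1, h⟩
  · left
    refine ⟨h, fun hmem => ?_⟩
    simp only [Set.mem_iUnion] at hmem
    obtain ⟨y, hb, hzy⟩ := hmem
    rcases owned_or_cut_of_adj S H hb.1 hzy hadj.symm with h' | h'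
    · exact (hx.2 y hb).1 h'
    · exact (hx.2 y hb).2 h'

omit S in
theorem ncard_starCut_le {δ : ℕ} (hδ : ∀ v, (G.neighborSet v).ncard ≤ δ) (v : V) :
    (starCut G B v).ncard ≤ δ + 1 := by
  have hsub : starCut G B v ⊆ insert v (G.neighborSet v) := by
    intro x hx
    by_cases hxv : x = v
    · exact Or.inl hxv
    · exact Or.inr (H.adj_of_starCut hx hxv)
  calc (starCut G B v).ncard ≤ (insert v (G.neighborSet v)).ncard :=
        Set.ncard_le_ncard hsub (Set.toFinite _)
    _ ≤ (G.neighborSet v).ncard + 1 := Set.ncard_insert_le _ _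
    _ ≤ δ + 1 := by have := hδ v; omega

theorem ncard_boundary_le {δ : ℕ} (hδ : ∀ v, (G.neighborSet v).ncard ≤ δ) {v : V}
    (hv : Live G B v) :
    ((starCut G B v \ ⋃ y ∈ {y | Beats G B s y v}, owned G B s y) ∪
      ⋃ y ∈ {y | Beats G B s y v}, starCut G B y ∩ owned G B s v).ncard ≤ δ + 1 := by
  classical
  by_cases hi : Inner G B v
  · have hR := Set.toFinite {y | Beats G B s y v}
    have := ncard_exchange hR.toFinset (starCut G B v) (owned G B s)
      (fun y => starCut G B y ∩ owned G B s v) (fun y hy y' hy' hne => by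
        rw [Set.Finite.mem_toFinset] at hy hy'
        rw [Set.disjoint_left]
        intro x hx hx'
        exact hne (eq_of_owned hy.1 hy'.1
          (S.eq_of_common_adj hv hy.1 hy'.1 hy.2.2.1.symm hy'.2.2.1.symm) hx hx'))
      (fun y hy => by
        rw [Set.Finite.mem_toFinset] at hy
        have h2 := (hy.2.2.2.resolve_left (not_not_intro hi)).2
        unfold crossCount at h2
        omega)
    simp only [Set.Finite.mem_toFinset] at this
    exact this.trans (ncard_starCut_le H hδ v)
  · -- the only live neighbour `c` of `v` beats `v`, and the boundary lies in its separator
    obtain ⟨c, hc, hvc⟩ := S.exists_adj v hv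
    have huniq : ∀ y, Live G B y → G.Adj v y → y = c := by
      intro y hy hvy
      by_contra hne
      exact hi ⟨hv, y, c, hne, hy, hc, hvy, hvc⟩
    have hb : Beats G B s c v := ⟨hc, hv, hvc.symm, Or.inl hi⟩
    refine (Set.ncard_le_ncard ?_ (Set.toFinite _)).trans (ncard_starCut_le H hδ c)
    rintro x (⟨hx, hxn⟩ | hx)
    · by_cases hxv : x = v
      · subst hxv
        exact H.live_adj_mem_starCut hc hv hvc.symm
      by_cases hxl : Live G B x
      · rw [huniq x hxl (H.adj_of_starCut hx hxv)]
        exact self_mem_starCut c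
      · exfalso
        obtain ⟨y₀, hy₀, hxy₀⟩ := H.exists_live_of_not_live hxl
        obtain ⟨y, hy, -, hxy⟩ := exists_owned (s := s) hy₀ hxy₀
        have hyc := huniq y hy (adj_of_small_cut H hv hy hx hxv hxy.1)
        subst hyc
        refine hxn ?_
        simp only [Set.mem_iUnion]
        exact ⟨y, hb, hxy⟩
    · simp only [Set.mem_iUnion] at hx
      obtain ⟨y, hy, hxy, -⟩ := hx
      rwa [← huniq y hy.1 hy.2.2.1.symm]

/-- A connected set that is bounded by live and torn vertices lies on the small side of a vertex
and has a small boundary. -/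
theorem exists_small_of_component {δ : ℕ} (hδ : ∀ v, (G.neighborSet v).ncard ≤ δ) {D : Set V}
    (hconn : IsConn G D) (hne : D.Nonempty) (hD : ∀ x ∈ D, ¬ Live G B x ∧ x ∉ torn G B s)
    (hcl : ∀ x ∈ D, ∀ y, G.Adj x y → y ∉ D → Live G B y ∨ y ∈ torn G B s) :
    (∃ v, D ⊆ smallSide G B v) ∧ (setNbhd G D).ncard ≤ δ + 1 := by
  obtain ⟨x₀, hx₀⟩ := hne
  obtain ⟨v, hv, hxv⟩ := (torn_or_kept S H (hD x₀ hx₀).1).resolve_left (hD x₀ hx₀).2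
  have hsub : D ⊆ kept G B s v := hconn _ ⟨x₀, hx₀, hxv⟩ fun x _ y hy hxk hadj =>
    kept_of_adj S H hv hxk hadj (hD y hy).1 (hD y hy).2
  refine ⟨⟨v, fun x hx => (hsub hx).1.1⟩, ?_⟩
  refine (Set.ncard_le_ncard ?_ (Set.toFinite _)).trans (ncard_boundary_le S H hδ hv)
  rintro z ⟨hz, x, hx, hadj⟩
  exact mem_boundary S H hv (hsub hx) hadj (hcl x hx z hadj hz)

omit S in
/-- All killers of a vertex in the star separator of a live vertex `u` are neighbours of `u`. -/
theorem killRank_lt_of_cut {δ : ℕ} (hδ : ∀ v, (G.neighborSet v).ncard ≤ δ) {u t : V}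
    (hu : Live G B u) (ht : t ∈ starCut G B u) (htu : t ≠ u) : killRank G B t < δ := by
  refine lt_of_lt_of_le (Set.ncard_lt_ncard ?_ (Set.toFinite _)) (hδ u)
  refine ⟨fun b hb => ?_, fun h => ?_⟩
  · obtain ⟨h1, h2⟩ := H.mem_starCut_of_small hu ht htu hb.1
    exact H.adj_of_starCut h1 h2
  · exact IsHaven.kills_irrefl t (h (H.adj_of_starCut ht htu))

end

end Separation

/-! ### Perfect graphs, components and weights -/

section Perfect

variable {V : Type*} {G : SimpleGraph V}

/-- A triangle-free set of vertices of a perfect graph has a proper colouring with two colours. -/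
theorem exists_two_coloring (hG : IsPerfect G) (S : Set V)
    (hS : ∀ a ∈ S, ∀ b ∈ S, ∀ c ∈ S, G.Adj a b → G.Adj a c → ¬ G.Adj b c) :
    ∃ s : V → ℕ, (∀ v, s v < 2) ∧ ∀ u ∈ S, ∀ v ∈ S, G.Adj u v → (s u + s v) % 2 = 1 := by
  classical
  have hle : (G.induce S).cliqueNum ≤ 2 := by
    obtain ⟨t, ht⟩ := (G.induce S).exists_isNClique_cliqueNum
    by_contra hlt
    push Not at hlt
    rw [← ht.card_eq, Finset.two_lt_card] at hlt
    obtain ⟨a, ha, b, hb, c, hc, hab, hac, hbc⟩ := hlt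
    exact hS a a.2 b b.2 c c.2 (ht.isClique ha hb hab) (ht.isClique ha hc hac)
      (ht.isClique hb hc hbc)
  have hcol : (G.induce S).Colorable 2 := by
    rw [← SimpleGraph.chromaticNumber_le_iff_colorable, hG S]
    exact_mod_cast hle
  obtain ⟨C⟩ := hcol
  refine ⟨fun v => if h : v ∈ S then (C ⟨v, h⟩ : ℕ) else 0, fun v => ?_, fun u hu v hv huv => ?_⟩
  · dsimp only
    split_ifs
    · exact (C _).2
    · omega
  · have h1 : C ⟨u, hu⟩ ≠ C ⟨v, hv⟩ := C.valid huv
    have h2 : (C ⟨u, hu⟩ : ℕ) ≠ C ⟨v, hv⟩ := fun h => h1 (Fin.ext h)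
    have h3 := (C ⟨u, hu⟩).2
    have h4 := (C ⟨v, hv⟩).2
    simp only [hu, hv, dif_pos]
    omega

/-- In a perfect graph, two induced paths with common ends and anticomplete interiors close up to
an even hole. -/
theorem IsPerfect.evenHoles (hG : IsPerfect G) : EvenHoles G := by
  intro x y m k hm hk hx hy h0 hend hint
  rcases (show m + k = 4 ∨ 5 ≤ m + k by omega) with h4 | h5
  · rw [h4]; decide
  -- the vertices of the hole in cyclic order
  let z : ℕ → V := fun i => if i ≤ m then x i else y (m + k - i)
  have hz1 : ∀ i ≤ m, z i = x i := fun i hi => by simp [z, hi]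
  have hz2 : ∀ i, m ≤ i → z i = y (m + k - i) := by
    intro i hi
    rcases hi.eq_or_lt with rfl | hlt
    · simp [z, hend]
    · simp [z, not_le.2 hlt]
  have hadj : ∀ i j, i < j → j < m + k →
      (G.Adj (z i) (z j) ↔ (j = i + 1 ∨ (i = 0 ∧ j + 1 = m + k))) := by
    intro i j hij hj
    by_cases hjm : j ≤ m
    · rw [hz1 i (by omega), hz1 j hjm, hx.adj_iff (by omega) hjm]
      omega
    by_cases him : m ≤ i
    · rw [hz2 i him, hz2 j (by omega), hy.adj_iff (by omega) (by omega)]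
      omega
    rw [hz1 i (by omega), hz2 j (by omega)]
    by_cases hi0 : i = 0
    · subst hi0
      rw [h0, hy.adj_iff (by omega) (by omega)]
      omega
    · have := (hint i (m + k - j) (by omega) (by omega) (by omega) (by omega)).2
      constructor
      · intro h; exact absurd h this
      · omega
  obtain ⟨s, -, hs⟩ := exists_two_coloring hG {v | ∃ i < m + k, z i = v} (by
    have key : ∀ i j l, i < j → j < l → l < m + k → G.Adj (z i) (z j) → G.Adj (z i) (z l) →
        ¬ G.Adj (z j) (z l) := by
      intro i j l hij hjl hl
      rw [hadj i j hij (by omega), hadj i l (by omega) hl, hadj j l hjl hl]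
      omega
    rintro _ ⟨i, hi, rfl⟩ _ ⟨j, hj, rfl⟩ _ ⟨l, hl, rfl⟩ h1 h2 h3
    have n1 : i ≠ j := by rintro rfl; exact h1.ne rfl
    have n2 : i ≠ l := by rintro rfl; exact h2.ne rfl
    have n3 : j ≠ l := by rintro rfl; exact h3.ne rfl
    rcases n1.lt_or_gt with a | a <;> rcases n2.lt_or_gt with b | b <;>
      rcases n3.lt_or_gt with c | c
    · exact key i j l a c hl h1 h2 h3
    · exact key i l j b c hj h2 h1 h3.symm
    · omega
    · exact key l i j b a hj h2.symm h3.symm h1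
    · exact key j i l a b hl h1.symm h3 h2
    · omega
    · exact key j l i c b hi h3 h1.symm h2.symm
    · exact key l j i c a hi h3.symm h2.symm h1.symm)
  have hpar : ∀ i < m + k, (s (z 0) + s (z i) + i) % 2 = 0 := by
    intro i
    induction i with
    | zero => intro _; omega
    | succ i ih =>
      intro hi
      have h1 := hs (z i) ⟨i, by omega, rfl⟩ (z (i + 1)) ⟨i + 1, hi, rfl⟩
        ((hadj i (i + 1) (by omega) hi).2 (Or.inl rfl))
      have h2 := ih (by omega)
      omega
  have h1 := hpar (m + k - 1) (by omega)
  have h2 := hs (z 0) ⟨0, by omega, rfl⟩ (z (m + k - 1)) ⟨m + k - 1, by omega, rfl⟩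
    ((hadj 0 (m + k - 1) (by omega) (by omega)).2 (Or.inr ⟨rfl, by omega⟩))
  rw [Nat.even_iff]
  omega

end Perfect

section Component

variable {V : Type*} {G : SimpleGraph V}

theorem IsComponentOf.subset {S D : Set V} (h : IsComponentOf G S D) : D ⊆ S := by
  obtain ⟨K, rfl⟩ := h
  rintro _ ⟨x, -, rfl⟩
  exact x.2

theorem IsComponentOf.nonempty {S D : Set V} (h : IsComponentOf G S D) : D.Nonempty := by
  obtain ⟨K, rfl⟩ := h
  exact K.nonempty_supp.image _

theorem IsComponentOf.mem_of_adj {S D : Set V} (h : IsComponentOf G S D) {x y : V} (hx : x ∈ D)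
    (hxy : G.Adj x y) (hy : y ∈ S) : y ∈ D := by
  obtain ⟨K, rfl⟩ := h
  obtain ⟨x, hx, rfl⟩ := hx
  exact ⟨⟨y, hy⟩, (K.mem_supp_congr_adj (show (G.induce S).Adj x ⟨y, hy⟩ from hxy)).1 hx, rfl⟩

theorem IsComponentOf.isConn {S D : Set V} (h : IsComponentOf G S D) : IsConn G D := by
  obtain ⟨K, rfl⟩ := h
  rintro T ⟨_, ⟨x, hx, rfl⟩, hxT⟩ hcl
  rintro _ ⟨y, hy, rfl⟩
  obtain ⟨p⟩ := K.reachable_of_mem_supp hx hy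
  induction p with
  | nil => exact hxT
  | cons hadj p ih =>
    have hv := (K.mem_supp_congr_adj hadj).1 hx
    exact ih hv (hcl _ ⟨_, hx, rfl⟩ _ ⟨_, hv, rfl⟩ hxT hadj) hy

theorem exists_component {S : Set V} {x : V} (hx : x ∈ S) :
    ∃ D, IsComponentOf G S D ∧ x ∈ D :=
  ⟨_, ⟨(G.induce S).connectedComponentMk ⟨x, hx⟩, rfl⟩, ⟨x, hx⟩,
    SimpleGraph.ConnectedComponent.connectedComponentMk_mem, rfl⟩

theorem IsComponentOf.subset_of_conn {S D E : Set V} (h : IsComponentOf G S D) (hE : IsConn G E)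
    (hES : E ⊆ S) (hne : (E ∩ D).Nonempty) : E ⊆ D :=
  hE D hne fun _ _ _ hy hx hxy => h.mem_of_adj hx hxy (hES hy)

theorem IsComponentOf.eq {S D E : Set V} (h : IsComponentOf G S D) (h' : IsComponentOf G S E)
    (hne : (D ∩ E).Nonempty) : D = E :=
  (h'.subset_of_conn h.isConn h.subset hne).antisymm
    (h.subset_of_conn h'.isConn h'.subset (Set.inter_comm D E ▸ hne))

end Component

section Weight

variable {V : Type*} [Fintype V] {w : V → ℝ}

theorem weight_add_le (hw : ∀ v, 0 ≤ w v) {X Y : Set V} (h : Disjoint X Y) :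
    weight w X + weight w Y ≤ ∑ v, w v := by
  unfold weight
  rw [← Finset.sum_add_distrib]
  refine Finset.sum_le_sum fun v _ => ?_
  have := Set.indicator_union_of_disjoint h w
  rw [show X.indicator w v + Y.indicator w v = (X ∪ Y).indicator w v from (congrFun this v).symm]
  exact Set.indicator_le_self' (fun _ _ => hw v) v

theorem inter_nonempty_of_heavy (hw : ∀ v, 0 ≤ w v) (hsum : ∑ v, w v = 1) {c : ℝ}
    (hc : 1 / 2 ≤ c) {X Y : Set V} (hX : c < weight w X) (hY : c < weight w Y) :
    (X ∩ Y).Nonempty := by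
  rw [← Set.not_disjoint_iff_nonempty_inter]
  intro h
  have := weight_add_le hw h
  linarith

end Weight

/-! ### The haven of heavy components -/

section Heavy

variable {V : Type*} {G : SimpleGraph V} {B : V → Set V}

/-- `B v` is a component of `G ∖ N[v]` of weight more than `c`. -/
structure HeavySide [Fintype V] (G : SimpleGraph V) (w : V → ℝ) (c : ℝ) (B : V → Set V) :
    Prop where
  comp : ∀ v, IsComponentOf G (closedNbhd G v)ᶜ (B v)
  heavy : ∀ v, c < weight w (B v)

theorem mem_ball_self (d : ℕ) (v : V) : v ∈ ball G d v := by simp [ball]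

theorem ball_mono {d e : ℕ} (h : d ≤ e) (v : V) : ball G d v ⊆ ball G e v := by
  intro u hu
  have hu' : G.edist v u ≤ d := hu
  exact hu'.trans (by exact_mod_cast h)

theorem mem_ball_succ {d : ℕ} {v u x : V} (hu : u ∈ ball G d v) (h : G.Adj u x) :
    x ∈ ball G (d + 1) v := by
  have h1 : G.edist v u ≤ d := hu
  have h2 : G.edist u x = 1 := SimpleGraph.edist_eq_one_iff_adj.2 h
  calc G.edist v x ≤ G.edist v u + G.edist u x := SimpleGraph.edist_triangle
    _ ≤ d + 1 := by rw [h2]; gcongr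
    _ = ((d + 1 : ℕ) : ℕ∞) := by push_cast; rfl

theorem mem_ball_one {v x : V} (h : G.Adj v x) : x ∈ ball G 1 v :=
  mem_ball_succ (mem_ball_self 0 v) h

theorem closedNbhd_subset_ball {d : ℕ} {a v : V} (hv : v ∈ ball G d a) :
    closedNbhd G v ⊆ ball G (d + 1) a := by
  rintro x (rfl | hx)
  · exact ball_mono (Nat.le_succ d) a hv
  · exact mem_ball_succ hv hx

section

variable [Fintype V] {w : V → ℝ} {c : ℝ}

/-- Without a balanced separator, deleting any part of a small ball leaves a heavy component. -/
theorem exists_heavy_component {d : ℕ}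
    (hno : ¬ ∃ X : Set V, IsBounded G d X ∧ IsBalancedSeparator G w c X) {e : ℕ} (he : e ≤ d)
    {X : Set V} {v : V} (hX : X ⊆ ball G e v) :
    ∃ D, IsComponentOf G Xᶜ D ∧ c < weight w D := by
  by_contra hcon
  push Not at hcon
  exact hno ⟨X, ⟨v, hX.trans (ball_mono he v)⟩, hcon⟩

theorem exists_heavySide {d : ℕ} (hd : 1 ≤ d)
    (hno : ¬ ∃ X : Set V, IsBounded G d X ∧ IsBalancedSeparator G w c X) :
    ∃ B, HeavySide G w c B := by
  choose B hB hB' using fun v => exists_heavy_component hno hd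
    (closedNbhd_subset_ball (G := G) (mem_ball_self 0 v))
  exact ⟨B, hB, hB'⟩

variable (hw : ∀ v, 0 ≤ w v) (hsum : ∑ v, w v = 1) (hc : 1 / 2 ≤ c) (hB : HeavySide G w c B)
include hw hsum hc hB

theorem HeavySide.isHaven : IsHaven G B where
  conn v := (hB.comp v).isConn
  self_notMem v h := (hB.comp v).subset h (Or.inl rfl)
  not_adj {v x} hx h := (hB.comp v).subset hx (Or.inr h)
  adj_of_boundary {v x y} hx hxy hy := by
    by_contra hvy
    refine hy ((hB.comp v).mem_of_adj hx hxy ?_)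
    rintro (rfl | h)
    · exact (hB.comp y).subset hx (Or.inr hxy.symm)
    · exact hvy h
  inter_nonempty u v := inter_nonempty_of_heavy hw hsum hc (hB.heavy u) (hB.heavy v)

theorem HeavySide.weight_small {v : V} {D : Set V} (hD : D ⊆ smallSide G B v) :
    weight w D ≤ c := by
  have h1 : Disjoint D (B v) := Set.disjoint_left.2 fun x hx => (hD hx).1
  have h2 := weight_add_le hw h1
  have h3 := hB.heavy v
  linarith

omit hw hsum hc in
theorem HeavySide.pawsBroken (hG : PawFriendly G) : PawsBroken G B := by
  have key : ∀ (v : V) (X : Set V), Breaks (G.induce Set.univ) ⟨v, trivial⟩ (Subtype.val ⁻¹' X) →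
      ∃ t ∈ X, t ∈ smallSide G B v := by
    rintro v X ⟨hv, hX⟩
    have hcomp : IsComponentOf (G.induce Set.univ) (closedNbhd (G.induce Set.univ) ⟨v, trivial⟩)ᶜ
        (Subtype.val ⁻¹' B v) := by
      obtain ⟨x, hx⟩ := (hB.comp v).nonempty
      have hmem : ∀ y : (Set.univ : Set V), y ∈ (closedNbhd (G.induce Set.univ) ⟨v, trivial⟩)ᶜ ↔
          (y : V) ∈ (closedNbhd G v)ᶜ := by
        intro y
        simp [closedNbhd, Subtype.ext_iff]
      obtain ⟨D, hD, hxD⟩ := exists_component (G := G.induce Set.univ)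
        ((hmem ⟨x, trivial⟩).2 ((hB.comp v).subset hx))
      have h1 : Subtype.val ⁻¹' B v = D := by
        apply Set.Subset.antisymm
        · have h2 : B v ⊆ Subtype.val '' D := by
            refine (hB.comp v).isConn _ ⟨x, hx, ⟨x, trivial⟩, hxD, rfl⟩ ?_
            rintro _ - z hz ⟨y, hy, rfl⟩ hyz
            exact ⟨⟨z, trivial⟩, hD.mem_of_adj hy hyz ((hmem ⟨z, trivial⟩).2
              ((hB.comp v).subset hz)), rfl⟩
          intro y hy
          obtain ⟨y', hy', h⟩ := h2 hy
          rwa [← Subtype.ext h]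
        · refine hD.isConn _ ⟨⟨x, trivial⟩, hxD, hx⟩ fun y hy z hz hyB hyz => ?_
          exact (hB.comp v).mem_of_adj hyB hyz ((hmem z).1 (hD.subset hz))
      rw [h1]
      exact hD
    obtain ⟨t, htX, ht⟩ := Set.not_subset.1 (hX _ hcomp)
    refine ⟨t, htX, fun h => ht (Or.inl h), ?_⟩
    rintro (h | ⟨h, y, hy, hyt⟩)
    · exact hv (by simpa [← h] using htX)
    · exact ht (Or.inr ⟨h, ⟨y, trivial⟩, hy, hyt⟩)
  intro p a b₁ b₂ hpaw
  have himg : ∀ u v : V, ({⟨u, trivial⟩, ⟨v, trivial⟩} : Set (Set.univ : Set V)) =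
      Subtype.val ⁻¹' {u, v} := by
    intro u v; ext; simp [Subtype.ext_iff]
  have himg' : ∀ u v x : V, ({⟨u, trivial⟩, ⟨v, trivial⟩, ⟨x, trivial⟩} :
      Set (Set.univ : Set V)) = Subtype.val ⁻¹' {u, v, x} := by
    intro u v x; ext; simp [Subtype.ext_iff]
  rcases hG.2 Set.univ ⟨p, trivial⟩ ⟨a, trivial⟩ ⟨b₁, trivial⟩ ⟨b₂, trivial⟩ hpaw with h | h | h
  · exact Or.inl (key _ _ (himg' p b₁ b₂ ▸ h))
  · exact Or.inr (Or.inl (key _ _ (himg p b₂ ▸ h)))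
  · exact Or.inr (Or.inr (key _ _ (himg p b₁ ▸ h)))

variable [LinearOrder V] (hconn : G.Connected)
include hconn

omit hw hsum hc hB [Fintype V] in
/-- A set of live vertices closed under adjacency of live vertices reaches, together with the small
sides of its members, the whole graph. -/
theorem mem_or_small_of_closed [Finite V] (H : IsHaven G B) {β : Set V} (hne : β.Nonempty)
    (hlive : ∀ u ∈ β, Live G B u) (hcl : ∀ u ∈ β, ∀ v, Live G B v → G.Adj u v → v ∈ β) (x : V) :
    x ∈ β ∨ ∃ u ∈ β, x ∈ smallSide G B u := by
  obtain ⟨u₀, hu₀⟩ := hne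
  obtain ⟨p⟩ := hconn u₀ x
  suffices h : ∀ y z (q : G.Walk y z), (y ∈ β ∨ ∃ u ∈ β, y ∈ smallSide G B u) →
      (z ∈ β ∨ ∃ u ∈ β, z ∈ smallSide G B u) from h _ _ p (Or.inl hu₀)
  intro y z q
  induction q with
  | nil => exact id
  | @cons y y' z hadj q ih =>
    intro hy
    refine ih ?_
    by_cases hl : Live G B y'
    · left
      rcases hy with hy | ⟨u, hu, hyu⟩
      · exact hcl y hy y' hl hadj
      · have h := IsHaven.live_adj_small hl (hlive u hu) hyu hadj
        by_cases hne : y' = u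
        · rwa [hne]
        · exact hcl u hu y' hl (H.adj_of_starCut h hne)
    · obtain ⟨v, hv, hyv⟩ := H.exists_live_of_not_live hl
      rcases hy with hy | ⟨u, hu, hyu⟩
      · right
        refine ⟨v, ?_, hyv⟩
        have h := IsHaven.live_adj_small (hlive y hy) hv hyv hadj.symm
        by_cases hne : v = y
        · rwa [hne]
        · exact hcl y hy v hv (H.adj_of_starCut h (Ne.symm hne)).symm
      · rcases small_or_cut_of_adj hyu hadj with h | h
        · exact Or.inr ⟨u, hu, h⟩
        · have hne : y' ≠ u := by rintro rfl; exact hl (hlive _ hu)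
          exact Or.inr ⟨v, hcl u hu v hv (adj_of_small_cut H (hlive u hu) hv h hne hyv), hyv⟩

omit hw hsum hc hB [Fintype V] in
/-- The live vertices induce a connected graph. -/
theorem live_subset_of_closed [Finite V] (H : IsHaven G B) {β : Set V} (hne : β.Nonempty)
    (hlive : ∀ u ∈ β, Live G B u) (hcl : ∀ u ∈ β, ∀ v, Live G B v → G.Adj u v → v ∈ β) {x : V}
    (hx : Live G B x) : x ∈ β := by
  rcases mem_or_small_of_closed hconn H hne hlive hcl x with h | ⟨u, hu, h⟩
  · exact h
  · exact absurd h (IsHaven.not_small_of_live hx (hlive u hu))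

variable {d : ℕ} (hd : 3 ≤ d)
  (hno : ¬ ∃ X : Set V, IsBounded G d X ∧ IsBalancedSeparator G w c X)
include hd hno

/-- The live vertices are not confined to a small ball. -/
theorem HeavySide.not_closed_of_ball {β : Set V} (hne : β.Nonempty)
    (hlive : ∀ u ∈ β, Live G B u) {a : V} (hball : β ⊆ ball G 2 a) :
    ¬ ∀ u ∈ β, ∀ v, Live G B v → G.Adj u v → v ∈ β := by
  intro hcl
  have H := hB.isHaven hw hsum hc
  obtain ⟨D, hD, hDw⟩ := exists_heavy_component hno hd (Set.Subset.refl (ball G 3 a))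
  obtain ⟨x, hx⟩ := hD.nonempty
  rcases mem_or_small_of_closed hconn H hne hlive hcl x with h | ⟨u, hu, h⟩
  · exact hD.subset hx (ball_mono (by omega) a (hball h))
  · have hsub : D ⊆ B u := (hB.comp u).subset_of_conn hD.isConn
      (fun y hy hyu => hD.subset hy (closedNbhd_subset_ball (hball hu) hyu))
      (inter_nonempty_of_heavy hw hsum hc hDw (hB.heavy u))
    exact h.1 (hsub hx)

omit hw hsum hc hB hconn hd hno [Fintype V] in
/-- There is no paw in the central bag. -/
theorem not_isPaw_of_live (hP : PawsBroken G B) {p a b b' : V} (hp : Live G B p)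
    (ha : Live G B a) (hb : Live G B b) (hb' : Live G B b') : ¬ IsPaw G p a b b' := by
  intro h
  rcases hP p a b b' h with ⟨t, ht, hs⟩ | ⟨t, ht, hs⟩ | ⟨t, ht, hs⟩ <;>
    simp only [Set.mem_insert_iff, Set.mem_singleton_iff] at ht
  · rcases ht with rfl | rfl | rfl
    · exact IsHaven.not_small_of_live hp ha hs
    · exact IsHaven.not_small_of_live hb ha hs
    · exact IsHaven.not_small_of_live hb' ha hs
  · rcases ht with rfl | rfl
    · exact IsHaven.not_small_of_live hp hb hs
    · exact IsHaven.not_small_of_live hb' hb hs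
  · rcases ht with rfl | rfl
    · exact IsHaven.not_small_of_live hp hb' hs
    · exact IsHaven.not_small_of_live hb hb' hs

/-- The central bag has no triangle: otherwise, as it has no paw, the live vertices adjacent to two
vertices of the triangle would be closed under adjacency. -/
theorem HeavySide.live_triangle_free (hP : PawsBroken G B) {x y z : V} (hx : Live G B x)
    (hy : Live G B y) (hz : Live G B z) (hxy : G.Adj x y) (hxz : G.Adj x z) : ¬ G.Adj y z := by
  intro hyz
  let two : V → Prop := fun v => (G.Adj v x ∧ G.Adj v y) ∨ (G.Adj v x ∧ G.Adj v z) ∨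
    (G.Adj v y ∧ G.Adj v z)
  have key : ∀ p q r, Live G B p → Live G B q → Live G B r → G.Adj p q → G.Adj p r → G.Adj q r →
      ∀ v u, Live G B v → Live G B u → G.Adj v p → G.Adj v q → G.Adj v u →
      (G.Adj u p ∧ G.Adj u q) ∨ (G.Adj u p ∧ G.Adj u r) ∨ (G.Adj u q ∧ G.Adj u r) := by
    intro p q r hp hq hr hpq hpr hqr v u hv hu hvp hvq hvu
    have h1 : G.Adj u p ∨ G.Adj u q := by
      by_contra hcon
      push Not at hcon
      exact not_isPaw_of_live hP hu hv hp hq ⟨hvp, hvq, hpq, hvu, hcon.1, hcon.2⟩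
    rcases h1 with h1 | h1
    · by_cases h2 : G.Adj u q
      · exact Or.inl ⟨h1, h2⟩
      · by_cases h3 : G.Adj u r
        · exact Or.inr (Or.inl ⟨h1, h3⟩)
        · exact absurd ⟨hpq, hpr, hqr, h1.symm, h2, h3⟩ (not_isPaw_of_live hP hu hp hq hr)
    · by_cases h2 : G.Adj u p
      · exact Or.inl ⟨h2, h1⟩
      · by_cases h3 : G.Adj u r
        · exact Or.inr (Or.inr ⟨h1, h3⟩)
        · exact absurd ⟨hpq.symm, hqr, hpr, h1.symm, h2, h3⟩ (not_isPaw_of_live hP hu hq hp hr)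
  refine hB.not_closed_of_ball hw hsum hc hconn hd hno (β := {v | Live G B v ∧ two v})
    ⟨x, hx, Or.inr (Or.inr ⟨hxy, hxz⟩)⟩ (fun u hu => hu.1) (a := x) ?_ ?_
  · rintro v ⟨-, hv⟩
    rcases hv with ⟨h, -⟩ | ⟨h, -⟩ | ⟨h, -⟩
    · exact ball_mono (by omega) x (mem_ball_one h.symm)
    · exact ball_mono (by omega) x (mem_ball_one h.symm)
    · exact mem_ball_succ (mem_ball_one hxy) h.symm
  · rintro v ⟨hv, h⟩ u hu hvu
    refine ⟨hu, ?_⟩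
    rcases h with ⟨h1, h2⟩ | ⟨h1, h2⟩ | ⟨h1, h2⟩
    · exact key x y z hx hy hz hxy hxz hyz v u hv hu h1 h2 hvu
    · have := key x z y hx hz hy hxz hxy hyz.symm v u hv hu h1 h2 hvu
      tauto
    · have := key y z x hy hz hx hyz hxy.symm hxz.symm v u hv hu h1 h2 hvu
      tauto

/-- A proper colouring of the central bag with two colours has all the properties that the
construction needs. -/
theorem HeavySide.liveColoring {s : V → ℕ} (hs : ∀ v, s v < 2)
    (hs' : ∀ u v, Live G B u → Live G B v → G.Adj u v → (s u + s v) % 2 = 1) :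
    LiveColoring G B s where
  lt_two := hs
  adj := hs'
  exists_adj v hv := by
    by_contra hcon
    push Not at hcon
    refine hB.not_closed_of_ball hw hsum hc hconn hd hno (β := {v}) ⟨v, rfl⟩ (by simpa using hv)
      (a := v) (by simpa using mem_ball_self 2 v) ?_
    rintro _ rfl u hu huv
    exact absurd huv (hcon u hu)
  inner u v hu hv huv := by
    by_contra hcon
    push Not at hcon
    obtain ⟨h1, h2⟩ := hcon
    refine hB.not_closed_of_ball hw hsum hc hconn hd hno (β := {u, v}) ⟨u, Or.inl rfl⟩
      (by rintro x (rfl | rfl) <;> assumption) (a := u) ?_ ?_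
    · rintro x (rfl | rfl)
      · exact mem_ball_self 2 x
      · exact ball_mono (by omega) u (mem_ball_one huv)
    · rintro x (rfl | rfl) y hy hxy
      · right
        by_contra hne
        exact h1 ⟨hu, y, v, hne, hy, hv, hxy, huv⟩
      · left
        by_contra hne
        exact h2 ⟨hv, y, u, hne, hy, hu, hxy, huv.symm⟩

theorem HeavySide.exists_coloring (hG : PawFriendly G) :
    ∃ s : V → ℕ, (∀ v, s v < 2) ∧
      ∀ u v, Live G B u → Live G B v → G.Adj u v → (s u + s v) % 2 = 1 := by
  obtain ⟨s, h1, h2⟩ := exists_two_coloring hG.1 {v | Live G B v}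
    (fun x hx y hy z hz hxy hxz => hB.live_triangle_free hw hsum hc hconn hd hno
      (hB.pawsBroken hG) hx hy hz hxy hxz)
  exact ⟨s, h1, fun u v hu hv => h2 u hu v hv⟩

end

end Heavy

/-! ### The even set separator -/

section Output

variable {V : Type*} [LinearOrder V] {G : SimpleGraph V} {B : V → Set V} {s : V → ℕ}

omit [LinearOrder V] in
theorem IsInducedPath.indPath {W : Set V} {x y : W} {p : (G.induce W).Walk x y}
    (hp : IsInducedPath (G.induce W) p) : IndPath G (fun i => (p.getVert i : V)) p.length := by
  have hinj : ∀ i j, i ≤ p.length → j ≤ p.length → p.getVert i = p.getVert j → i = j :=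
    fun i j hi hj h => hp.1.getVert_injOn hi hj h
  intro i j hij hj
  refine ⟨fun h => ?_, fun h => ?_, ?_⟩
  · have := hinj i j (by omega) hj (Subtype.ext h)
    omega
  · have hmem := hp.2 _ (p.getVert_mem_support i) _ (p.getVert_mem_support j) h
    obtain ⟨k, hk, he⟩ := (SimpleGraph.Walk.mk_mem_edges_iff_exists p).1 hmem
    rcases Sym2.eq_iff.1 he.symm with ⟨h1, h2⟩ | ⟨h1, h2⟩
    · have := hinj i k (by omega) hk.le h1
      have := hinj j (k + 1) hj hk h2
      omega
    · have := hinj i (k + 1) (by omega) hk h1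
      have := hinj j k hj hk.le h2
      omega
  · rintro rfl
    exact p.adj_getVert_succ hj

/-- The labels written by the algorithm: a live vertex is labelled by its colour, and a torn vertex
by its rank and the colour of a vertex that tears it. All other vertices have label `0`. -/
structure OutputLabel (G : SimpleGraph V) (B : V → Set V) (s : V → ℕ) (out : V → ℕ) : Prop where
  of_live : ∀ x, Live G B x → out x = s x + 1
  of_torn : ∀ x, x ∈ torn G B s → ∃ u y, Beats G B s u y ∧ x ∈ starCut G B u ∧ x ∈ owned G B s y ∧
    out x = 2 * killRank G B x + s u + 1
  of_other : ∀ x, ¬ Live G B x → x ∉ torn G B s → out x = 0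

theorem not_live_of_torn {x : V} (hx : x ∈ torn G B s) : ¬ Live G B x := by
  obtain ⟨u, y, hb, -, h⟩ := hx
  exact IsHaven.not_live_of_small hb.2.1 h.1

theorem OutputLabel.pos_iff {out : V → ℕ} (hout : OutputLabel G B s out) (x : V) :
    0 < out x ↔ Live G B x ∨ x ∈ torn G B s := by
  constructor
  · intro h
    by_contra hcon
    push Not at hcon
    have := hout.of_other x hcon.1 hcon.2
    omega
  · rintro (h | h)
    · rw [hout.of_live x h]; omega
    · obtain ⟨u, y, -, -, -, h⟩ := hout.of_torn x h
      omega

variable [Fintype V]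

theorem OutputLabel.le {out : V → ℕ} (hout : OutputLabel G B s out) (H : IsHaven G B)
    (S : LiveColoring G B s) {δ : ℕ} (hδ : ∀ v, (G.neighborSet v).ncard ≤ δ) (x : V) :
    out x ≤ δ ^ 2 + 2 := by
  by_cases hl : Live G B x
  · have := S.lt_two x
    rw [hout.of_live x hl]
    omega
  by_cases ht : x ∈ torn G B s
  · obtain ⟨u, y, hb, h1, h2, h3⟩ := hout.of_torn x ht
    have hne : x ≠ u := by rintro rfl; exact hl hb.1
    have h4 := killRank_lt_of_cut H hδ hb.1 h1 hne
    have h5 := S.lt_two u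
    rw [h3]
    nlinarith [sq_nonneg ((δ : ℤ) - 1), h4, h5]
  · rw [hout.of_other x hl ht]
    omega

/-- An induced path that avoids all lower labels and whose ends have the same label is even. -/
theorem OutputLabel.even {out : V → ℕ} (hout : OutputLabel G B s out) (H : IsHaven G B)
    (S : LiveColoring G B s) (hE : EvenHoles G) (hP : PawsBroken G B) {x : ℕ → V} {m : ℕ}
    (hx : IndPath G x m) (h0 : 0 < out (x 0)) (hm : out (x m) = out (x 0))
    (hmin : ∀ i ≤ m, out (x i) = 0 ∨ out (x 0) ≤ out (x i)) : Even m := by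
  have htorn : ∀ t, t ∈ torn G B s → 3 ≤ out t := by
    intro t ht
    obtain ⟨u, y, -, -, -, h⟩ := hout.of_torn t ht
    have := mt (IsHaven.live_iff_killRank (G := G) (B := B)).2 (not_live_of_torn ht)
    omega
  have hlive : ∀ t, Live G B t → out t ≤ 2 := by
    intro t ht
    have := S.lt_two t
    rw [hout.of_live t ht]
    omega
  rcases (hout.pos_iff _).1 h0 with hl | ht
  · have hml : Live G B (x m) := by
      refine ((hout.pos_iff _).1 (by omega)).resolve_right fun h => ?_
      have := htorn _ h
      have := hlive _ hl
      omega
    have h1 := live_parity H hE hP S.adj hx hl hml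
    have h2 := hout.of_live _ hl
    have h3 := hout.of_live _ hml
    rw [Nat.even_iff]
    omega
  · have h3 := htorn _ ht
    have hmt : x m ∈ torn G B s := by
      refine ((hout.pos_iff _).1 (by omega)).resolve_left fun h => ?_
      have := hlive _ h
      omega
    obtain ⟨u, y, hb, h4, h5, h6⟩ := hout.of_torn _ ht
    obtain ⟨u', y', hb', h4', h5', h6'⟩ := hout.of_torn _ hmt
    have h7 := S.lt_two u
    have h8 := S.lt_two u'
    refine torn_parity H S hE hP hx (fun i hi h => ?_) (by omega) hb hb' h4 h5 h4' h5' (by omega)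
      fun i hi h => ?_
    · have h9 := hlive _ h
      have h10 := (hout.pos_iff _).2 (Or.inl h)
      rcases hmin i hi with h11 | h11 <;> omega
    · obtain ⟨u'', y'', -, -, -, h9⟩ := hout.of_torn _ h
      rcases hmin i hi with h11 | h11
      · omega
      · have := S.lt_two u''
        omega

theorem OutputLabel.isEvenSetSeparator {out : V → ℕ} (hout : OutputLabel G B s out)
    {w : V → ℝ} (hw : ∀ v, 0 ≤ w v) (hsum : ∑ v, w v = 1) {c : ℝ} (hc : 1 / 2 ≤ c)
    (hB : HeavySide G w c B) (S : LiveColoring G B s) (hE : EvenHoles G) (hP : PawsBroken G B)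
    {δ : ℕ} (hδ : ∀ v, (G.neighborSet v).ncard ≤ δ) :
    IsEvenSetSeparator G w (δ ^ 2 + 2) c (δ + 1)
      (fun i : Fin (δ ^ 2 + 2) => {v | out v = (i : ℕ) + 1}) := by
  have H := hB.isHaven hw hsum hc
  refine ⟨⟨fun i j hij => ?_, fun i => ?_⟩, fun D hD => ?_⟩
  · rw [Set.disjoint_left]
    intro v hv hv'
    simp only [Set.mem_ofPred_eq] at hv hv'
    exact hij (Fin.ext (by omega))
  · rintro x hx y hy - p hp
    simp only [Set.mem_preimage, Set.mem_ofPred_eq] at hx hy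
    have hx' := hp.indPath
    refine hout.even H S hE hP hx' (by simp [hx]) (by simp [hx, hy]) fun t ht => ?_
    simp only [SimpleGraph.Walk.getVert_zero, hx]
    by_contra hcon
    push Not at hcon
    obtain ⟨h1, h2⟩ := hcon
    have hi := i.2
    refine (p.getVert t).2 ?_
    simp only [Set.mem_iUnion]
    exact ⟨⟨out (p.getVert t) - 1, by omega⟩, Fin.lt_def.2 (by simp only; omega), by
      simp only [Set.mem_ofPred_eq]; omega⟩
  · have hmem : ∀ x, x ∈ (⋃ i : Fin (δ ^ 2 + 2), {v | out v = (i : ℕ) + 1}) ↔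
        Live G B x ∨ x ∈ torn G B s := by
      intro x
      rw [← hout.pos_iff, Set.mem_iUnion]
      constructor
      · rintro ⟨i, hi⟩
        simp only [Set.mem_ofPred_eq] at hi
        omega
      · intro h
        have := hout.le H S hδ x
        exact ⟨⟨out x - 1, by omega⟩, by simp only [Set.mem_ofPred_eq]; omega⟩
    obtain ⟨⟨v, hv⟩, hN⟩ := exists_small_of_component S H hδ hD.isConn hD.nonempty
      (fun x hx => by
        have := mt (hmem x).2 (hD.subset hx)
        tauto)
      (fun x hx y hxy hy => by
        by_contra hcon
        exact hy (hD.mem_of_adj hx hxy (mt (hmem y).1 hcon)))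
    exact ⟨hN, hB.weight_small hw hsum hc hv⟩

end Output

/-! ### Running programs -/

section Machine

/-- The program `p`, started in `s`, halts after at most `K` steps in a state satisfying `Q`. -/
def Halts (p : Prog) (s : State) (K : ℕ) (Q : State → Prop) : Prop :=
  ∃ t s', Runs p s t s' ∧ t ≤ K ∧ Q s'

theorem Halts.mono {p : Prog} {s : State} {K K' : ℕ} {Q Q' : State → Prop} (h : Halts p s K Q)
    (hK : K ≤ K') (hQ : ∀ s', Q s' → Q' s') : Halts p s K' Q' := by
  obtain ⟨t, s', h1, h2, h3⟩ := h
  exact ⟨t, s', h1, h2.trans hK, hQ _ h3⟩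

theorem Halts.seq {p q : Prog} {s : State} {K K' : ℕ} {Q Q' : State → Prop}
    (h : Halts p s K Q) (h' : ∀ s', Q s' → Halts q s' K' Q') :
    Halts (.seq p q) s (K + K') Q' := by
  obtain ⟨t, s', h1, h2, h3⟩ := h
  obtain ⟨t', s'', h4, h5, h6⟩ := h' s' h3
  exact ⟨t + t', s'', .seq h1 h4, by omega, h6⟩

theorem halts_write {a : ℕ} {i j e : NExpr} {s : State} {Q : State → Prop}
    (h : Q (s.setNat a (i.eval s) (j.eval s) (e.eval s))) : Halts (.write a i j e) s 1 Q :=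
  ⟨1, _, .write a i j e s, le_rfl, h⟩

theorem halts_writeReal {a : ℕ} {i : NExpr} {e : RExpr} {s : State} {Q : State → Prop}
    (h : Q (s.setReal a (i.eval s) (e.eval s))) : Halts (.writeReal a i e) s 1 Q :=
  ⟨1, _, .writeReal a i e s, le_rfl, h⟩

theorem halts_skip {s : State} {Q : State → Prop} (h : Q s) : Halts .skip s 1 Q :=
  ⟨1, _, .skip s, le_rfl, h⟩

theorem halts_cond {b : Test} {p q : Prog} {s : State} {K : ℕ} {Q : State → Prop}
    (hp : b.holds s → Halts p s K Q) (hq : ¬ b.holds s → Halts q s K Q) :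
    Halts (.cond b p q) s (K + 1) Q := by
  by_cases hb : b.holds s
  · obtain ⟨t, s', h1, h2, h3⟩ := hp hb
    exact ⟨t + 1, s', .condTrue hb h1, by omega, h3⟩
  · obtain ⟨t, s', h1, h2, h3⟩ := hq hb
    exact ⟨t + 1, s', .condFalse hb h1, by omega, h3⟩

/-- Loop counter number `k`. Counters are kept in integer array `3`. -/
def ctr (k : ℕ) : NExpr := .read 3 (.const k) (.const 0)

/-- The number of vertices. -/
def size : NExpr := .read 0 (.const 0) (.const 0)

/-- `e < f`. -/
def Test.lt (e f : NExpr) : Test := .neg (.natLe f e)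

/-- `e = f`. -/
def Test.eq (e f : NExpr) : Test := .both (.natLe e f) (.natLe f e)

/-- Disjunction of tests. -/
def Test.or (b b' : Test) : Test := .neg (.both (.neg b) (.neg b'))

/-- The entry of integer array `a` at `(i, j)` is not zero. -/
def Test.rel (a : ℕ) (i j : NExpr) : Test := .natLe (.const 1) (.read a i j)

/-- `for counter k from 0 below bound do p`. -/
def Prog.iterate (k : ℕ) (bound : NExpr) (p : Prog) : Prog :=
  .seq (.write 3 (.const k) (.const 0) (.const 0))
    (.loop (.lt (ctr k) bound) (.seq p (.write 3 (.const k) (.const 0) (.succ (ctr k)))))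

@[simp] theorem ctr_eval (k : ℕ) (s : State) : (ctr k).eval s = s.nat 3 k 0 := rfl

@[simp] theorem size_eval (s : State) : size.eval s = s.nat 0 0 0 := rfl

@[simp] theorem Test.lt_holds (s : State) (e f : NExpr) :
    (Test.lt e f).holds s ↔ e.eval s < f.eval s := not_le

@[simp] theorem Test.eq_holds (s : State) (e f : NExpr) :
    (Test.eq e f).holds s ↔ e.eval s = f.eval s := le_antisymm_iff.symm

@[simp] theorem Test.or_holds (s : State) (b b' : Test) :
    (Test.or b b').holds s ↔ b.holds s ∨ b'.holds s := by
  simp only [Test.or, Test.holds]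
  tauto

@[simp] theorem Test.rel_holds (s : State) (a : ℕ) (i j : NExpr) :
    (Test.rel a i j).holds s ↔ 1 ≤ s.nat a (i.eval s) (j.eval s) := by
  simp only [Test.rel, Test.holds, NExpr.eval]

@[simp] theorem Test.both_holds (s : State) (b b' : Test) :
    (Test.both b b').holds s ↔ b.holds s ∧ b'.holds s := by
  simp only [Test.holds]

@[simp] theorem Test.neg_holds (s : State) (b : Test) :
    (Test.neg b).holds s ↔ ¬ b.holds s := by
  simp only [Test.holds]

theorem halts_loop {k b : ℕ} {bound : NExpr} {p : Prog} {K : ℕ} {I : ℕ → State → Prop}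
    (hbound : ∀ i σ, I i σ → bound.eval σ = b)
    (hset : ∀ i σ v, I i σ → I i (σ.setNat 3 k 0 v))
    (hp : ∀ i σ, i < b → I i σ → σ.nat 3 k 0 = i →
      Halts p σ K (fun σ' => σ'.nat 3 k 0 = i ∧ I (i + 1) σ')) :
    ∀ (m i : ℕ) (s : State), i + m = b → I i s → s.nat 3 k 0 = i →
      Halts (.loop (.lt (ctr k) bound) (.seq p (.write 3 (.const k) (.const 0) (.succ (ctr k))))) s
        (m * (K + 2) + 1) (I b) := by
  intro m
  induction m with
  | zero =>
    intro i s hi hI hs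
    obtain rfl : i = b := by omega
    refine ⟨1, s, .loopFalse ?_, by omega, hI⟩
    simp [hs, hbound _ _ hI]
  | succ m ih =>
    intro i s hi hI hs
    obtain ⟨t, s₁, h1, h2, h3, h4⟩ := hp i s (by omega) hI hs
    obtain ⟨t', s₂, h5, h6, h7⟩ := ih (i + 1) (s₁.setNat 3 k 0 (i + 1)) (by omega)
      (hset _ _ _ h4) (by simp [State.setNat])
    have hb : (Test.lt (ctr k) bound).holds s := by
      simp only [Test.lt_holds, ctr_eval, hs, hbound _ _ hI]
      omega
    have hw : Runs (.write 3 (.const k) (.const 0) (.succ (ctr k))) s₁ 1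
        (s₁.setNat 3 k 0 (i + 1)) := by
      simpa only [NExpr.eval, ctr_eval, h3] using
        Runs.write 3 (.const k) (.const 0) (.succ (ctr k)) s₁
    refine ⟨_, s₂, .loopTrue hb (.seq h1 hw) h5, ?_, h7⟩
    have : (m + 1) * (K + 2) = m * (K + 2) + (K + 2) := by ring
    omega

/-- The rule for counted loops. The invariant `I` must not speak of the loop counter. -/
theorem halts_iterate {k b : ℕ} {bound : NExpr} {p : Prog} {K : ℕ} {I : ℕ → State → Prop}
    {s : State} (hbound : ∀ i σ, I i σ → bound.eval σ = b)
    (hset : ∀ i σ v, I i σ → I i (σ.setNat 3 k 0 v))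
    (hp : ∀ i σ, i < b → I i σ → σ.nat 3 k 0 = i →
      Halts p σ K (fun σ' => σ'.nat 3 k 0 = i ∧ I (i + 1) σ')) (h0 : I 0 s) :
    Halts (Prog.iterate k bound p) s (b * (K + 2) + 2) (I b) := by
  have h := Halts.seq (halts_write (a := 3) (i := .const k) (j := .const 0) (e := .const 0)
    (Q := fun σ => I 0 σ ∧ σ.nat 3 k 0 = 0) (s := s) ⟨hset _ _ _ h0, by
      simp [State.setNat, NExpr.eval]⟩)
    (fun σ hσ => halts_loop hbound hset hp b 0 σ (by omega) hσ.1 hσ.2)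
  exact h.mono (by omega) fun _ => id

/-- `σ` differs from `s` at most in integer array `W` and in the loop counters below `d`. -/
structure Keeps (W d : ℕ) (s σ : State) : Prop where
  real : σ.real = s.real
  nat : ∀ a, a ≠ 3 → a ≠ W → σ.nat a = s.nat a
  ctr : ∀ k, d ≤ k → σ.nat 3 k 0 = s.nat 3 k 0

theorem Keeps.refl (W d : ℕ) (s : State) : Keeps W d s s :=
  ⟨rfl, fun _ _ _ => rfl, fun _ _ => rfl⟩

theorem Keeps.setCtr {W d : ℕ} {s σ : State} (h : Keeps W d s σ) {k : ℕ} (hk : k < d) (v : ℕ) :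
    Keeps W d s (σ.setNat 3 k 0 v) := by
  refine ⟨h.real, fun a h3 hW => ?_, fun l hl => ?_⟩
  · rw [← h.nat a h3 hW]
    funext i j
    simp [State.setNat, h3]
  · rw [← h.ctr l hl]
    have : l ≠ k := by omega
    simp [State.setNat, this]

theorem Keeps.setTab {W d : ℕ} {s σ : State} (h : Keeps W d s σ) (hW3 : W ≠ 3) (i j v : ℕ) :
    Keeps W d s (σ.setNat W i j v) := by
  refine ⟨h.real, fun a h3 hW => ?_, fun l hl => ?_⟩
  · rw [← h.nat a h3 hW]
    funext i j
    simp [State.setNat, hW]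
  · rw [← h.ctr l hl]
    simp [State.setNat, hW3.symm]

/-- Compute integer array `W`: cell `(i, j)`, where `i` and `j` run through the vertices, is set to
`init` and then updated for every value of counter `2` below `bound`: to `e₁` if `b₁` holds, and
otherwise to `e₂` if `b₂` holds. -/
def Prog.table (W : ℕ) (init bound : NExpr) (b₁ : Test) (e₁ : NExpr) (b₂ : Test) (e₂ : NExpr) :
    Prog :=
  .iterate 0 size (.iterate 1 size (.seq (.write W (ctr 0) (ctr 1) init)
    (.iterate 2 bound (.cond b₁ (.write W (ctr 0) (ctr 1) e₁)
      (.cond b₂ (.write W (ctr 0) (ctr 1) e₂) .skip)))))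

/-- The number of steps of a table computation with `n` rows and columns and bound `b`. -/
def tableCost (n b : ℕ) : ℕ := n * (n * (1 + (b * 5 + 2) + 2) + 2 + 2) + 2

/-- The situation in the computation of cell `(i, j)` of table `W`, starting from `s`: the
rows above row `i` satisfy the specification `Φ`. -/
structure InCell (n W : ℕ) (Φ : ℕ → ℕ → ℕ → Prop) (s : State) (i j : ℕ) (σ : State) : Prop
    extends Keeps W 3 s σ where
  row : σ.nat 3 0 0 = i
  col : σ.nat 3 1 0 = j
  rows : ∀ i' < i, ∀ j' < n, Φ i' j' (σ.nat W i' j')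

open Classical in
/-- The rule for table computations. `Φ i j` specifies cell `(i, j)`, and `Ψ i j k` is the
invariant for this cell after `k` updates. -/
theorem halts_table {n W b : ℕ} (hW0 : W ≠ 0) (hW3 : W ≠ 3) {init bound : NExpr} {b₁ b₂ : Test}
    {e₁ e₂ : NExpr} {s : State} (hn : s.nat 0 0 0 = n) (Φ : ℕ → ℕ → ℕ → Prop)
    (Ψ : ℕ → ℕ → ℕ → ℕ → Prop)
    (hbound : ∀ σ, Keeps W 3 s σ → bound.eval σ = b)
    (hinit : ∀ i < n, ∀ j < n, ∀ σ, InCell n W Φ s i j σ → Ψ i j 0 (init.eval σ))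
    (hstep : ∀ i < n, ∀ j < n, ∀ k < b, ∀ σ, InCell n W Φ s i j σ → σ.nat 3 2 0 = k →
      Ψ i j k (σ.nat W i j) → Ψ i j (k + 1)
        (if b₁.holds σ then e₁.eval σ else if b₂.holds σ then e₂.eval σ else σ.nat W i j))
    (hfin : ∀ i < n, ∀ j < n, ∀ v, Ψ i j b v → Φ i j v) :
    Halts (Prog.table W init bound b₁ e₁ b₂ e₂) s (tableCost n b)
      (fun s' => Keeps W 3 s s' ∧ ∀ i < n, ∀ j < n, Φ i j (s'.nat W i j)) := by
  have hsize : ∀ σ, Keeps W 3 s σ → size.eval σ = n := fun σ h => by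
    rw [size_eval, h.nat 0 (by decide) hW0.symm, hn]
  have hcW : ∀ (σ : State) (k v : ℕ) (i j : ℕ), (σ.setNat 3 k 0 v).nat W i j = σ.nat W i j := by
    intro σ k v i j
    simp [State.setNat, hW3]
  have hWc : ∀ (σ : State) (k v : ℕ) (i j : ℕ), (σ.setNat W i j v).nat 3 k 0 = σ.nat 3 k 0 := by
    intro σ k v i j
    simp [State.setNat, hW3.symm]
  have hcc : ∀ (σ : State) (k l v : ℕ), k ≠ l → (σ.setNat 3 k 0 v).nat 3 l 0 = σ.nat 3 l 0 := by
    intro σ k l v h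
    simp [State.setNat, h.symm]
  -- one cell
  have hcell : ∀ i < n, ∀ j < n, ∀ σ, (InCell n W Φ s i j σ ∧
      ∀ j' < j, Φ i j' (σ.nat W i j')) →
      Halts (.seq (.write W (ctr 0) (ctr 1) init) (.iterate 2 bound
        (.cond b₁ (.write W (ctr 0) (ctr 1) e₁) (.cond b₂ (.write W (ctr 0) (ctr 1) e₂) .skip)))) σ
        (1 + (b * 5 + 2)) (fun σ' => InCell n W Φ s i j σ' ∧
          ∀ j' < j + 1, Φ i j' (σ'.nat W i j')) := by
    intro i hi j hj σ hσ
    -- overwriting cell `(i, j)` keeps everything but the value of this cell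
    have hwrite : ∀ (τ : State) (v : ℕ), (InCell n W Φ s i j τ ∧
        ∀ j' < j, Φ i j' (τ.nat W i j')) → (InCell n W Φ s i j (τ.setNat W i j v) ∧
          ∀ j' < j, Φ i j' ((τ.setNat W i j v).nat W i j')) ∧
          (τ.setNat W i j v).nat W i j = v := by
      rintro τ v ⟨h1, h2⟩
      refine ⟨⟨⟨h1.toKeeps.setTab hW3 _ _ _, ?_, ?_, fun i' hi' j' hj' => ?_⟩,
        fun j' hj' => ?_⟩, ?_⟩
      · rw [hWc, h1.row]
      · rw [hWc, h1.col]
      · have : i' ≠ i := by omega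
        simpa [State.setNat, this] using h1.rows i' hi' j' hj'
      · have : j' ≠ j := by omega
        simpa [State.setNat, this] using h2 j' hj'
      · simp [State.setNat]
    have hstart := hwrite σ (init.eval σ) hσ
    refine Halts.seq (halts_write (Q := fun τ => (InCell n W Φ s i j τ ∧
        ∀ j' < j, Φ i j' (τ.nat W i j')) ∧ Ψ i j 0 (τ.nat W i j)) ?_) ?_
    · rw [ctr_eval, ctr_eval, hσ.1.row, hσ.1.col]
      exact ⟨hstart.1, by rw [hstart.2]; exact hinit i hi j hj σ hσ.1⟩
    · intro τ hτ
      refine (halts_iterate (k := 2) (b := b) (K := 3) (I := fun k τ => (InCell n W Φ s i j τ ∧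
        ∀ j' < j, Φ i j' (τ.nat W i j')) ∧ Ψ i j k (τ.nat W i j)) ?_ ?_ ?_ hτ).mono le_rfl ?_
      · intro k τ h
        exact hbound τ h.1.1.toKeeps
      · rintro k τ v ⟨⟨h1, h2⟩, h3⟩
        refine ⟨⟨⟨h1.toKeeps.setCtr (by omega) v, ?_, ?_, ?_⟩, ?_⟩, ?_⟩
        · rw [hcc _ _ _ _ (by decide), h1.row]
        · rw [hcc _ _ _ _ (by decide), h1.col]
        · simpa only [hcW] using h1.rows
        · simpa only [hcW] using h2
        · simpa only [hcW] using h3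
      · rintro k τ hk ⟨h1, h3⟩ hτk
        have hs := hstep i hi j hj k hk τ h1.1 hτk h3
        have hupd : ∀ v, Ψ i j (k + 1) v → ∀ e : NExpr, e.eval τ = v →
            Halts (.write W (ctr 0) (ctr 1) e) τ 1 (fun σ' => σ'.nat 3 2 0 = k ∧
              ((InCell n W Φ s i j σ' ∧ ∀ j' < j, Φ i j' (σ'.nat W i j')) ∧
                Ψ i j (k + 1) (σ'.nat W i j))) := by
          intro v hv e he
          refine halts_write ?_
          rw [ctr_eval, ctr_eval, h1.1.row, h1.1.col, he]
          obtain ⟨h4, h5⟩ := hwrite τ v h1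
          exact ⟨by rw [hWc, hτk], h4, by rwa [h5]⟩
        refine halts_cond (K := 2) (fun hb => ?_) (fun hb => halts_cond (K := 1) (fun hb' => ?_)
          (fun hb' => halts_skip ⟨hτk, h1, ?_⟩))
        · rw [if_pos hb] at hs
          exact (hupd _ hs _ rfl).mono (by omega) fun _ => id
        · rw [if_neg hb, if_pos hb'] at hs
          exact hupd _ hs _ rfl
        · rwa [if_neg hb, if_neg hb'] at hs
      · rintro τ ⟨⟨h1, h2⟩, h3⟩
        refine ⟨h1, fun j' hj' => ?_⟩
        rcases (Nat.lt_succ_iff_lt_or_eq.1 hj') with h | rfl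
        · exact h2 j' h
        · exact hfin i hi _ hj _ h3
  refine (halts_iterate (k := 0) (b := n) (I := fun i τ => Keeps W 3 s τ ∧
    ∀ i' < i, ∀ j' < n, Φ i' j' (τ.nat W i' j')) (fun _ σ h => hsize σ h.1) ?_ ?_
    ⟨Keeps.refl W 3 s, by simp⟩).mono le_rfl fun _ h => h
  · rintro i σ v ⟨h1, h2⟩
    exact ⟨h1.setCtr (by omega) v, by simpa only [hcW] using h2⟩
  · rintro i σ hi ⟨h1, h2⟩ hσ
    refine (halts_iterate (k := 1) (b := n) (I := fun j τ => (Keeps W 3 s τ ∧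
      τ.nat 3 0 0 = i ∧ ∀ i' < i, ∀ j' < n, Φ i' j' (τ.nat W i' j')) ∧
      ∀ j' < j, Φ i j' (τ.nat W i j')) (fun _ σ h => hsize σ h.1.1) ?_ ?_
      ⟨⟨h1, hσ, h2⟩, by simp⟩).mono le_rfl ?_
    · rintro j τ v ⟨⟨h3, h4, h5⟩, h6⟩
      exact ⟨⟨h3.setCtr (by omega) v, by rw [hcc _ _ _ _ (by decide), h4],
        by simpa only [hcW] using h5⟩, by simpa only [hcW] using h6⟩
    · rintro j τ hj ⟨⟨h3, h4, h5⟩, h6⟩ hτ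
      refine (hcell i hi j hj τ ⟨⟨h3, h4, hτ, h5⟩, h6⟩).mono le_rfl ?_
      rintro τ' ⟨h7, h8⟩
      exact ⟨h7.col, ⟨h7.toKeeps, h7.row, h7.rows⟩, h8⟩
    · rintro τ ⟨⟨h3, h4, h5⟩, h6⟩
      refine ⟨h4, h3, fun i' hi' => ?_⟩
      rcases (Nat.lt_succ_iff_lt_or_eq.1 hi') with h | rfl
      · exact h5 i' h
      · exact h6

end Machine

/-! ### Tables of relations and of cardinalities -/

section Tables

/-- The integer array `a` represents the relation `R` on the vertices: nonzero entries mean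
that `R` holds. -/
def Represents {n : ℕ} (s : State) (a : ℕ) (R : Fin n → Fin n → Prop) : Prop :=
  ∀ i j : Fin n, 1 ≤ s.nat a i j ↔ R i j

theorem Represents.keep {n : ℕ} {s σ : State} {a W d : ℕ} {R : Fin n → Fin n → Prop}
    (h : Represents s a R) (hσ : Keeps W d s σ) (h3 : a ≠ 3 := by decide)
    (hW : a ≠ W := by decide) : Represents σ a R := by
  intro i j
  rw [hσ.nat a h3 hW]
  exact h i j

/-- A test that fails. -/
def Test.never : Test := .natLe (.const 1) (.const 0)

@[simp] theorem Test.never_holds (s : State) : Test.never.holds s ↔ False := by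
  simp [Test.never, Test.holds, NExpr.eval]

/-- Cell `(i, j)` of array `W` becomes `1` if `T` holds for some value of counter `2`, and `0`
otherwise. -/
def Prog.existsTable (W : ℕ) (T : Test) : Prog :=
  .table W (.const 0) size T (.const 1) .never (.const 0)

/-- `e + m` as an expression. -/
def NExpr.add (m : ℕ) (e : NExpr) : NExpr := Nat.rec e (fun _ e => .succ e) m

@[simp] theorem NExpr.add_eval (s : State) (m : ℕ) (e : NExpr) :
    (NExpr.add m e).eval s = e.eval s + m := by
  induction m with
  | zero => rfl
  | succ m ih =>
    change (NExpr.add m e).eval s + 1 = _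
    rw [ih]
    rfl

/-- Cell `(i, j)` of array `W` becomes `m` times the number of values of counter `2` for which `T`
holds. -/
def Prog.countTable (W m : ℕ) (T : Test) : Prog :=
  .table W (.const 0) size T (.add m (.read W (ctr 0) (ctr 1))) .never (.const 0)

theorem halts_existsTable {n W : ℕ} (hW0 : W ≠ 0) (hW3 : W ≠ 3) {T : Test} {s : State}
    (hn : s.nat 0 0 0 = n) {R : Fin n → Fin n → Prop} (τ : Fin n → Fin n → Fin n → Prop)
    (hT : ∀ i j k : Fin n, ∀ σ, Keeps W 3 s σ → σ.nat 3 0 0 = i → σ.nat 3 1 0 = j →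
      σ.nat 3 2 0 = k → (T.holds σ ↔ τ i j k))
    (hR : ∀ i j, R i j ↔ ∃ k, τ i j k) :
    Halts (Prog.existsTable W T) s (tableCost n n)
      (fun s' => Keeps W 3 s s' ∧ Represents s' W R) := by
  refine (halts_table (n := n) hW0 hW3 hn
    (fun i j v => ∀ (hi : i < n) (hj : j < n), 1 ≤ v ↔ R ⟨i, hi⟩ ⟨j, hj⟩)
    (fun i j k v => ∀ (hi : i < n) (hj : j < n), 1 ≤ v ↔ ∃ k' : Fin n, k'.1 < k ∧
      τ ⟨i, hi⟩ ⟨j, hj⟩ k') (b := n) ?_ ?_ ?_ ?_).mono le_rfl ?_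
  · intro σ hσ
    rw [size_eval, hσ.nat 0 (by decide) hW0.symm, hn]
  · intro i hi j hj σ _ _ _
    simp [NExpr.eval]
  · intro i _ j _ k hk σ hσ h2 hΨ hi hj
    have h := hT ⟨i, hi⟩ ⟨j, hj⟩ ⟨k, hk⟩ σ hσ.toKeeps hσ.row hσ.col h2
    by_cases hb : T.holds σ
    · simp only [hb, if_true, NExpr.eval, le_refl, true_iff]
      exact ⟨⟨k, hk⟩, by simp, h.1 hb⟩
    · simp only [hb, if_false, Test.never_holds, hΨ hi hj]
      constructor
      · rintro ⟨k', h1, h2⟩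
        exact ⟨k', by omega, h2⟩
      · rintro ⟨k', h1, h2⟩
        refine ⟨k', ?_, h2⟩
        by_contra hlt
        obtain rfl : k' = ⟨k, hk⟩ := Fin.ext (by simp only; omega)
        exact hb (h.2 h2)
  · intro i _ j _ v hΨ hi hj
    rw [hΨ hi hj, hR]
    simp
  · rintro s' ⟨h1, h2⟩
    exact ⟨h1, fun i j => h2 i i.2 j j.2 i.2 j.2⟩

theorem halts_countTable {n W m : ℕ} (hW0 : W ≠ 0) (hW3 : W ≠ 3) {T : Test} {s : State}
    (hn : s.nat 0 0 0 = n) (τ : Fin n → Fin n → Fin n → Prop)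
    (hT : ∀ i j k : Fin n, ∀ σ, Keeps W 3 s σ → σ.nat 3 0 0 = i → σ.nat 3 1 0 = j →
      σ.nat 3 2 0 = k → (T.holds σ ↔ τ i j k)) :
    Halts (Prog.countTable W m T) s (tableCost n n)
      (fun s' => Keeps W 3 s s' ∧ ∀ i j : Fin n, s'.nat W i j = m * {k | τ i j k}.ncard) := by
  refine (halts_table (n := n) hW0 hW3 hn
    (fun i j v => ∀ (hi : i < n) (hj : j < n), v = m * {k | τ ⟨i, hi⟩ ⟨j, hj⟩ k}.ncard)
    (fun i j k v => ∀ (hi : i < n) (hj : j < n),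
      v = m * {k' : Fin n | k'.1 < k ∧ τ ⟨i, hi⟩ ⟨j, hj⟩ k'}.ncard) (b := n) ?_ ?_ ?_ ?_).mono
    le_rfl ?_
  · intro σ hσ
    rw [size_eval, hσ.nat 0 (by decide) hW0.symm, hn]
  · intro i hi j hj σ _ _ _
    simp [NExpr.eval]
  · intro i _ j _ k hk σ hσ h2 hΨ hi hj
    have h := hT ⟨i, hi⟩ ⟨j, hj⟩ ⟨k, hk⟩ σ hσ.toKeeps hσ.row hσ.col h2
    have hΨ' := hΨ hi hj
    by_cases hb : T.holds σ
    · simp only [hb, if_true, NExpr.add_eval, NExpr.eval, ctr_eval, hσ.row, hσ.col, hΨ']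
      have hins : {k' : Fin n | k'.1 < k + 1 ∧ τ ⟨i, hi⟩ ⟨j, hj⟩ k'} =
          insert ⟨k, hk⟩ {k' : Fin n | k'.1 < k ∧ τ ⟨i, hi⟩ ⟨j, hj⟩ k'} := by
        ext k'
        simp only [Set.mem_ofPred_eq, Set.mem_insert_iff]
        constructor
        · rintro ⟨h1, h2⟩
          rcases Nat.lt_succ_iff_lt_or_eq.1 h1 with h3 | h3
          · exact Or.inr ⟨h3, h2⟩
          · exact Or.inl (Fin.ext h3)
        · rintro (rfl | ⟨h1, h2⟩)
          · exact ⟨Nat.lt_succ_self _, h.1 hb⟩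
          · exact ⟨by omega, h2⟩
      rw [hins, Set.ncard_insert_of_notMem (by simp) (Set.toFinite _)]
      ring
    · simp only [hb, if_false, Test.never_holds, hΨ']
      congr 2
      ext k'
      simp only [Set.mem_ofPred_eq]
      refine and_congr_left fun h2 => ⟨fun h1 => by omega, fun h1 => ?_⟩
      by_contra hlt
      obtain rfl : k' = ⟨k, hk⟩ := Fin.ext (by simp only; omega)
      exact hb (h.2 h2)
  · intro i _ j _ v hΨ hi hj
    rw [hΨ hi hj]
    simp
  · rintro s' ⟨h1, h2⟩
    exact ⟨h1, fun i j => h2 i i.2 j j.2 i.2 j.2⟩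

end Tables

/-! ### Adjacency lists -/

section Lists

variable {n : ℕ} {G : SimpleGraph (Fin n)}

/-- The integer array `1` is the adjacency matrix of `G`, with zeros outside. -/
def HasGraph (s : State) (G : SimpleGraph (Fin n)) : Prop :=
  s.nat 0 0 0 = n ∧ ∀ i j, 1 ≤ s.nat 1 i j ↔ ∃ (hi : i < n) (hj : j < n), G.Adj ⟨i, hi⟩ ⟨j, hj⟩

theorem HasGraph.represents {s : State} (h : HasGraph s G) : Represents s 1 G.Adj := fun i j =>
  (h.2 i j).trans ⟨fun ⟨_, _, h⟩ => h, fun h => ⟨i.2, j.2, h⟩⟩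

theorem HasGraph.keep {s σ : State} {W d : ℕ} (h : HasGraph s G) (hσ : Keeps W d s σ)
    (h0 : W ≠ 0 := by decide) (h1 : W ≠ 1 := by decide) : HasGraph σ G := by
  unfold HasGraph
  rw [hσ.nat 0 (by decide) h0.symm, hσ.nat 1 (by decide) h1.symm]
  exact h

theorem hasGraph_inputState [DecidableRel G.Adj] (w : Fin n → ℝ) (c : ℝ) :
    HasGraph (inputState G w c) G := by
  refine ⟨by simp [inputState], fun i j => ?_⟩
  by_cases h : i < n ∧ j < n
  · obtain ⟨hi, hj⟩ := h
    by_cases hadj : G.Adj ⟨i, hi⟩ ⟨j, hj⟩ <;> simp [inputState, hi, hj, hadj]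
  · simp only [inputState, h]
    simp only [not_and_or] at h
    simp
    intro hi hj
    omega

/-- Array `4`: the position of the vertex `j` in the adjacency list of the vertex `i`, for
adjacent `i` and `j`. Array `5`: the adjacency lists. -/
def Prog.lists : Prog :=
  .seq (.countTable 4 1 (.both (.rel 1 (ctr 0) (ctr 2)) (.lt (ctr 2) (ctr 1))))
    (.table 5 (.const 0) size
      (.both (.rel 1 (ctr 0) (ctr 2)) (.eq (.read 4 (ctr 0) (ctr 2)) (ctr 1))) (ctr 2)
      .never (.const 0))

theorem halts_lists {δ : ℕ} (hδ : ∀ v, (G.neighborSet v).ncard ≤ δ) {s : State}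
    (hs : HasGraph s G) :
    Halts Prog.lists s (tableCost n n + tableCost n n) (fun s' => HasGraph s' G ∧
      s'.real = s.real ∧ ∀ x y : Fin n, G.Adj x y → ∃ k < δ, s'.nat 5 x k = y) := by
  refine Halts.seq (halts_countTable (by decide) (by decide) hs.1
    (fun i j k => G.Adj i k ∧ k < j) ?_) ?_
  · intro i j k σ hσ h0 h1 h2
    simp only [Test.both_holds, Test.rel_holds, Test.lt_holds, ctr_eval, h0, h1, h2,
      (hs.keep hσ).represents i k, Fin.lt_def]
  rintro s₁ ⟨k₁, hpos⟩
  have hs₁ := hs.keep k₁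
  simp only [one_mul] at hpos
  -- the positions of the neighbours of `x` are distinct
  have hlt : ∀ x y z : Fin n, G.Adj x y → y < z → {k | G.Adj x k ∧ k < y}.ncard <
      {k | G.Adj x k ∧ k < z}.ncard := by
    intro x y z hxy hyz
    refine Set.ncard_lt_ncard ⟨fun k hk => ⟨hk.1, hk.2.trans hyz⟩, fun h => ?_⟩ (Set.toFinite _)
    exact lt_irrefl y (h (show G.Adj x y ∧ y < z from ⟨hxy, hyz⟩)).2
  have hinj : ∀ x y z : Fin n, G.Adj x y → G.Adj x z → {k | G.Adj x k ∧ k < y}.ncard =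
      {k | G.Adj x k ∧ k < z}.ncard → y = z := by
    intro x y z hy hz h
    rcases lt_trichotomy y z with h1 | h1 | h1
    · exact absurd h (hlt x y z hy h1).ne
    · exact h1
    · exact absurd h (hlt x z y hz h1).ne'
  refine (halts_table (n := n) (b := n) (by decide) (by decide) hs₁.1
    (fun i j v => ∀ (hi : i < n) (y : Fin n), G.Adj ⟨i, hi⟩ y →
      {k | G.Adj ⟨i, hi⟩ k ∧ k < y}.ncard = j → v = y)
    (fun i j k v => ∀ (hi : i < n) (y : Fin n), y.1 < k → G.Adj ⟨i, hi⟩ y →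
      {k | G.Adj ⟨i, hi⟩ k ∧ k < y}.ncard = j → v = y) ?_ ?_ ?_ ?_).mono le_rfl ?_
  · intro σ hσ
    rw [size_eval, (hs₁.keep hσ).1]
  · intro i _ j _ σ _ hi y hy
    omega
  · intro i _ j _ k hk σ hσ h2 hΨ hi y hyk hadj hy
    have hσp : σ.nat 4 = s₁.nat 4 := hσ.nat 4 (by decide) (by decide)
    have h4 : σ.nat 4 i k = {l | G.Adj ⟨i, hi⟩ l ∧ l < (⟨k, hk⟩ : Fin n)}.ncard := by
      rw [hσp]
      exact hpos ⟨i, hi⟩ ⟨k, hk⟩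
    have hG := (hs₁.keep hσ.toKeeps).represents ⟨i, hi⟩ ⟨k, hk⟩
    simp only at hG
    have hT : (Test.both (.rel 1 (ctr 0) (ctr 2)) (.eq (.read 4 (ctr 0) (ctr 2)) (ctr 1))).holds σ ↔
        G.Adj ⟨i, hi⟩ ⟨k, hk⟩ ∧ {l | G.Adj ⟨i, hi⟩ l ∧ l < (⟨k, hk⟩ : Fin n)}.ncard = j := by
      simp only [Test.both_holds, Test.rel_holds, Test.eq_holds, NExpr.eval, ctr_eval, hσ.row,
        hσ.col, h2, hG, h4]
    by_cases hc : G.Adj ⟨i, hi⟩ ⟨k, hk⟩ ∧ {l | G.Adj ⟨i, hi⟩ l ∧ l < (⟨k, hk⟩ : Fin n)}.ncard = j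
    · rw [if_pos (hT.2 hc), ctr_eval, h2]
      exact congrArg Fin.val (hinj _ _ _ hc.1 hadj (hc.2.trans hy.symm))
    · rw [if_neg (mt hT.1 hc), if_neg (by simp)]
      refine hΨ hi y ?_ hadj hy
      by_contra hlt
      obtain rfl : y = ⟨k, hk⟩ := Fin.ext (by simp only; omega)
      exact hc ⟨hadj, hy⟩
  · intro i _ j _ v hΨ hi y
    exact hΨ hi y y.2
  · rintro s' ⟨k', hΦ⟩
    refine ⟨hs₁.keep k', k'.real.trans k₁.real, fun x y hxy => ?_⟩
    have hsub : {k | G.Adj x k ∧ k < y}.ncard < (G.neighborSet x).ncard :=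
      Set.ncard_lt_ncard ⟨fun k hk => hk.1, fun h =>
        lt_irrefl y (h (show y ∈ G.neighborSet x from hxy)).2⟩
        (Set.toFinite _)
    have hle : (G.neighborSet x).ncard ≤ n := by
      simpa using Set.ncard_le_card (G.neighborSet x)
    exact ⟨_, hsub.trans_le (hδ x), hΦ x x.2 _ (hsub.trans_le hle) x.2 y hxy rfl⟩

end Lists

/-! ### Computing the heavy components -/

section Labels

variable {V : Type*} {G : SimpleGraph V}

/-- The graph `G ∖ N[v]`, with the vertices of `N[v]` kept as isolated vertices. -/
def awayGraph (G : SimpleGraph V) (v : V) : SimpleGraph V where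
  Adj x y := G.Adj x y ∧ x ∉ closedNbhd G v ∧ y ∉ closedNbhd G v
  symm := ⟨fun _ _ h => ⟨h.1.symm, h.2.2, h.2.1⟩⟩
  loopless := ⟨fun _ h => h.1.ne rfl⟩

theorem mem_component_iff {v x z : V} {D : Set V} (hD : IsComponentOf G (closedNbhd G v)ᶜ D)
    (hx : x ∈ D) : z ∈ D ↔ z ∉ closedNbhd G v ∧ (awayGraph G v).Reachable x z := by
  constructor
  · intro hz
    refine ⟨hD.subset hz, ?_⟩
    refine hD.isConn {z | (awayGraph G v).Reachable x z} ⟨x, hx, SimpleGraph.Reachable.refl x⟩ ?_ hz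
    intro a ha b hb hxa hab
    exact SimpleGraph.Reachable.trans hxa
      (SimpleGraph.Adj.reachable ⟨hab, hD.subset ha, hD.subset hb⟩)
  · rintro ⟨-, ⟨p⟩⟩
    induction p with
    | nil => exact hx
    | cons h p ih => exact ih (hD.mem_of_adj hx h.1 h.2.2)

theorem exists_walk_length_lt [Fintype V] {H : SimpleGraph V} {x z : V} (h : H.Reachable x z) :
    ∃ p : H.Walk x z, p.length ≤ Fintype.card V - 1 := by
  classical
  obtain ⟨p, hp⟩ := h.exists_isPath
  have := hp.length_lt
  exact ⟨p, by omega⟩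

end Labels

section Components

variable {n : ℕ} {G : SimpleGraph (Fin n)}

/-- The vertex `e` is outside the closed neighbourhood of the vertex in counter `3`. -/
def Test.away (e : NExpr) : Test := .both (.neg (.eq (ctr 3) e)) (.neg (.rel 1 (ctr 3) e))

theorem away_holds {s : State} (hs : HasGraph s G) {e : NExpr} {v x : Fin n}
    (hv : s.nat 3 3 0 = v) (hx : e.eval s = x) : (Test.away e).holds s ↔ x ∉ closedNbhd G v := by
  simp only [Test.away, Test.both_holds, Test.neg_holds, Test.eq_holds, Test.rel_holds, ctr_eval,
    hv, hx, hs.represents v x, closedNbhd, Set.mem_ofPred_eq, not_or, Fin.val_inj, eq_comm]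

/-- Array `6`: for the vertex `v` in counter `3`, cell `(i, x)` becomes the least vertex at distance
at most `i` from `x` in `G ∖ N[v]`. -/
def Prog.labels (δ : ℕ) : Prog :=
  .table 6 (ctr 1) (.const δ)
    (.both (.lt (.const 0) (ctr 0)) (.both (.rel 1 (ctr 1) (.read 5 (ctr 1) (ctr 2)))
      (.both (.away (ctr 1)) (.both (.away (.read 5 (ctr 1) (ctr 2)))
        (.lt (.read 6 (.pred (ctr 0)) (.read 5 (ctr 1) (ctr 2))) (.read 6 (ctr 0) (ctr 1)))))))
    (.read 6 (.pred (ctr 0)) (.read 5 (ctr 1) (ctr 2))) .never (.const 0)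

theorem halts_labels {δ : ℕ} {s : State} (hs : HasGraph s G)
    (hlist : ∀ x y : Fin n, G.Adj x y → ∃ k < δ, s.nat 5 x k = y) {v : Fin n}
    (hv : s.nat 3 3 0 = v) :
    Halts (Prog.labels δ) s (tableCost n δ) (fun s' => Keeps 6 3 s s' ∧
      ∀ x y : Fin n, s'.nat 6 (n - 1) x = s'.nat 6 (n - 1) y ↔
        (awayGraph G v).Reachable x y) := by
  refine (halts_table (n := n) (b := δ) (by decide) (by decide) hs.1
    (fun i x l => ∀ (hx : x < n), (∃ z : Fin n, (awayGraph G v).Reachable ⟨x, hx⟩ z ∧ l = z) ∧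
      ∀ (z : Fin n) (p : (awayGraph G v).Walk ⟨x, hx⟩ z), p.length ≤ i → l ≤ z)
    (fun i x k l => ∀ (hx : x < n),
      (∃ z : Fin n, (awayGraph G v).Reachable ⟨x, hx⟩ z ∧ l = z) ∧ l ≤ x ∧
      (0 < i → ∀ k' < k, ∀ y : Fin n, s.nat 5 x k' = y → (awayGraph G v).Adj ⟨x, hx⟩ y →
        ∀ (z : Fin n) (p : (awayGraph G v).Walk y z), p.length ≤ i - 1 → l ≤ z))
    ?_ ?_ ?_ ?_).mono le_rfl ?_
  · intro σ hσ
    rfl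
  · intro i _ x _ σ hσ hx
    simp only [ctr_eval, hσ.col]
    exact ⟨⟨⟨x, hx⟩, SimpleGraph.Reachable.refl _, rfl⟩, le_rfl, fun _ k' hk' => by omega⟩
  · intro i hi x hx k hk σ hσ h2 hΨ _
    obtain ⟨h3, h4, h5⟩ := hΨ hx
    have hG := hs.keep hσ.toKeeps
    have hσv : σ.nat 3 3 0 = v := (hσ.ctr 3 le_rfl).trans hv
    have h5s : σ.nat 5 = s.nat 5 := hσ.nat 5 (by decide) (by decide)
    have haway := fun (e : NExpr) (y : Fin n) (h : e.eval σ = y) => away_holds hG hσv h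
    have hx1 : (ctr 1).eval σ = (⟨x, hx⟩ : Fin n) := by rw [ctr_eval, hσ.col]
    have hy1 : (NExpr.read 5 (ctr 1) (ctr 2)).eval σ = s.nat 5 x k := by
      simp only [NExpr.eval, ctr_eval, hσ.col, h2, h5s]
    have he : (NExpr.read 6 (.pred (ctr 0)) (.read 5 (ctr 1) (ctr 2))).eval σ =
        σ.nat 6 (i - 1) (s.nat 5 x k) := by
      change σ.nat 6 ((ctr 0).eval σ - 1) ((NExpr.read 5 (ctr 1) (ctr 2)).eval σ) = _
      rw [ctr_eval, hσ.row, hy1]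
    have ha : (NExpr.read 6 (ctr 0) (ctr 1)).eval σ = σ.nat 6 i x := by
      simp only [NExpr.eval, ctr_eval, hσ.row, hσ.col]
    have hT : (Test.both (.lt (.const 0) (ctr 0))
        (.both (.rel 1 (ctr 1) (.read 5 (ctr 1) (ctr 2)))
        (.both (.away (ctr 1)) (.both (.away (.read 5 (ctr 1) (ctr 2)))
        (.lt (.read 6 (.pred (ctr 0)) (.read 5 (ctr 1) (ctr 2)))
          (.read 6 (ctr 0) (ctr 1))))))).holds σ ↔
        0 < i ∧ ∃ y : Fin n, s.nat 5 x k = y ∧ (awayGraph G v).Adj ⟨x, hx⟩ y ∧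
          σ.nat 6 (i - 1) y < σ.nat 6 i x := by
      simp only [Test.both_holds, Test.lt_holds, Test.rel_holds, he, ha, hy1,
        haway _ _ hx1, ctr_eval, hσ.row, hσ.col, NExpr.eval.eq_1]
      refine and_congr_right fun h0 => ?_
      constructor
      · rintro ⟨h6, h7, h8, h9⟩
        obtain ⟨_, hy, h6⟩ := (hG.2 _ _).1 h6
        exact ⟨⟨_, hy⟩, rfl, ⟨h6, h7, (haway _ ⟨_, hy⟩ hy1).1 h8⟩, h9⟩
      · rintro ⟨y, hy, h6, h7⟩
        rw [hy]
        exact ⟨(hG.represents ⟨x, hx⟩ y).2 h6.1, h6.2.1, (haway _ y (hy1.trans hy)).2 h6.2.2, h7⟩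
    by_cases hc : 0 < i ∧ ∃ y : Fin n, s.nat 5 x k = y ∧ (awayGraph G v).Adj ⟨x, hx⟩ y ∧
          σ.nat 6 (i - 1) y < σ.nat 6 i x
    · rw [if_pos (hT.2 hc), he]
      obtain ⟨h0, y, hy, hadj, hlt⟩ := hc
      obtain ⟨⟨z, hz, hz'⟩, h7⟩ := hσ.rows (i - 1) (by omega) y y.2 y.2
      rw [hy]
      refine ⟨⟨z, hadj.reachable.trans hz, hz'⟩, by omega, fun _ k' hk' y' hy' hadj' z' p hp => ?_⟩
      rcases Nat.lt_succ_iff_lt_or_eq.1 hk' with h8 | rfl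
      · exact hlt.le.trans (h5 h0 k' h8 y' hy' hadj' z' p hp)
      · obtain rfl : y = y' := Fin.ext (hy.symm.trans hy')
        exact h7 z' p hp
    · rw [if_neg (mt hT.1 hc), if_neg (by simp)]
      refine ⟨h3, h4, fun h0 k' hk' y' hy' hadj' z' p hp => ?_⟩
      rcases Nat.lt_succ_iff_lt_or_eq.1 hk' with h8 | rfl
      · exact h5 h0 k' h8 y' hy' hadj' z' p hp
      · have h7 := (hσ.rows (i - 1) (by omega) y' y'.2 y'.2).2 z' p hp
        have h9 : ¬ σ.nat 6 (i - 1) y' < σ.nat 6 i x := fun h => hc ⟨h0, y', hy', hadj', h⟩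
        omega
  · intro i _ x _ l hΨ hx
    obtain ⟨h1, h2, h3⟩ := hΨ hx
    refine ⟨h1, fun z p hp => ?_⟩
    cases p with
    | nil => exact h2
    | cons hadj p =>
      rw [SimpleGraph.Walk.length_cons] at hp
      obtain ⟨k, hk, hy⟩ := hlist _ _ hadj.1
      exact h3 (by omega) k hk _ hy hadj z p (by omega)
  · rintro s' ⟨h1, h2⟩
    refine ⟨h1, fun x y => ?_⟩
    have hn : n - 1 < n := by have := x.2; omega
    obtain ⟨⟨a, ha, ha'⟩, hmin⟩ := h2 (n - 1) hn x x.2 x.2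
    obtain ⟨⟨b, hb, hb'⟩, hmin'⟩ := h2 (n - 1) hn y y.2 y.2
    constructor
    · intro h
      obtain rfl : a = b := Fin.ext (by omega)
      exact ha.trans hb.symm
    · intro h
      obtain ⟨p, hp⟩ := exists_walk_length_lt (h.trans hb)
      obtain ⟨q, hq⟩ := exists_walk_length_lt (h.symm.trans ha)
      rw [Fintype.card_fin] at hp hq
      have := hmin b p hp
      have := hmin' a q hq
      omega

/-- The memory holds the graph, its adjacency lists, the weights and the number `c`. -/
structure HasInput (s : State) (G : SimpleGraph (Fin n)) (δ : ℕ) (w : Fin n → ℝ) (c : ℝ) :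
    Prop where
  graph : HasGraph s G
  list : ∀ x y : Fin n, G.Adj x y → ∃ k < δ, s.nat 5 x k = y
  weight : ∀ x : Fin n, s.real 0 x = w x
  bound : s.real 1 0 = c

/-- `σ` differs from `s` at most in the counters `0`, `1`, `2`, in the labels, in real array
`2` and in row `v` of array `7`. -/
structure KeepsRow (v : ℕ) (s σ : State) : Prop where
  real : ∀ a, a ≠ 2 → σ.real a = s.real a
  nat : ∀ a, a ≠ 3 → a ≠ 6 → a ≠ 7 → σ.nat a = s.nat a
  ctr : σ.nat 3 3 0 = s.nat 3 3 0
  row : ∀ i, i ≠ v → σ.nat 7 i = s.nat 7 i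

theorem HasInput.keepRow {s σ : State} {δ : ℕ} {w : Fin n → ℝ} {c : ℝ} (h : HasInput s G δ w c)
    {v : ℕ} (hσ : KeepsRow v s σ) : HasInput σ G δ w c := by
  refine ⟨?_, ?_, fun x => ?_, ?_⟩
  · unfold HasGraph
    rw [hσ.nat 0 (by decide) (by decide) (by decide), hσ.nat 1 (by decide) (by decide) (by decide)]
    exact h.graph
  · rw [hσ.nat 5 (by decide) (by decide) (by decide)]
    exact h.list
  · rw [hσ.real 0 (by decide)]
    exact h.weight x
  · rw [hσ.real 1 (by decide)]
    exact h.bound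

/-- Row `v` of array `7`, where `v` is the vertex in counter `3`: the weight of the component of
`G ∖ N[v]` of every vertex `x` outside `N[v]` is added up in real array `2` and compared
with `c`. -/
def Prog.heavyRow : Prog :=
  .iterate 0 size (.seq (.writeReal 2 (.const 0) .zero) (.seq
    (.iterate 1 size (.cond (.both (.away (ctr 1)) (.eq (.read 6 (.pred size) (ctr 1))
      (.read 6 (.pred size) (ctr 0))))
      (.writeReal 2 (.const 0) (.plus (.read 2 (.const 0)) (.read 0 (ctr 1)))) .skip))
    (.cond (.both (.away (ctr 0)) (.neg (.realLe (.read 2 (.const 0)) (.read 1 (.const 0)))))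
      (.write 7 (ctr 3) (ctr 0) (.const 1)) (.write 7 (ctr 3) (ctr 0) (.const 0)))))

open Classical in
theorem halts_heavyRow {δ : ℕ} {w : Fin n → ℝ} {c : ℝ} {s : State} (hs : HasInput s G δ w c)
    {v : Fin n} (hv : s.nat 3 3 0 = v) {lab : Fin n → ℕ}
    (hlab : ∀ x : Fin n, s.nat 6 (n - 1) x = lab x) :
    Halts Prog.heavyRow s (n * (1 + ((n * (2 + 2) + 2) + 2) + 2) + 2) (fun s' =>
      KeepsRow v s s' ∧ ∀ x : Fin n, 1 ≤ s'.nat 7 v x ↔ x ∉ closedNbhd G v ∧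
        c < ∑ z : Fin n, if z ∉ closedNbhd G v ∧ lab z = lab x then w z else 0) := by
  have hset : ∀ (σ : State) (k l : ℕ), k < 3 → (KeepsRow v s σ ∧ σ.nat 6 = s.nat 6) →
      KeepsRow v s (σ.setNat 3 k 0 l) ∧ (σ.setNat 3 k 0 l).nat 6 = s.nat 6 := by
    rintro σ k l hk ⟨h, h6⟩
    refine ⟨⟨h.real, fun a h3 h6 h7 => ?_, ?_, fun i hi => ?_⟩, ?_⟩
    · rw [← h.nat a h3 h6 h7]
      funext i j
      simp [State.setNat, h3]
    · rw [← h.ctr]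
      have : 3 ≠ k := by omega
      simp [State.setNat, this]
    · rw [← h.row i hi]
      funext j
      simp [State.setNat]
    · rw [← h6]
      funext i j
      simp [State.setNat]
  have hsetR : ∀ (σ : State) (r : ℝ), (KeepsRow v s σ ∧ σ.nat 6 = s.nat 6) →
      KeepsRow v s (σ.setReal 2 0 r) ∧ (σ.setReal 2 0 r).nat 6 = s.nat 6 := by
    rintro σ r ⟨h, h6⟩
    refine ⟨⟨fun a ha => ?_, h.nat, h.ctr, h.row⟩, h6⟩
    rw [← h.real a ha]
    funext i
    simp [State.setReal, ha]
  have hset7 : ∀ (σ : State) (x l : ℕ), (KeepsRow v s σ ∧ σ.nat 6 = s.nat 6) →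
      KeepsRow v s (σ.setNat 7 v x l) ∧ (σ.setNat 7 v x l).nat 6 = s.nat 6 := by
    rintro σ x l ⟨h, h6⟩
    refine ⟨⟨h.real, fun a h3 h6 h7 => ?_, ?_, fun i hi => ?_⟩, ?_⟩
    · rw [← h.nat a h3 h6 h7]
      funext i j
      simp [State.setNat, h7]
    · rw [← h.ctr]
      simp [State.setNat]
    · rw [← h.row i hi]
      funext j
      simp [State.setNat, hi]
    · rw [← h6]
      funext i j
      simp [State.setNat]
  refine (halts_iterate (k := 0) (b := n) (I := fun i σ => (KeepsRow v s σ ∧ σ.nat 6 = s.nat 6) ∧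
    ∀ x : Fin n, x.1 < i → (1 ≤ σ.nat 7 v x ↔ x ∉ closedNbhd G v ∧
      c < ∑ z : Fin n, if z ∉ closedNbhd G v ∧ lab z = lab x then w z else 0)) ?_ ?_ ?_ ?_).mono
    le_rfl ?_
  · intro i σ h
    exact (hs.keepRow h.1.1).graph.1
  · rintro i σ l ⟨h1, h2⟩
    refine ⟨hset σ 0 l (by decide) h1, ?_⟩
    simpa [State.setNat] using h2
  · rintro i σ hi ⟨h1, h2⟩ hσi
    refine Halts.seq (halts_writeReal (Q := fun τ => (KeepsRow v s τ ∧ τ.nat 6 = s.nat 6) ∧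
      τ.nat 3 0 0 = i ∧ (∀ x : Fin n, x.1 < i → (1 ≤ τ.nat 7 v x ↔ x ∉ closedNbhd G v ∧
      c < ∑ z : Fin n, if z ∉ closedNbhd G v ∧ lab z = lab x then w z else 0)) ∧ τ.real 2 0 = 0) ?_)
      fun τ hτ => ?_
    · exact ⟨hsetR σ _ h1, hσi, h2, by simp [State.setReal, NExpr.eval, RExpr.eval]⟩
    obtain ⟨h3, h4, h5, h6⟩ := hτ
    refine Halts.seq (halts_iterate (k := 1) (b := n) (K := 2) (I := fun j τ =>
      (KeepsRow v s τ ∧ τ.nat 6 = s.nat 6) ∧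
      τ.nat 3 0 0 = i ∧ (∀ x : Fin n, x.1 < i → (1 ≤ τ.nat 7 v x ↔ x ∉ closedNbhd G v ∧
      c < ∑ z : Fin n, if z ∉ closedNbhd G v ∧ lab z = lab x then w z else 0)) ∧
      τ.real 2 0 = ∑ z : Fin n, if z.1 < j ∧ z ∉ closedNbhd G v ∧ lab z = lab ⟨i, hi⟩ then w z
        else 0) ?_ ?_ ?_ ?_) fun τ' hτ' => ?_
    · intro j τ h
      exact (hs.keepRow h.1.1).graph.1
    · rintro j τ l ⟨h7, h8, h9, h10⟩
      refine ⟨hset τ 1 l (by decide) h7, ?_, ?_, h10⟩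
      · simpa [State.setNat] using h8
      · simpa [State.setNat] using h9
    · rintro j ρ hj ⟨h7, h8, h9, h10⟩ hρ
      have hG := hs.keepRow h7.1
      have hρv : ρ.nat 3 3 0 = v := h7.1.ctr.trans hv
      have hT : (Test.both (.away (ctr 1)) (.eq (.read 6 (.pred size) (ctr 1))
          (.read 6 (.pred size) (ctr 0)))).holds ρ ↔
          (⟨j, hj⟩ : Fin n) ∉ closedNbhd G v ∧ lab ⟨j, hj⟩ = lab ⟨i, hi⟩ := by
        have ha := away_holds hG.graph (e := ctr 1) (x := ⟨j, hj⟩) hρv (by rw [ctr_eval, hρ])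
        have hl : ∀ x : Fin n, ρ.nat 6 (n - 1) x = lab x := fun x => by rw [h7.2, hlab]
        simp only [Test.both_holds, ha, Test.eq_holds, NExpr.eval, ctr_eval, size_eval, hρ, h8,
          hG.graph.1]
        rw [hl ⟨j, hj⟩, hl ⟨i, hi⟩]
      have hsum : ∑ z : Fin n, (if z.1 < j + 1 ∧ z ∉ closedNbhd G v ∧ lab z = lab ⟨i, hi⟩ then w z
          else 0) = (∑ z : Fin n, if z.1 < j ∧ z ∉ closedNbhd G v ∧ lab z = lab ⟨i, hi⟩ then w z
          else 0) + if (⟨j, hj⟩ : Fin n) ∉ closedNbhd G v ∧ lab ⟨j, hj⟩ = lab ⟨i, hi⟩ then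
            w ⟨j, hj⟩ else 0 := by
        have hone : (if (⟨j, hj⟩ : Fin n) ∉ closedNbhd G v ∧ lab ⟨j, hj⟩ = lab ⟨i, hi⟩ then
            w ⟨j, hj⟩ else 0) = ∑ z : Fin n, if z = ⟨j, hj⟩ then (if z ∉ closedNbhd G v ∧
              lab z = lab ⟨i, hi⟩ then w z else 0) else 0 := by
          rw [Finset.sum_ite_eq', if_pos (Finset.mem_univ _)]
        rw [hone, ← Finset.sum_add_distrib]
        refine Finset.sum_congr rfl fun z _ => ?_
        by_cases hz : z = ⟨j, hj⟩
        · simp [hz]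
        · have : z.1 < j + 1 ↔ z.1 < j := by
            have : z.1 ≠ j := fun h => hz (Fin.ext h)
            omega
          simp [hz, this]
      refine halts_cond (K := 1) (fun hb => halts_writeReal ?_) (fun hb => halts_skip ?_)
      · refine ⟨hρ, hsetR ρ _ h7, h8, h9, ?_⟩
        rw [hsum, if_pos (hT.1 hb), ← h10]
        simp [State.setReal, NExpr.eval, RExpr.eval, hρ, ← hG.weight ⟨j, hj⟩]
      · refine ⟨hρ, h7, h8, h9, ?_⟩
        rw [hsum, if_neg (mt hT.2 hb), add_zero, h10]
    · exact ⟨h3, h4, h5, by simp [h6]⟩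
    · obtain ⟨h7, h8, h9, h10⟩ := hτ'
      have hG := hs.keepRow h7.1
      have hτv : τ'.nat 3 3 0 = v := h7.1.ctr.trans hv
      have hsum : τ'.real 2 0 = ∑ z : Fin n, if z ∉ closedNbhd G v ∧ lab z = lab ⟨i, hi⟩ then w z
          else 0 := by
        rw [h10]
        simp
      have hT : (Test.both (.away (ctr 0))
          (.neg (.realLe (.read 2 (.const 0)) (.read 1 (.const 0))))).holds τ' ↔
          (⟨i, hi⟩ : Fin n) ∉ closedNbhd G v ∧ c < ∑ z : Fin n, if z ∉ closedNbhd G v ∧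
            lab z = lab ⟨i, hi⟩ then w z else 0 := by
        rw [Test.both_holds, away_holds hG.graph (e := ctr 0) (x := ⟨i, hi⟩) hτv
          (by rw [ctr_eval, h8]), Test.neg_holds, ← hsum, ← hG.bound]
        simp only [Test.holds, RExpr.eval, NExpr.eval, not_le]
      have hwrite : ∀ l : ℕ, (1 ≤ l ↔ (⟨i, hi⟩ : Fin n) ∉ closedNbhd G v ∧ c < ∑ z : Fin n,
          if z ∉ closedNbhd G v ∧ lab z = lab ⟨i, hi⟩ then w z else 0) →
          Halts (.write 7 (ctr 3) (ctr 0) (.const l)) τ' 1 (fun σ' => σ'.nat 3 0 0 = i ∧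
          (KeepsRow v s σ' ∧ σ'.nat 6 = s.nat 6) ∧ ∀ x : Fin n, x.1 < i + 1 →
          (1 ≤ σ'.nat 7 v x ↔ x ∉ closedNbhd G v ∧
            c < ∑ z : Fin n, if z ∉ closedNbhd G v ∧ lab z = lab x then w z else 0)) := by
        intro l hl
        refine halts_write ?_
        simp only [NExpr.eval, ctr_eval, h8, hτv]
        refine ⟨by simpa [State.setNat] using h8, hset7 τ' i l h7, fun x hx => ?_⟩
        by_cases hxi : x.1 = i
        · obtain rfl : x = ⟨i, hi⟩ := Fin.ext hxi
          simpa [State.setNat] using hl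
        · simpa [State.setNat, hxi] using h9 x (by omega)
      refine halts_cond (K := 1) (fun hb => ?_) (fun hb => ?_)
      · exact hwrite 1 (by simpa using hT.1 hb)
      · exact hwrite 0 (by simpa using mt hT.2 hb)
  · refine ⟨⟨⟨fun _ _ => rfl, fun _ _ _ _ => rfl, rfl, fun _ _ => rfl⟩, rfl⟩, ?_⟩
    simp
  · rintro σ ⟨h1, h2⟩
    exact ⟨h1.1, fun x => h2 x x.2⟩

/-- Array `7`: the heavy components. -/
def Prog.heavy (δ : ℕ) : Prog := .iterate 3 size (.seq (.labels δ) .heavyRow)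

open Classical in
theorem HeavySide.mem_iff {w : Fin n → ℝ} {c : ℝ} {B : Fin n → Set (Fin n)}
    (hB : HeavySide G w c B) (hw : ∀ v, 0 ≤ w v) (hsum : ∑ v, w v = 1) (hc : 1 / 2 ≤ c)
    (v x : Fin n) : x ∈ B v ↔ x ∉ closedNbhd G v ∧ c < ∑ z : Fin n,
      if z ∉ closedNbhd G v ∧ (awayGraph G v).Reachable z x then w z else 0 := by
  have key : ∀ D, IsComponentOf G (closedNbhd G v)ᶜ D → x ∈ D → weight w D = ∑ z : Fin n,
      if z ∉ closedNbhd G v ∧ (awayGraph G v).Reachable z x then w z else 0 := by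
    intro D hD hx
    unfold weight
    refine Finset.sum_congr rfl fun z _ => ?_
    have := mem_component_iff hD hx (z := z)
    rw [Set.indicator_apply]
    refine if_congr ?_ rfl rfl
    rw [this]
    exact and_congr_right fun _ => ⟨fun h => h.symm, fun h => h.symm⟩
  constructor
  · intro hx
    exact ⟨(hB.comp v).subset hx, key _ (hB.comp v) hx ▸ hB.heavy v⟩
  · rintro ⟨hx, hlt⟩
    obtain ⟨D, hD, hxD⟩ := exists_component (G := G) (S := (closedNbhd G v)ᶜ) hx
    rw [← key D hD hxD] at hlt
    rwa [← hD.eq (hB.comp v) (inter_nonempty_of_heavy hw hsum hc hlt (hB.heavy v))]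

theorem halts_heavy {δ : ℕ} {w : Fin n → ℝ} {c : ℝ} {B : Fin n → Set (Fin n)}
    (hB : HeavySide G w c B) (hw : ∀ v, 0 ≤ w v) (hsum : ∑ v, w v = 1) (hc : 1 / 2 ≤ c)
    {s : State} (hs : HasInput s G δ w c) :
    Halts (Prog.heavy δ) s
      (n * (tableCost n δ + (n * (1 + ((n * (2 + 2) + 2) + 2) + 2) + 2) + 2) + 2)
      (fun s' => HasGraph s' G ∧ Represents s' 7 (fun v x => x ∈ B v)) := by
  refine (halts_iterate (k := 3) (b := n) (I := fun i σ => HasInput σ G δ w c ∧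
    ∀ v x : Fin n, v.1 < i → (1 ≤ σ.nat 7 v x ↔ x ∈ B v)) ?_ ?_ ?_ ⟨hs, by simp⟩).mono le_rfl ?_
  · intro i σ h
    exact h.1.graph.1
  · rintro i σ l ⟨h1, h2⟩
    refine ⟨⟨⟨?_, ?_⟩, ?_, h1.weight, h1.bound⟩, ?_⟩
    · simpa [State.setNat] using h1.graph.1
    · simpa [State.setNat] using h1.graph.2
    · simpa [State.setNat] using h1.list
    · simpa [State.setNat] using h2
  · rintro i σ hi ⟨h1, h2⟩ hσi
    refine Halts.seq (halts_labels h1.graph h1.list (v := ⟨i, hi⟩) hσi) ?_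
    rintro τ ⟨h3, h4⟩
    have hτ : HasInput τ G δ w c := by
      refine ⟨h1.graph.keep h3, ?_, ?_, ?_⟩
      · rw [h3.nat 5 (by decide) (by decide)]
        exact h1.list
      · rw [h3.real]
        exact h1.weight
      · rw [h3.real]
        exact h1.bound
    have hτi : τ.nat 3 3 0 = (⟨i, hi⟩ : Fin n) := (h3.ctr 3 le_rfl).trans hσi
    refine (halts_heavyRow hτ hτi (lab := fun x => τ.nat 6 (n - 1) x) (fun _ => rfl)).mono le_rfl ?_
    rintro ρ ⟨h5, h6⟩
    refine ⟨h5.ctr.trans hτi, hτ.keepRow h5, fun v x hv => ?_⟩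
    rcases Nat.lt_succ_iff_lt_or_eq.1 hv with h7 | h7
    · rw [h5.row v (by simp only; omega), h3.nat 7 (by decide) (by decide)]
      exact h2 v x h7
    · obtain rfl : v = ⟨i, hi⟩ := Fin.ext h7
      rw [h6 x, hB.mem_iff hw hsum hc]
      refine and_congr_right fun _ => iff_of_eq (congrArg (c < ·) ?_)
      refine Finset.sum_congr rfl fun z _ => ?_
      congr 1
      rw [h4 z x]
  · rintro σ ⟨h1, h2⟩
    exact ⟨h1.graph, fun v x => h2 v x v.2⟩

end Components

/-! ### Computing the even set separator -/

section Program

variable {n : ℕ} {G : SimpleGraph (Fin n)} {B : Fin n → Set (Fin n)}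

/-- Arrays `8`, `9`, `10`, `11`: the star separators, the small sides, the relation `Kills`, and
twice the rank. -/
def Prog.sides : Prog :=
  .seq (.existsTable 8 (.or (.eq (ctr 0) (ctr 1)) (.both (.neg (.rel 7 (ctr 0) (ctr 1)))
    (.both (.rel 7 (ctr 0) (ctr 2)) (.rel 1 (ctr 2) (ctr 1)))))) <|
  .seq (.existsTable 9 (.both (.neg (.rel 7 (ctr 0) (ctr 1))) (.neg (.rel 8 (ctr 0) (ctr 1))))) <|
  .seq (.existsTable 10 (.both (.rel 9 (ctr 0) (ctr 1))
    (.or (.neg (.rel 9 (ctr 1) (ctr 0))) (.lt (ctr 0) (ctr 1))))) <|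
  .countTable 11 2 (.rel 10 (ctr 2) (ctr 0))

/-- The memory holds the graph and the tables computed by `Prog.sides`. -/
structure HasSides (s : State) (G : SimpleGraph (Fin n)) (B : Fin n → Set (Fin n)) : Prop where
  graph : HasGraph s G
  cut : Represents s 8 (fun v x => x ∈ starCut G B v)
  small : Represents s 9 (fun v x => x ∈ smallSide G B v)
  rank : ∀ x y : Fin n, s.nat 11 x y = 2 * killRank G B x

theorem HasSides.keep {s σ : State} {W d : ℕ} (h : HasSides s G B) (hσ : Keeps W d s σ)
    (hW : W ∉ [0, 1, 8, 9, 11] := by decide) : HasSides σ G B := by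
  simp only [List.mem_cons, List.not_mem_nil, or_false, not_or] at hW
  obtain ⟨h0, h1, h8, h9, h11⟩ := hW
  refine ⟨h.graph.keep hσ h0 h1, h.cut.keep hσ (by decide) (Ne.symm h8),
    h.small.keep hσ (by decide) (Ne.symm h9), ?_⟩
  rw [hσ.nat 11 (by decide) (Ne.symm h11)]
  exact h.rank

theorem halts_sides {s : State} (hs : HasGraph s G) (hB : Represents s 7 (fun v x => x ∈ B v)) :
    Halts Prog.sides s (4 * tableCost n n) (fun s' => HasSides s' G B) := by
  have hcost : 4 * tableCost n n = tableCost n n + (tableCost n n + (tableCost n n +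
    tableCost n n)) := by ring
  rw [hcost]
  refine Halts.seq (halts_existsTable (by decide) (by decide) hs.1
    (R := fun v x => x ∈ starCut G B v)
    (fun v x k => v = x ∨ (x ∉ B v ∧ k ∈ B v ∧ G.Adj k x)) ?_ ?_) ?_
  · intro i j k σ hσ h0 h1 h2
    simp only [Test.both_holds, Test.or_holds, Test.neg_holds, Test.rel_holds, Test.eq_holds,
      ctr_eval, h0, h1, h2, (hs.keep hσ).represents k j, (hB.keep hσ) i j, (hB.keep hσ) i k,
      Fin.val_inj]
  · intro v x
    constructor
    · rintro (rfl | ⟨h1, k, h2, h3⟩)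
      · exact ⟨x, Or.inl rfl⟩
      · exact ⟨k, Or.inr ⟨h1, h2, h3⟩⟩
    · rintro ⟨k, rfl | ⟨h1, h2, h3⟩⟩
      · exact Or.inl rfl
      · exact Or.inr ⟨h1, k, h2, h3⟩
  rintro s₁ ⟨k₁, h8⟩
  have hs₁ := hs.keep k₁
  have hB₁ := hB.keep k₁
  refine Halts.seq (halts_existsTable (by decide) (by decide) hs₁.1
    (R := fun v x => x ∈ smallSide G B v)
    (fun v x _ => x ∉ B v ∧ x ∉ starCut G B v) ?_ ?_) ?_
  · intro i j k σ hσ h0 h1 h2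
    simp only [Test.both_holds, Test.neg_holds, Test.rel_holds, ctr_eval, h0, h1,
      (hB₁.keep hσ) i j, (h8.keep hσ) i j]
  · intro v x
    exact ⟨fun h => ⟨x, h⟩, fun ⟨_, h⟩ => h⟩
  rintro s₂ ⟨k₂, h9⟩
  have hs₂ := hs₁.keep k₂
  have h8₂ := h8.keep k₂
  refine Halts.seq (halts_existsTable (by decide) (by decide) hs₂.1
    (R := fun b x => Kills G B b x)
    (fun b x _ => x ∈ smallSide G B b ∧ (b ∉ smallSide G B x ∨ b < x)) ?_ ?_) ?_
  · intro i j k σ hσ h0 h1 h2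
    simp only [Test.both_holds, Test.or_holds, Test.neg_holds, Test.rel_holds, Test.lt_holds,
      ctr_eval, h0, h1, (h9.keep hσ) i j, (h9.keep hσ) j i, Fin.val_fin_lt]
  · intro v x
    exact ⟨fun h => ⟨x, h⟩, fun ⟨_, h⟩ => h⟩
  rintro s₃ ⟨k₃, h10⟩
  have hs₃ := hs₂.keep k₃
  refine (halts_countTable (by decide) (by decide) hs₃.1 (fun x _ k => Kills G B k x) ?_).mono
    le_rfl ?_
  · intro i j k σ hσ h0 h1 h2
    simp only [Test.rel_holds, ctr_eval, h0, h2, (h10.keep hσ) k i]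
  · rintro s₄ ⟨k₄, h11⟩
    exact ⟨hs₃.keep k₄, (h8₂.keep k₃).keep k₄, (h9.keep k₃).keep k₄, h11⟩

/-- The vertex `e` is live. -/
def Test.live (e : NExpr) : Test := .natLe (.read 11 e e) (.const 0)

theorem live_holds {s : State} (hs : HasSides s G B) {e : NExpr} {x : Fin n}
    (hx : e.eval s = x) : (Test.live e).holds s ↔ Live G B x := by
  rw [IsHaven.live_iff_killRank]
  simp only [Test.live, Test.holds, NExpr.eval, hx, hs.rank x x]
  omega

/-- The graph induced by the live vertices, with the other vertices isolated. -/
def liveGraph (G : SimpleGraph (Fin n)) (B : Fin n → Set (Fin n)) : SimpleGraph (Fin n) where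
  Adj x y := G.Adj x y ∧ Live G B x ∧ Live G B y
  symm := ⟨fun _ _ h => ⟨h.1.symm, h.2.2, h.2.1⟩⟩
  loopless := ⟨fun _ h => h.1.ne rfl⟩

/-- Adjacency of live vertices, and the colour of the second one in the previous row
of array `14`. -/
def Test.step (m : ℕ) : Test :=
  .both (.lt (.const 0) (ctr 0)) (.both (.rel 1 (ctr 1) (ctr 2)) (.both (.live (ctr 1))
    (.both (.live (ctr 2)) (.eq (.read 14 (.pred (ctr 0)) (ctr 2)) (.const m)))))

/-- Array `12`: all vertices but the least live one. Array `14`: row `i` holds the colours, plus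
`1`, of the live vertices at distance at most `i` from the least one. -/
def Prog.colors : Prog :=
  .seq (.existsTable 12 (.or (.neg (.live (ctr 0))) (.both (.live (ctr 2))
    (.lt (ctr 2) (ctr 0))))) <|
  .table 14 (.const 0) size (.or (.neg (.rel 12 (ctr 1) (ctr 1))) (.step 2)) (.const 1)
    (.step 1) (.const 2)

/-- The row of array `14` with all colours. -/
def NExpr.color (e : NExpr) : NExpr := .read 14 (.pred size) e

/-- The memory holds the tables of `Prog.sides` and the colours. -/
structure HasColors (s : State) (G : SimpleGraph (Fin n)) (B : Fin n → Set (Fin n))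
    (col : Fin n → ℕ) : Prop extends HasSides s G B where
  color : ∀ x, Live G B x → s.nat 14 (n - 1) x = col x + 1
  color_zero : ∀ x, ¬ Live G B x → s.nat 14 (n - 1) x = 0

theorem HasColors.keep {s σ : State} {W d : ℕ} {col : Fin n → ℕ} (h : HasColors s G B col)
    (hσ : Keeps W d s σ) (hW : W ∉ [0, 1, 8, 9, 11] := by decide) (h14 : 14 ≠ W := by decide) :
    HasColors σ G B col := by
  refine ⟨h.toHasSides.keep hσ hW, ?_, ?_⟩
  · rw [hσ.nat 14 (by decide) h14]
    exact h.color
  · rw [hσ.nat 14 (by decide) h14]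
    exact h.color_zero

theorem color_eval {s : State} {col : Fin n → ℕ} (hs : HasColors s G B col) {e : NExpr} {x : Fin n}
    (hx : e.eval s = x) : (NExpr.color e).eval s = s.nat 14 (n - 1) x := by
  simp only [NExpr.color, NExpr.eval, size_eval, hs.graph.1, hx]

theorem halts_colors {col : Fin n → ℕ} (S : LiveColoring G B col) {a : Fin n}
    (ha : Live G B a) (hmin : ∀ x, Live G B x → a ≤ x) (hcol : col a = 0)
    (hreach : ∀ x, Live G B x → (liveGraph G B).Reachable x a) {s : State}
    (hs : HasSides s G B) :
    Halts Prog.colors s (2 * tableCost n n) (fun s' => HasColors s' G B col) := by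
  rw [two_mul]
  refine Halts.seq (halts_existsTable (by decide) (by decide) hs.graph.1
    (R := fun x _ => x ≠ a) (fun x _ y => ¬ Live G B x ∨ (Live G B y ∧ y < x)) ?_ ?_) ?_
  · intro i j k σ hσ h0 h1 h2
    have hS := hs.keep hσ
    simp only [Test.both_holds, Test.or_holds, Test.neg_holds, Test.lt_holds, ctr_eval, h0, h2,
      live_holds hS (e := ctr 0) (x := i) (by rw [ctr_eval, h0]),
      live_holds hS (e := ctr 2) (x := k) (by rw [ctr_eval, h2]), Fin.val_fin_lt]
  · intro x _
    constructor
    · intro hx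
      by_cases hl : Live G B x
      · exact ⟨a, Or.inr ⟨ha, lt_of_le_of_ne (hmin x hl) hx.symm⟩⟩
      · exact ⟨a, Or.inl hl⟩
    · rintro ⟨y, h | ⟨h, hlt⟩⟩ rfl
      · exact h ha
      · exact absurd hlt (not_lt.2 (hmin y h))
  rintro s₁ ⟨k₁, h12⟩
  have hs₁ := hs.keep k₁
  refine (halts_table (n := n) (b := n) (by decide) (by decide) hs₁.graph.1
    (fun i x v => ∀ (hx : x < n), (v ≠ 0 → Live G B ⟨x, hx⟩ ∧ v = col ⟨x, hx⟩ + 1) ∧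
      ((∃ p : (liveGraph G B).Walk ⟨x, hx⟩ a, p.length ≤ i) → v ≠ 0))
    (fun i x k v => ∀ (hx : x < n), (v ≠ 0 → Live G B ⟨x, hx⟩ ∧ v = col ⟨x, hx⟩ + 1) ∧
      (0 < k → (⟨x, hx⟩ : Fin n) = a → v ≠ 0) ∧
      (0 < i → ∀ y : Fin n, y.1 < k → (liveGraph G B).Adj ⟨x, hx⟩ y →
        (∃ p : (liveGraph G B).Walk y a, p.length ≤ i - 1) → v ≠ 0)) ?_ ?_ ?_ ?_).mono le_rfl ?_
  · intro σ hσ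
    rw [size_eval, (hs₁.keep hσ).graph.1]
  · intro i _ x _ σ _ hx
    simp [NExpr.eval]
  · intro i hi x hx k hk σ hσ h2 hΨ _
    obtain ⟨h3, h4, h5⟩ := hΨ hx
    have hS := hs₁.keep hσ.toKeeps
    have hprev := (hσ.rows · · k hk hk)
    have hstep : ∀ m, (Test.step m).holds σ ↔ 0 < i ∧ (liveGraph G B).Adj ⟨x, hx⟩ ⟨k, hk⟩ ∧
        σ.nat 14 (i - 1) k = m := by
      intro m
      have h6 := hS.graph.represents ⟨x, hx⟩ ⟨k, hk⟩
      have h7 : (NExpr.read 14 (.pred (ctr 0)) (ctr 2)).eval σ = σ.nat 14 (i - 1) k := by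
        change σ.nat 14 ((ctr 0).eval σ - 1) ((ctr 2).eval σ) = _
        rw [ctr_eval, ctr_eval, hσ.row, h2]
      simp only at h6
      simp only [Test.step, Test.both_holds, Test.lt_holds, Test.rel_holds, Test.eq_holds, h7,
        live_holds hS (e := ctr 1) (x := ⟨x, hx⟩) (by rw [ctr_eval, hσ.col]),
        live_holds hS (e := ctr 2) (x := ⟨k, hk⟩) (by rw [ctr_eval, h2]), ctr_eval, hσ.row,
        hσ.col, h2, h6, NExpr.eval.eq_1, liveGraph]
      tauto
    have hstart : (Test.neg (.rel 12 (ctr 1) (ctr 1))).holds σ ↔ (⟨x, hx⟩ : Fin n) = a := by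
      have h6 := (h12.keep hσ.toKeeps) ⟨x, hx⟩ ⟨x, hx⟩
      simp only at h6
      simp only [Test.neg_holds, Test.rel_holds, ctr_eval, hσ.col, h6, not_not]
    -- the colour of a vertex with a coloured neighbour
    have hother : (liveGraph G B).Adj ⟨x, hx⟩ ⟨k, hk⟩ → 0 < i → ∀ m, σ.nat 14 (i - 1) k = m →
        m ≠ 0 → col ⟨x, hx⟩ + m = 2 := by
      intro hadj h0 m hm hm0
      have h6 := (hprev (i - 1) (by omega)).1 (by omega)
      have h7 := S.adj _ _ hadj.2.1 hadj.2.2 hadj.1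
      have h8 := S.lt_two ⟨x, hx⟩
      have h9 := S.lt_two ⟨k, hk⟩
      have h10 := h6.2
      omega
    by_cases hb : (Test.or (.neg (.rel 12 (ctr 1) (ctr 1))) (.step 2)).holds σ
    · rw [if_pos hb]
      refine ⟨fun _ => ?_, fun _ _ => by simp [NExpr.eval], fun _ _ _ _ _ => by simp [NExpr.eval]⟩
      rw [Test.or_holds, hstart, hstep] at hb
      rcases hb with rfl | ⟨h0, hadj, hm⟩
      · exact ⟨ha, by rw [hcol]; rfl⟩
      · have := hother hadj h0 2 hm (by decide)
        exact ⟨hadj.2.1, by simp only [NExpr.eval]; omega⟩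
    rw [if_neg hb]
    rw [Test.or_holds, hstart, hstep, not_or] at hb
    by_cases hb' : (Test.step 1).holds σ
    · rw [if_pos hb']
      refine ⟨fun _ => ?_, fun _ _ => by simp [NExpr.eval], fun _ _ _ _ _ => by simp [NExpr.eval]⟩
      obtain ⟨h0, hadj, hm⟩ := (hstep 1).1 hb'
      have := hother hadj h0 1 hm (by decide)
      exact ⟨hadj.2.1, by simp only [NExpr.eval]; omega⟩
    · rw [if_neg hb']
      rw [hstep] at hb'
      refine ⟨h3, fun _ hxa => absurd hxa hb.1, fun h0 y hy hadj hp => ?_⟩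
      rcases Nat.lt_succ_iff_lt_or_eq.1 hy with h8 | h8
      · exact h5 h0 y h8 hadj hp
      · exfalso
        obtain rfl : y = ⟨k, hk⟩ := Fin.ext h8
        have h9 := (hprev (i - 1) (by omega)).2 hp
        have h10 := (hprev (i - 1) (by omega)).1 h9
        have h11 := S.lt_two ⟨k, hk⟩
        have h13 := h10.2
        have : σ.nat 14 (i - 1) k = 1 ∨ σ.nat 14 (i - 1) k = 2 := by omega
        rcases this with h | h
        · exact hb' ⟨h0, hadj, h⟩
        · exact hb.2 ⟨h0, hadj, h⟩
  · intro i _ x hxn v hΨ hx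
    obtain ⟨h1, h2, h3⟩ := hΨ hx
    refine ⟨h1, ?_⟩
    rintro ⟨p, hp⟩
    cases p with
    | nil => exact h2 (by omega) rfl
    | @cons _ y _ hadj p =>
      rw [SimpleGraph.Walk.length_cons] at hp
      exact h3 (by omega) y y.2 hadj ⟨p, by omega⟩
  · rintro s' ⟨k', hΦ⟩
    have hn : n - 1 < n := by have := a.2; omega
    refine ⟨hs₁.keep k', fun x hx => ?_, fun x hx => ?_⟩
    · obtain ⟨h1, h2⟩ := hΦ (n - 1) hn x x.2 x.2
      obtain ⟨p, hp⟩ := exists_walk_length_lt (hreach x hx)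
      rw [Fintype.card_fin] at hp
      exact (h1 (h2 ⟨p, hp⟩)).2
    · by_contra h
      exact hx ((hΦ (n - 1) hn x x.2 x.2).1 h).1

/-- The vertex `e` is an inner vertex. -/
def Test.inner (e : NExpr) : Test := .both (.live e) (.natLe (.const 2) (.read 15 e e))

/-- Arrays `15` to `19`: the number of live neighbours, the complements of the owned sets, the
numbers `crossCount`, the relation `Beats`, and the pairs of a live vertex `u` and a vertex that is
`u` or torn by `u`. -/
def Prog.tears : Prog :=
  .seq (.countTable 15 1 (.both (.live (ctr 2)) (.rel 1 (ctr 0) (ctr 2)))) <|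
  .seq (.existsTable 16 (.or (.neg (.rel 9 (ctr 0) (ctr 1))) (.both (.live (ctr 2))
    (.both (.eq (.color (ctr 2)) (.color (ctr 0))) (.both (.lt (ctr 2) (ctr 0))
      (.rel 9 (ctr 2) (ctr 1))))))) <|
  .seq (.countTable 17 1 (.both (.rel 8 (ctr 0) (ctr 2)) (.neg (.rel 16 (ctr 1) (ctr 2))))) <|
  .seq (.existsTable 18 (.both (.live (ctr 0)) (.both (.live (ctr 1)) (.both
    (.rel 1 (ctr 0) (ctr 1)) (.or (.neg (.inner (ctr 1))) (.both (.inner (ctr 0))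
      (.or (.lt (.read 17 (ctr 0) (ctr 1)) (.read 17 (ctr 1) (ctr 0)))
        (.both (.eq (.read 17 (ctr 0) (ctr 1)) (.read 17 (ctr 1) (ctr 0)))
          (.lt (ctr 0) (ctr 1)))))))))) <|
  .existsTable 19 (.or (.both (.eq (ctr 0) (ctr 1)) (.live (ctr 0))) (.both
    (.rel 18 (ctr 0) (ctr 2)) (.both (.neg (.rel 16 (ctr 2) (ctr 1))) (.rel 8 (ctr 0) (ctr 1)))))

/-- The vertex `u` is live, and it is `t` or it tears `t`. -/
def Marks (G : SimpleGraph (Fin n)) (B : Fin n → Set (Fin n)) (col : Fin n → ℕ) (u t : Fin n) :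
    Prop :=
  (u = t ∧ Live G B u) ∨ ∃ y, Beats G B col u y ∧ t ∈ starCut G B u ∧ t ∈ owned G B col y

theorem inner_iff {u : Fin n} :
    Inner G B u ↔ Live G B u ∧ 2 ≤ {k | Live G B k ∧ G.Adj u k}.ncard := by
  refine and_congr_right fun _ => ?_
  rw [show (2 ≤ {k | Live G B k ∧ G.Adj u k}.ncard) ↔ 1 < {k | Live G B k ∧ G.Adj u k}.ncard
    from Iff.rfl, Set.one_lt_ncard (Set.toFinite _)]
  constructor
  · rintro ⟨c, c', hne, h1, h2, h3, h4⟩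
    exact ⟨c, ⟨h1, h3⟩, c', ⟨h2, h4⟩, hne⟩
  · rintro ⟨c, ⟨h1, h3⟩, c', ⟨h2, h4⟩, hne⟩
    exact ⟨c, c', hne, h1, h2, h3, h4⟩

theorem halts_tears {col : Fin n → ℕ} {s : State} (hs : HasColors s G B col) :
    Halts Prog.tears s (5 * tableCost n n)
      (fun s' => HasColors s' G B col ∧ Represents s' 19 (Marks G B col)) := by
  have hcost : 5 * tableCost n n = tableCost n n + (tableCost n n + (tableCost n n +
    (tableCost n n + tableCost n n))) := by ring
  rw [hcost]
  refine Halts.seq (halts_countTable (by decide) (by decide) hs.graph.1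
    (fun u _ k => Live G B k ∧ G.Adj u k) ?_) ?_
  · intro i j k σ hσ h0 h1 h2
    have hS := hs.keep hσ
    simp only [Test.both_holds, Test.rel_holds, ctr_eval, h0, h2, hS.graph.represents i k,
      live_holds hS.toHasSides (e := ctr 2) (x := k) (by rw [ctr_eval, h2])]
  rintro s₁ ⟨k₁, h15⟩
  simp only [one_mul] at h15
  have hs₁ := hs.keep k₁
  refine Halts.seq (halts_existsTable (by decide) (by decide) hs₁.graph.1
    (R := fun v x => ∃ y, x ∉ smallSide G B v ∨ (Live G B y ∧
      s₁.nat 14 (n - 1) y = s₁.nat 14 (n - 1) v ∧ y < v ∧ x ∈ smallSide G B y))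
    (fun v x y => x ∉ smallSide G B v ∨ (Live G B y ∧
      s₁.nat 14 (n - 1) y = s₁.nat 14 (n - 1) v ∧ y < v ∧ x ∈ smallSide G B y)) ?_
    (fun _ _ => Iff.rfl)) ?_
  · intro i j k σ hσ h0 h1 h2
    have hS := hs₁.keep hσ
    simp only [Test.both_holds, Test.or_holds, Test.neg_holds, Test.rel_holds, Test.lt_holds,
      Test.eq_holds, ctr_eval, h0, h1, h2, hS.small i j, hS.small k j,
      live_holds hS.toHasSides (e := ctr 2) (x := k) (by rw [ctr_eval, h2]),
      color_eval hS (e := ctr 2) (x := k) (by rw [ctr_eval, h2]),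
      color_eval hS (e := ctr 0) (x := i) (by rw [ctr_eval, h0]), Fin.val_fin_lt,
      hσ.nat 14 (by decide) (by decide)]
  rintro s₂ ⟨k₂, h16'⟩
  have hs₂ := hs₁.keep k₂
  have h16 : ∀ v x : Fin n, Live G B v → (1 ≤ s₂.nat 16 v x ↔ x ∉ owned G B col v) := by
    intro v x hv
    rw [h16' v x]
    constructor
    · rintro ⟨y, h | ⟨hy, hc, hlt, h⟩⟩ ⟨h1, h2⟩
      · exact h h1
      · rw [hs₁.color y hy, hs₁.color v hv] at hc
        exact h2 y hy (by omega) hlt h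
    · intro h
      by_cases hx : x ∈ smallSide G B v
      · by_contra hcon
        push Not at hcon
        refine h ⟨hx, fun y hy hc hlt => (hcon y).2 hy ?_ hlt⟩
        rw [hs₁.color y hy, hs₁.color v hv, hc]
      · exact ⟨v, Or.inl hx⟩
  refine Halts.seq (halts_countTable (by decide) (by decide) hs₂.graph.1
    (fun u y k => k ∈ starCut G B u ∧ ¬ 1 ≤ s₂.nat 16 y k) ?_) ?_
  · intro i j k σ hσ h0 h1 h2
    have hS := hs₂.keep hσ
    simp only [Test.both_holds, Test.rel_holds, Test.neg_holds, ctr_eval, h0, h1, h2, hS.cut i k,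
      hσ.nat 16 (by decide) (by decide)]
  rintro s₃ ⟨k₃, h17'⟩
  simp only [one_mul] at h17'
  have hs₃ := hs₂.keep k₃
  have h17 : ∀ u y : Fin n, Live G B y → s₃.nat 17 u y = crossCount G B col u y := by
    intro u y hy
    rw [h17' u y]
    unfold crossCount
    congr 1
    ext k
    simp only [Set.mem_ofPred_eq, Set.mem_inter_iff, h16 y k hy, not_not]
  have h15₃ : ∀ i j : Fin n, s₃.nat 15 i j = {k | Live G B k ∧ G.Adj i k}.ncard := by
    rw [k₃.nat 15 (by decide) (by decide), k₂.nat 15 (by decide) (by decide)]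
    exact h15
  refine Halts.seq (halts_existsTable (by decide) (by decide) hs₃.graph.1
    (R := Beats G B col) (fun u y _ => Beats G B col u y) ?_
    (fun u y => ⟨fun h => ⟨u, h⟩, fun ⟨_, h⟩ => h⟩)) ?_
  · intro i j k σ hσ h0 h1 h2
    have hS := hs₃.keep hσ
    have hin : ∀ (e : NExpr) (x : Fin n), e.eval σ = x → ((Test.inner e).holds σ ↔
        Inner G B x) := by
      intro e x hx
      rw [inner_iff]
      simp only [Test.inner, Test.both_holds, live_holds hS.toHasSides hx]
      simp only [Test.holds, NExpr.eval, hx, hσ.nat 15 (by decide) (by decide), h15₃]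
    have hr : ∀ e f : NExpr, (NExpr.read 17 e f).eval σ = s₃.nat 17 (e.eval σ) (f.eval σ) := by
      intro e f
      rw [← hσ.nat 17 (by decide) (by decide)]
      rfl
    simp only [Test.both_holds, Test.or_holds, Test.rel_holds, Test.neg_holds, Test.lt_holds,
      Test.eq_holds, hr,
      live_holds hS.toHasSides (e := ctr 0) (x := i) (by rw [ctr_eval, h0]),
      live_holds hS.toHasSides (e := ctr 1) (x := j) (by rw [ctr_eval, h1]),
      hin (ctr 0) i (by rw [ctr_eval, h0]), hin (ctr 1) j (by rw [ctr_eval, h1]), ctr_eval, h0, h1,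
      hS.graph.represents i j, Fin.val_fin_lt]
    refine and_congr_right fun hi => and_congr_right fun hj => ?_
    rw [h17 i j hj, h17 j i hi]
  rintro s₄ ⟨k₄, h18⟩
  have hs₄ := hs₃.keep k₄
  have h16₄ : ∀ v x : Fin n, Live G B v → (1 ≤ s₄.nat 16 v x ↔ x ∉ owned G B col v) := by
    rw [k₄.nat 16 (by decide) (by decide), k₃.nat 16 (by decide) (by decide)]
    exact h16
  refine (halts_existsTable (by decide) (by decide) hs₄.graph.1
    (R := Marks G B col) (fun u t y => (u = t ∧ Live G B u) ∨ (Beats G B col u y ∧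
      t ∈ owned G B col y ∧ t ∈ starCut G B u)) ?_ ?_).mono le_rfl ?_
  · intro i j k σ hσ h0 h1 h2
    have hS := hs₄.keep hσ
    simp only [Test.both_holds, Test.or_holds, Test.rel_holds, Test.neg_holds, Test.eq_holds,
      live_holds hS.toHasSides (e := ctr 0) (x := i) (by rw [ctr_eval, h0]), ctr_eval, h0, h1, h2,
      hS.cut i j, (h18.keep hσ) i k, Fin.val_inj, hσ.nat 16 (by decide) (by decide)]
    refine or_congr_right (and_congr_right fun hb => ?_)
    rw [h16₄ k j hb.2.1, not_not]
  · intro u t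
    constructor
    · rintro (h | ⟨y, h1, h2, h3⟩)
      · exact ⟨u, Or.inl h⟩
      · exact ⟨y, Or.inr ⟨h1, h3, h2⟩⟩
    · rintro ⟨y, h | ⟨h1, h2, h3⟩⟩
      · exact Or.inl h
      · exact Or.inr ⟨y, h1, h3, h2⟩
  · rintro s₅ ⟨k₅, h19⟩
    exact ⟨hs₄.keep k₅, h19⟩

/-- Array `2`: the labels of the live and of the torn vertices. -/
def Prog.output : Prog :=
  .table 2 (.const 0) size
    (.both (.rel 19 (ctr 2) (ctr 0)) (.eq (.color (ctr 2)) (.const 1)))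
    (.succ (.read 11 (ctr 0) (ctr 0)))
    (.rel 19 (ctr 2) (ctr 0)) (.succ (.succ (.read 11 (ctr 0) (ctr 0))))

theorem halts_output {col : Fin n → ℕ} (S : LiveColoring G B col) {s : State}
    (hs : HasColors s G B col) (h19 : Represents s 19 (Marks G B col)) :
    Halts Prog.output s (tableCost n n)
      (fun s' => OutputLabel G B col (fun x => s'.nat 2 x 0)) := by
  have hlive : ∀ u t, Marks G B col u t → Live G B u := by
    rintro u t (h | ⟨y, h, -⟩)
    · exact h.2
    · exact h.1
  refine (halts_table (n := n) (b := n) (by decide) (by decide) hs.graph.1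
    (fun t _ v => ∀ ht : t < n, (∀ u, Marks G B col u ⟨t, ht⟩ → v ≠ 0) ∧
      (v ≠ 0 → ∃ u, Marks G B col u ⟨t, ht⟩ ∧ v = 2 * killRank G B ⟨t, ht⟩ + col u + 1))
    (fun t _ k v => ∀ ht : t < n, (∀ u : Fin n, u.1 < k → Marks G B col u ⟨t, ht⟩ → v ≠ 0) ∧
      (v ≠ 0 → ∃ u, Marks G B col u ⟨t, ht⟩ ∧ v = 2 * killRank G B ⟨t, ht⟩ + col u + 1))
    ?_ ?_ ?_ ?_).mono le_rfl ?_
  · intro σ hσ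
    rw [size_eval, (hs.graph.keep hσ).1]
  · intro t _ j _ σ _ ht
    simp [NExpr.eval]
  · intro t _ j _ k hk σ hσ h2 hΨ ht
    obtain ⟨h3, h4⟩ := hΨ ht
    have hS := hs.keep hσ.toKeeps
    have hm : (Test.rel 19 (ctr 2) (ctr 0)).holds σ ↔ Marks G B col ⟨k, hk⟩ ⟨t, ht⟩ := by
      have := (h19.keep hσ.toKeeps) ⟨k, hk⟩ ⟨t, ht⟩
      simp only at this
      simp only [Test.rel_holds, ctr_eval, hσ.row, h2, this]
    have hr : (NExpr.read 11 (ctr 0) (ctr 0)).eval σ = 2 * killRank G B ⟨t, ht⟩ := by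
      rw [← hS.rank ⟨t, ht⟩ ⟨t, ht⟩]
      simp only [NExpr.eval, ctr_eval, hσ.row]
    have hc : Marks G B col ⟨k, hk⟩ ⟨t, ht⟩ → (NExpr.color (ctr 2)).eval σ = col ⟨k, hk⟩ + 1 :=
      fun h => by
        rw [color_eval hS (e := ctr 2) (x := ⟨k, hk⟩) (by rw [ctr_eval, h2]),
          hS.color _ (hlive _ _ h)]
    have hlt := S.lt_two ⟨k, hk⟩
    have hb : (Test.both (.rel 19 (ctr 2) (ctr 0)) (.eq (.color (ctr 2)) (.const 1))).holds σ ↔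
        Marks G B col ⟨k, hk⟩ ⟨t, ht⟩ ∧ (NExpr.color (ctr 2)).eval σ = 1 := by
      rw [Test.both_holds, hm, Test.eq_holds]
      rfl
    by_cases hM : Marks G B col ⟨k, hk⟩ ⟨t, ht⟩
    · have hcM := hc hM
      by_cases h1 : (NExpr.color (ctr 2)).eval σ = 1
      · rw [if_pos (hb.2 ⟨hM, h1⟩)]
        change (∀ u : Fin n, _ → _ → (NExpr.read 11 (ctr 0) (ctr 0)).eval σ + 1 ≠ 0) ∧
          ((NExpr.read 11 (ctr 0) (ctr 0)).eval σ + 1 ≠ 0 → ∃ u, _ ∧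
            (NExpr.read 11 (ctr 0) (ctr 0)).eval σ + 1 = _)
        rw [hr]
        exact ⟨fun _ _ _ => by omega, fun _ => ⟨_, hM, by omega⟩⟩
      · rw [if_neg (fun h => h1 (hb.1 h).2), if_pos (hm.2 hM)]
        change (∀ u : Fin n, _ → _ → (NExpr.read 11 (ctr 0) (ctr 0)).eval σ + 1 + 1 ≠ 0) ∧
          ((NExpr.read 11 (ctr 0) (ctr 0)).eval σ + 1 + 1 ≠ 0 → ∃ u, _ ∧
            (NExpr.read 11 (ctr 0) (ctr 0)).eval σ + 1 + 1 = _)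
        rw [hr]
        exact ⟨fun _ _ _ => by omega, fun _ => ⟨_, hM, by omega⟩⟩
    · rw [if_neg (fun h => hM (hb.1 h).1), if_neg (mt hm.1 hM)]
      refine ⟨fun u hu hmu => ?_, h4⟩
      rcases Nat.lt_succ_iff_lt_or_eq.1 hu with h5 | h5
      · exact h3 u h5 hmu
      · obtain rfl : u = ⟨k, hk⟩ := Fin.ext h5
        exact absurd hmu hM
  · intro t _ j _ v hΨ ht
    obtain ⟨h1, h2⟩ := hΨ ht
    exact ⟨fun u => h1 u u.2, h2⟩
  · rintro s' ⟨-, hΦ⟩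
    have hcell : ∀ x : Fin n, (∀ u, Marks G B col u x → s'.nat 2 x 0 ≠ 0) ∧
        (s'.nat 2 x 0 ≠ 0 → ∃ u, Marks G B col u x ∧
          s'.nat 2 x 0 = 2 * killRank G B x + col u + 1) :=
      fun x => hΦ x x.2 0 (by have := x.2; omega) x.2
    refine ⟨fun x hx => ?_, fun x hx => ?_, fun x hx hx' => ?_⟩
    · obtain ⟨u, hu, h⟩ := (hcell x).2 ((hcell x).1 x (Or.inl ⟨rfl, hx⟩))
      rcases hu with ⟨rfl, -⟩ | ⟨y, hb, -, hy⟩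
      · rw [h, IsHaven.live_iff_killRank.1 hx]
        omega
      · exact absurd hx (IsHaven.not_live_of_small hb.2.1 hy.1)
    · have hx' := hx
      obtain ⟨u, y, hb, h1, h2⟩ := hx'
      obtain ⟨u', hu', h⟩ := (hcell x).2 ((hcell x).1 u (Or.inr ⟨y, hb, h1, h2⟩))
      rcases hu' with ⟨rfl, hl⟩ | ⟨y', hb', h1', h2'⟩
      · exact absurd hl (not_live_of_torn hx)
      · exact ⟨u', y', hb', h1', h2', h⟩
    · by_contra h
      obtain ⟨u, hu, -⟩ := (hcell x).2 h
      rcases hu with ⟨rfl, hl⟩ | ⟨y, hb, h1, h2⟩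
      · exact hx hl
      · exact hx' ⟨u, y, hb, h1, h2⟩

end Program

/-! ### The running time -/

section Final

variable {n : ℕ} {G : SimpleGraph (Fin n)}

/-- The whole algorithm. -/
def Prog.separator (δ : ℕ) : Prog :=
  .seq .lists (.seq (.heavy δ) (.seq .sides (.seq .colors (.seq .tears .output))))

theorem tableCost_le {n : ℕ} (hn : 0 < n) : tableCost n n ≤ 16 * n ^ 3 := by
  obtain ⟨m, rfl⟩ : ∃ m, n = m + 1 := ⟨n - 1, by omega⟩
  have h : 16 * (m + 1) ^ 3 = tableCost (m + 1) (m + 1) + (11 * m ^ 3 + 28 * m ^ 2 + 19 * m) := by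
    unfold tableCost
    ring
  omega

theorem heavyCost_le {n : ℕ} (hn : 0 < n) (δ : ℕ) :
    n * (tableCost n δ + (n * (1 + ((n * (2 + 2) + 2) + 2) + 2) + 2) + 2) + 2 ≤
      (5 * δ + 30) * n ^ 3 := by
  obtain ⟨m, rfl⟩ : ∃ m, n = m + 1 := ⟨n - 1, by omega⟩
  have h : (5 * δ + 30) * (m + 1) ^ 3 = ((m + 1) * (tableCost (m + 1) δ +
      ((m + 1) * (1 + (((m + 1) * (2 + 2) + 2) + 2) + 2) + 2) + 2) + 2) +
      (21 * m ^ 3 + 52 * m ^ 2 + 35 * m + 2) := by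
    unfold tableCost
    ring
  omega

/-- The colouring of the live vertices can be normalised so that the least live vertex has
colour `0`, which is where the algorithm starts. -/
theorem exists_min_coloring {B : Fin n → Set (Fin n)} {w : Fin n → ℝ} {c : ℝ} {d : ℕ}
    (hconn : G.Connected) (hG : PawFriendly G) (hw : ∀ v, 0 ≤ w v) (hsum : ∑ v, w v = 1)
    (hc : 1 / 2 ≤ c) (hB : HeavySide G w c B) (hd : 3 ≤ d)
    (hno : ¬ ∃ X : Set (Fin n), IsBounded G d X ∧ IsBalancedSeparator G w c X) :
    ∃ (col : Fin n → ℕ) (a : Fin n), LiveColoring G B col ∧ Live G B a ∧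
      (∀ x, Live G B x → a ≤ x) ∧ col a = 0 ∧
      ∀ x, Live G B x → (liveGraph G B).Reachable x a := by
  have H := hB.isHaven hw hsum hc
  obtain ⟨x₀⟩ := hconn.nonempty
  have hex : ∃ x, Live G B x := by
    by_cases hl : Live G B x₀
    · exact ⟨x₀, hl⟩
    · obtain ⟨v, hv, -⟩ := H.exists_live_of_not_live hl
      exact ⟨v, hv⟩
  obtain ⟨a, ha, hmin⟩ := (wellFounded_lt (α := Fin n)).has_min {x | Live G B x} hex
  obtain ⟨s, hs, hs'⟩ := hB.exists_coloring hw hsum hc hconn hd hno hG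
  refine ⟨fun v => (s v + s a) % 2, a, ?_, ha, fun x hx => not_lt.1 (hmin x hx), by
    simp only; omega, fun x hx => ?_⟩
  · refine hB.liveColoring hw hsum hc hconn hd hno (fun v => Nat.mod_lt _ (by decide))
      fun u v hu hv huv => ?_
    have := hs' u v hu hv huv
    omega
  · refine (live_subset_of_closed hconn H (β := {x | Live G B x ∧ (liveGraph G B).Reachable x a})
      ⟨a, ha, SimpleGraph.Reachable.refl a⟩ (fun u hu => hu.1) (fun u hu v hv huv => ⟨hv, ?_⟩) hx).2
    exact SimpleGraph.Reachable.trans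
      (SimpleGraph.Adj.reachable ⟨huv.symm, hv, hu.1⟩) hu.2

theorem halts_separator [DecidableRel G.Adj] {B : Fin n → Set (Fin n)} {w : Fin n → ℝ} {c : ℝ}
    {δ : ℕ} (hδ : ∀ v, (G.neighborSet v).ncard ≤ δ) (hw : ∀ v, 0 ≤ w v) (hsum : ∑ v, w v = 1)
    (hc : 1 / 2 ≤ c) (hB : HeavySide G w c B) {col : Fin n → ℕ} {a : Fin n}
    (S : LiveColoring G B col) (ha : Live G B a) (hmin : ∀ x, Live G B x → a ≤ x)
    (hcol : col a = 0) (hreach : ∀ x, Live G B x → (liveGraph G B).Reachable x a) :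
    Halts (Prog.separator δ) (inputState G w c) ((5 * δ + 254) * n ^ 3)
      (fun s' => OutputLabel G B col (fun x => s'.nat 2 x 0)) := by
  have hn : 0 < n := by have := a.2; omega
  refine Halts.mono (K := (tableCost n n + tableCost n n) +
    ((n * (tableCost n δ + (n * (1 + ((n * (2 + 2) + 2) + 2) + 2) + 2) + 2) + 2) +
    (4 * tableCost n n + (2 * tableCost n n + (5 * tableCost n n + tableCost n n))))) ?_ ?_
    (fun _ h => h)
  · refine Halts.seq (halts_lists hδ (hasGraph_inputState w c)) fun s₁ h₁ => ?_
    have hin : HasInput s₁ G δ w c := by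
      refine ⟨h₁.1, h₁.2.2, fun x => ?_, ?_⟩
      · rw [h₁.2.1]
        simp [inputState]
      · rw [h₁.2.1]
        simp [inputState]
    refine Halts.seq (halts_heavy hB hw hsum hc hin) fun s₂ h₂ => ?_
    refine Halts.seq (halts_sides h₂.1 h₂.2) fun s₃ h₃ => ?_
    refine Halts.seq (halts_colors S ha hmin hcol hreach h₃) fun s₄ h₄ => ?_
    refine Halts.seq (halts_tears h₄) fun s₅ h₅ => ?_
    exact halts_output S h₅.1 h₅.2
  · have h1 := tableCost_le hn
    have h2 := heavyCost_le hn δ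
    have h3 : (5 * δ + 254) * n ^ 3 = 14 * (16 * n ^ 3) + (5 * δ + 30) * n ^ 3 := by ring
    omega

end Final

end EvenSep

theorem lemma8p1 (c : ℝ) (hc : 1 / 2 ≤ c) (hc' : c < 1) (d δ : ℕ) (hd : 0 < d) (hδ : 0 < δ)
    (hdδ : δ + 3 ≤ d) :
    ∃ (P : EvenSep.Prog) (C : ℕ),
      ∀ (n : ℕ) (G : SimpleGraph (Fin n)) [DecidableRel G.Adj] (w : Fin n → ℝ),
        G.Connected → EvenSep.PawFriendly G → G.maxDegree ≤ δ →
        (∀ v, w v ∈ Set.Icc (0 : ℝ) 1) → ∑ v, w v = 1 →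
        (¬ ∃ X : Set (Fin n),
          EvenSep.IsBounded G d X ∧ EvenSep.IsBalancedSeparator G w c X) →
        ∃ L : Fin (δ ^ 2 + 2) → Set (Fin n),
          EvenSep.IsEvenSetSeparator G w (δ ^ 2 + 2) c (δ + 1) L ∧
          ∃ (t : ℕ) (s : EvenSep.State),
            EvenSep.Runs P (EvenSep.inputState G w c) t s ∧ t ≤ C * n ^ 3 ∧
            EvenSep.outputSets n (δ ^ 2 + 2) s = L := by
  refine ⟨EvenSep.Prog.separator δ, 5 * δ + 254, fun n G _ w hconn hG hdeg hw hsum hno => ?_⟩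
  have hw0 : ∀ v, 0 ≤ w v := fun v => (hw v).1
  have hdeg' : ∀ v, (G.neighborSet v).ncard ≤ δ := by
    intro v
    rw [Set.ncard_eq_toFinset_card']
    exact (G.degree_le_maxDegree v).trans hdeg
  obtain ⟨B, hB⟩ := EvenSep.exists_heavySide (by omega) hno
  obtain ⟨col, a, S, ha, hmin, hcol, hreach⟩ :=
    EvenSep.exists_min_coloring hconn hG hw0 hsum hc hB (by omega) hno
  obtain ⟨t, s, hrun, ht, hout⟩ :=
    EvenSep.halts_separator hdeg' hw0 hsum hc hB S ha hmin hcol hreach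
  exact ⟨EvenSep.outputSets n (δ ^ 2 + 2) s,
    hout.isEvenSetSeparator hw0 hsum hc hB S hG.1.evenHoles (hB.pawsBroken hG) hdeg',
    t, s, hrun, ht, rfl⟩
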